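/- **Notation.** Let $0<a<c$ be coprime integers, $\zeta_n:=e^{2\pi i/n}$, and $(q;q)_\infty:=\prod_{n\ge1}(1-q^n)$ for $|q|<1$. Define $$R_2\left(\tfrac ac,q;w\right):=\zeta_{2c}^a\,\frac{e^{\pi i w}}{(q;q)_\infty}\sum_{n\in\mathbb Z}\frac{(-1)^{n+1}q^{\frac n2(3n+1)}}{1-\zeta_c^a e^{2\pi i w}q^n}.$$ For $\frac ac\notin\{\frac16,\frac12,\frac56\}$ let $s=s(a,c):=0,1,2,3$ according as $\frac ac$ lies in $(0,\frac16)$, $(\frac16,\frac12)$, $(\frac12,\frac56)$, $(\frac56,1)$, and, for $q=e^{2\pi i\tau}$ (with $q^{\alpha}:=e^{2\pi i\alpha\tau}$), $$T_2\left(\tfrac ac,q;w\right):=\frac1{(q;q)_\infty}\left(e^{\pi i w}q^{\frac a{2c}}\sum_{m\ge0}(-1)^m\frac{q^{\frac m2(3m+1)+ms}}{1-e^{2\pi i w}q^{\frac ac+m}}-e^{-\pi i w}q^{-\frac a{2c}}\sum_{m\ge1}(-1)^m\frac{q^{\frac m2(3m+1)-ms}}{1-e^{-2\pi i w}q^{-\frac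 ac+m}}\right).$$ Put $$I^{\pm}_{k,\nu,a,c}(z;w):=\pm\int_{\mathbb R}\frac{e^{-\frac{3\pi zx^2}{k}}}{\sinh\left(\frac{\pi zx}{k}+\frac{\pi i}{6k}-\frac{\pi i\nu}{k}\mp\pi i\left(w+\frac ac\right)\right)}\,dx ,$$ and $\omega_{h,k}:=\exp(\pi i\,t(h,k))$, where $t(h,k):=\sum_{\mu \,(\mathrm{mod}\ k)}\left(\left(\frac\mu k\right)\right)\left(\left(\frac{h\mu}k\right)\right)$ is the Dedekind sum, with $((x)):=x-\lfloor x\rfloor-\frac12$ for $x\in\mathbb R\setminus\mathbb Z$ and $((x)):=0$ for $x\in\mathbb Z$. **Theorem 4.2.** Let $h,k,h'$ be integers, $k>0$, $\gcd(h,k)=1$, such that either * $k=1$, $h'=0$ and $\frac ac\notin\{\frac16,\frac12,\frac56\}$, or * $2c^2\mid k$, $hh'\equiv-1\pmod{2k}$ and $h'\equiv1\pmod{2c^2}$. Let $z\in\mathbb C$ with $\mathrm{Re}(z)>0$, and let $q:=e^{\frac{2\pi i}k(h+iz)}$ and $q_1:=e^{\frac{2\pi i}k\left(h'+\frac iz\right)}$,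 where fractional powers of $q_1$ are taken with $\tau=\frac1k\left(h'+\frac iz\right)$. Let $w\in\mathbb C$ be such that, for all $t\in[0,1]$, all $\nu \pmod k$ and both signs, the integrand of $I^\pm_{k,\nu,a,c}(z;tw)$ has no pole on the real line (this holds for all $w$ sufficiently close to $0$), and such that $\zeta_c^ae^{2\pi iw}q^n\ne1$ for all $n\in\mathbb Z$. Then all the series and integrals that occur below converge absolutely, and $$R_2\left(\tfrac ac,q;w\right)=S_1-\frac{z^{\frac12}}{2k}\,\omega_{h,k}\,e^{-\frac{\pi z}{12k}}\sum_{\nu\ (\mathrm{mod}\ k),\ \pm}(-1)^\nu e^{\frac{\pi ih'}k(-3\nu^2+\nu)}\,I^\pm_{k,\nu,a,c}(z;w),$$ where the powers of $z$ are principal and $$S_1:=\begin{cases}-i\,z^{-\frac12}\,e^{\frac\pi{12}(z^{-1}-z)-\frac{2\pi s}z\left(w+\frac ac\right)+\frac{3\pi}z\left(w+\frac ac\right)^2}\,T_2\left(\frac ac,q_1;\frac{iw}z\right)&\text{if }k=1,\\[1ex]-\dfrac i{z^{1/2}}\,\omega_{h,k}\,e^{\frac{3\pi kw^2}z+\frac\pi{12k}(z^{-1}-z)}\,R_2\left(\frac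 ac,q_1;\frac w{iz}\right)&\text{if }2c^2\mid k.\end{cases}$$ (The sum runs over a complete residue system modulo $k$, on the choice of which it does not depend.) -/

import Mathlib

noncomputable section

namespace TwistedRank

/-- The infinite product `(q;q)_∞ = ∏_{n ≥ 1} (1 - q ^ n)`. -/
def qProd (q : ℂ) : ℂ := ∏' n : ℕ, (1 - q ^ (n + 1))

/-- The root of unity `ζ_n = e^{2πi/n}`. -/
def zeta (n : ℕ) : ℂ := Complex.exp (2 * Real.pi * Complex.I / n)

/-- The denominator `1 - ζ_c^a e^{2πiw} q^n`. -/
def R2Den (a c : ℕ) (q w : ℂ) (n : ℤ) : ℂ :=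
  1 - zeta c ^ a * Complex.exp (2 * Real.pi * Complex.I * w) * q ^ n

/-- The `n`-th term of the bilateral series in `R_2(a/c, q; w)`; the exponent `n(3n+1)/2` is an
integer, so the integer division is exact. -/
def R2Term (a c : ℕ) (q w : ℂ) (n : ℤ) : ℂ :=
  (-1) ^ (n + 1) * q ^ (n * (3 * n + 1) / 2) / R2Den a c q w n

/-- `R_2(a/c, q; w)`. -/
def R2 (a c : ℕ) (q w : ℂ) : ℂ :=
  zeta (2 * c) ^ a * (Complex.exp (Real.pi * Complex.I * w) / qProd q) *
    ∑' n : ℤ, R2Term a c q w n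

/-- The integer `s(a,c) ∈ {0,1,2,3}`, which says in which of the intervals `(0,1/6)`, `(1/6,1/2)`,
`(1/2,5/6)`, `(5/6,1)` the number `a/c` lies. -/
def sIndex (a c : ℕ) : ℤ :=
  if (a : ℝ) / c < 1 / 6 then 0
  else if (a : ℝ) / c < 1 / 2 then 1
  else if (a : ℝ) / c < 5 / 6 then 2
  else 3

/-- The sawtooth function `((x))`. -/
def sawtooth (x : ℝ) : ℝ :=
  if Int.fract x = 0 then 0 else x - ⌊x⌋ - 1 / 2

/-- The Dedekind sum `t(h,k)`. -/
def dedekindSum (h : ℤ) (k : ℕ) : ℝ :=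
  ∑ μ ∈ Finset.range k, sawtooth ((μ : ℝ) / k) * sawtooth ((h : ℝ) * μ / k)

/-- `ω_{h,k} = exp(πi t(h,k))`. -/
def omega (h : ℤ) (k : ℕ) : ℂ := Complex.exp (Real.pi * Complex.I * dedekindSum h k)

/-- The power `q^α = e^{2πiατ}` for `q = e^{2πiτ}`. -/
def qPow (τ α : ℂ) : ℂ := Complex.exp (2 * Real.pi * Complex.I * α * τ)

/-- The `m`-th term of the series with sign `ε = ±1` in `T_2(a/c, q; w)`, where `q = e^{2πiτ}`. -/
def T2Term (a c : ℕ) (τ w : ℂ) (ε : ℤ) (m : ℕ) : ℂ :=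
  (-1) ^ m * qPow τ ((m : ℂ) / 2 * (3 * m + 1) + ε * m * sIndex a c) /
    (1 - Complex.exp (ε * (2 * Real.pi * Complex.I * w)) * qPow τ (ε * ((a : ℂ) / c) + m))

/-- `T_2(a/c, q; w)` for `q = e^{2πiτ}`: the sum with the sign `+` is over `m ≥ 0`, the one with the
sign `-` is over `m ≥ 1`. -/
def T2 (a c : ℕ) (τ w : ℂ) : ℂ :=
  1 / qProd (qPow τ 1) *
    (Complex.exp (Real.pi * Complex.I * w) * qPow τ ((a : ℂ) / (2 * c)) *
        ∑' m : ℕ, T2Term a c τ w 1 m -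
      Complex.exp (-(Real.pi * Complex.I * w)) * qPow τ (-((a : ℂ) / (2 * c))) *
        ∑' m : ℕ, T2Term a c τ w (-1) (m + 1))

/-- The denominator of the integrand of `I^±_{k,ν,a,c}(z;w)`, with `ε = ±1` for the sign. -/
def mordellDen (k : ℕ) (ν : ℤ) (a c : ℕ) (ε : ℤ) (z w : ℂ) (x : ℝ) : ℂ :=
  Complex.sinh (Real.pi * z * x / k + Real.pi * Complex.I / (6 * k) - Real.pi * Complex.I * ν / k -
    ε * (Real.pi * Complex.I * (w + (a : ℂ) / c)))

/-- The integrand of `I^±_{k,ν,a,c}(z;w)`. -/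
def mordellIntegrand (k : ℕ) (ν : ℤ) (a c : ℕ) (ε : ℤ) (z w : ℂ) (x : ℝ) : ℂ :=
  Complex.exp (-(3 * Real.pi * z * (x : ℂ) ^ 2 / k)) / mordellDen k ν a c ε z w x

/-- The Mordell-type integral `I^±_{k,ν,a,c}(z;w)`, with `ε = ±1` for the sign. -/
def mordellI (k : ℕ) (ν : ℤ) (a c : ℕ) (ε : ℤ) (z w : ℂ) : ℂ :=
  ε * ∫ x : ℝ, mordellIntegrand k ν a c ε z w x

/-- The explicit term `S_1`, for `τ₁ = (h' + i/z)/k` and `q₁ = e^{2πiτ₁}`. -/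
def S1 (a c k : ℕ) (h h' : ℤ) (z w : ℂ) : ℂ :=
  if k = 1 then
    -Complex.I * z ^ (-(1 / 2) : ℂ) *
      Complex.exp (Real.pi / 12 * (z⁻¹ - z) -
        2 * Real.pi * sIndex a c / z * (w + (a : ℂ) / c) +
        3 * Real.pi / z * (w + (a : ℂ) / c) ^ 2) *
      T2 a c ((h' + Complex.I / z) / k) (Complex.I * w / z)
  else
    -(Complex.I / z ^ (1 / 2 : ℂ)) * omega h k *
      Complex.exp (3 * Real.pi * k * w ^ 2 / z + Real.pi / (12 * k) * (z⁻¹ - z)) *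
      R2 a c (Complex.exp (2 * Real.pi * Complex.I / k * (h' + Complex.I / z))) (w / (Complex.I * z))

end TwistedRank

end

open Complex Filter Topology MeasureTheory
noncomputable section
namespace TwistedRank

/-! Up to a constant and the factor `qProd q`, the left side is the Appell-type series A(v) = ∑
(-1)^n q^(3n²/2) / sin π(v + nτ) at v = w + a/c (`R2_eq_appell`), and the main term S₁ comes from a
series of the same shape at τ₁ = (h' + i/z)/k. The core is an identity between meromorphic functions
of w: `transformDefect`, which is A(v) minus i/z times a Gaussian multiple of the dual series at
iv/z plus theta-weighted Mordell integrals, vanishes identically (`transformDefect_eq_zero`).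

Three facts force this. An integral matrix of determinant 1 matches the poles of the two series, and
their residues cancel (`modPt_transform`, `residue_match`), so all singularities are removable.
Under w ↦ w + 1 the function changes sign: A does so by itself; for the dual series the sum of
shifted and unshifted values collapses, by a finite geometric sum, to 3k theta values times
Gaussians (`appellDual_add_one`); each Mordell integral, continued to an entire function, satisfies
a functional equation whose right side is a single residue (`mordellExt_add_one`), and these
residues are the same Gaussians. Finally the function is bounded on equally spaced horizontal lines
that avoid the poles. Periodicity of the norm and Phragmén–Lindelöf extend the bound to the plane,
Liouville makes the function constant, and an antiperiodic constant is 0.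

The integer s is a free parameter that selects a window of 3k consecutive odd numbers j. The
functional equation needs a/c - j/(6k) in (0,1) for every j in the window not divisible by 3. For k
= 1 this singles out `sIndex`; for 2c² ∣ k the choice s = 3ka/c works and also folds the dual series
back to R₂ (`appellDual_three_mul`).

It remains to divide by Euler products and to name the coefficients. Dedekind's formula
`qProd_modPt` is obtained by Euclidean descent on k from η(-1/τ) and the reciprocity law. The theta
values vanish for 3 ∣ j and otherwise reduce to `qProd` by the pentagonal number theorem, so the
window regroups into the pairs ±(6ν - 1) modulo 6k (`sum_mordellTerm`). The hypothesis on the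
segment from 0 to w keeps poles off the contour, so that the continued integrals are the actual ones
(`integral_eq_mordellExt`). -/

/-- The bilateral series `∑ c_m / sin (π (v + m τ))`. -/
def appell (c : ℤ → ℂ) (τ v : ℂ) : ℂ := ∑' m : ℤ, c m / Complex.sin (Real.pi * (v + m * τ))

/-! ### The bilateral series: convergence, poles and residues. -/

/-- This comes from |sin(x + iy)|² = sin² x + sinh² y. It supplies the lower bounds for the
denominators far from their zeros, here and, after rotation by i, for sinh. -/
lemma sinh_abs_im_le_norm_sin (x : ℂ) : Real.sinh |x.im| ≤ ‖Complex.sin x‖ := by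
  have h : ‖Complex.sin x‖ ^ 2 = Real.sin x.re ^ 2 + Real.sinh x.im ^ 2 := by
    rw [← Complex.normSq_eq_norm_sq, Complex.normSq_apply, Complex.sin_eq]
    simp only [← Complex.ofReal_sin, ← Complex.ofReal_cos, ← Complex.ofReal_sinh,
      ← Complex.ofReal_cosh, ← Complex.ofReal_mul, Complex.add_re, Complex.add_im,
      Complex.ofReal_re, Complex.ofReal_im, Complex.mul_re, Complex.mul_im, Complex.I_re,
      Complex.I_im]
    have h1 := Real.cosh_sq x.im
    have h2 := Real.sin_sq_add_cos_sq x.re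
    ring_nf
    rw [h1]
    linear_combination (Real.sinh x.im ^ 2) * h2
  have h3 : Real.sinh |x.im| ^ 2 = Real.sinh x.im ^ 2 := by
    rcases abs_choice x.im with h | h <;> rw [h]
    rw [Real.sinh_neg]; ring
  refine le_of_sq_le_sq ?_ (norm_nonneg _)
  nlinarith [sq_nonneg (Real.sin x.re)]

lemma one_le_norm_sin {x : ℂ} (hx : 1 ≤ |x.im|) : 1 ≤ ‖Complex.sin x‖ :=
  (hx.trans (Real.self_le_sinh_iff.2 (abs_nonneg _))).trans (sinh_abs_im_le_norm_sin x)

lemma pi_mul_im (v τ : ℂ) (m : ℤ) :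
    ((Real.pi : ℂ) * (v + m * τ)).im = Real.pi * (v.im + m * τ.im) := by
  simp

lemma finite_abs_im_lt {τ : ℂ} (hτ : 0 < τ.im) (v : ℂ) (C : ℝ) :
    {m : ℤ | |v.im + m * τ.im| < C}.Finite := by
  refine Set.Finite.subset (Set.finite_Icc (-⌈(C + |v.im|) / τ.im⌉) ⌈(C + |v.im|) / τ.im⌉) ?_
  intro m hm
  simp only [Set.mem_ofPred_eq] at hm
  have h1 : |(m : ℝ)| ≤ (C + |v.im|) / τ.im := by
    rw [le_div_iff₀ hτ]
    have : |(m : ℝ)| * τ.im = |m * τ.im| := by rw [abs_mul, abs_of_pos hτ]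
    rw [this]
    have := abs_add_le (v.im + m * τ.im) (-v.im)
    rw [abs_neg] at this
    have h2 : v.im + m * τ.im + -v.im = m * τ.im := by ring
    rw [h2] at this
    linarith
  have h2 := h1.trans (Int.le_ceil _)
  have h3 := abs_le.1 h2
  exact ⟨by exact_mod_cast h3.1, by exact_mod_cast h3.2⟩

lemma summable_appell {c : ℤ → ℂ} (hc : Summable fun m => ‖c m‖) {τ : ℂ} (hτ : 0 < τ.im) (v : ℂ) :
    Summable fun m : ℤ => c m / Complex.sin (Real.pi * (v + m * τ)) := by
  refine Summable.of_norm_bounded_eventually hc ?_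
  refine (finite_abs_im_lt hτ v 1).subset ?_
  intro m hm
  by_contra hlt
  simp only [Set.mem_ofPred_eq, not_lt] at hlt
  refine hm ?_
  change ‖c m / Complex.sin (Real.pi * (v + m * τ))‖ ≤ ‖c m‖
  rw [norm_div]
  refine div_le_self (norm_nonneg _) (one_le_norm_sin ?_)
  rw [pi_mul_im, abs_mul, abs_of_pos Real.pi_pos]
  nlinarith [Real.pi_gt_three]

/-- `sin (π x)` vanishes exactly at the integers. -/
lemma sin_pi_mul_eq_zero_iff (x : ℂ) : Complex.sin (Real.pi * x) = 0 ↔ ∃ r : ℤ, x = r := by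
  rw [Complex.sin_eq_zero_iff]
  have : (Real.pi : ℂ) ≠ 0 := by exact_mod_cast Real.pi_ne_zero
  constructor
  · rintro ⟨k, hk⟩
    exact ⟨k, mul_left_cancel₀ this (by rw [hk]; ring)⟩
  · rintro ⟨k, hk⟩
    exact ⟨k, by rw [hk]; ring⟩

/-- Only finitely many indices come near the real axis, and each of their sines is nonzero at v₀ and
continuous. Ignoring indices with `c m = 0` lets the lemma serve at a pole too, once the polar term
has been deleted from the coefficients. -/
lemma exists_le_norm_sin {c : ℤ → ℂ} {τ : ℂ} (hτ : 0 < τ.im) {v₀ : ℂ}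
    (h : ∀ m : ℤ, c m ≠ 0 → ∀ r : ℤ, v₀ + m * τ ≠ r) :
    ∃ δ > 0, ∀ᶠ v in 𝓝 v₀, ∀ m : ℤ, c m ≠ 0 → δ ≤ ‖Complex.sin (Real.pi * (v + m * τ))‖ := by
  classical
  -- The threshold 2 leaves room for v to move by less than 1: indices outside S keep imaginary part
  -- at least 1 on the unit ball about v₀.
  set S := (finite_abs_im_lt hτ v₀ 2).toFinset with hS
  have h1 : ∃ δ : ℝ, 0 < δ ∧ δ ≤ 1 ∧ ∀ᶠ v in 𝓝 v₀, ∀ m ∈ S, c m ≠ 0 →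
      δ ≤ ‖Complex.sin (Real.pi * (v + m * τ))‖ := by
    clear hS
    clear_value S
    induction S using Finset.induction_on with
    | empty => exact ⟨1, one_pos, le_rfl, by simp⟩
    | insert a s ha ih =>
      obtain ⟨δ, hδ, hδ1, hev⟩ := ih
      by_cases hca : c a = 0
      · refine ⟨δ, hδ, hδ1, hev.mono fun v hv m hm hcm => ?_⟩
        rcases Finset.mem_insert.1 hm with rfl | hm
        · exact absurd hca hcm
        · exact hv m hm hcm
      · have hne : 0 < ‖Complex.sin (Real.pi * (v₀ + a * τ))‖ := by
          rw [norm_pos_iff, Ne, sin_pi_mul_eq_zero_iff]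
          rintro ⟨r, hr⟩
          exact h a hca r hr
        have hcont : Continuous fun v : ℂ => ‖Complex.sin (Real.pi * (v + a * τ))‖ := by fun_prop
        have hev2 := hcont.continuousAt.eventually (lt_mem_nhds (half_lt_self hne))
        refine ⟨min δ (‖Complex.sin (Real.pi * (v₀ + a * τ))‖ / 2), by positivity,
          (min_le_left _ _).trans hδ1, ?_⟩
        filter_upwards [hev, hev2] with v hv hv2 m hm hcm
        rcases Finset.mem_insert.1 hm with rfl | hm
        · exact (min_le_right _ _).trans hv2.le
        · exact (min_le_left _ _).trans (hv m hm hcm)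
  obtain ⟨δ, hδ, hδ1, hev⟩ := h1
  refine ⟨δ, hδ, ?_⟩
  filter_upwards [hev, Metric.ball_mem_nhds v₀ one_pos] with v hv hv2 m hcm
  by_cases hm : m ∈ S
  · exact hv m hm hcm
  · refine hδ1.trans (one_le_norm_sin ?_)
    rw [pi_mul_im, abs_mul, abs_of_pos Real.pi_pos]
    have h3 : 2 ≤ |v₀.im + m * τ.im| := by simpa [hS] using hm
    have h4 : |(v₀ - v).im| ≤ ‖v₀ - v‖ := Complex.abs_im_le_norm _
    rw [Metric.mem_ball, dist_comm, dist_eq_norm] at hv2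
    have h5 := abs_sub_abs_le_abs_sub (v₀.im + m * τ.im) (v.im + m * τ.im)
    have h6 : v₀.im + m * τ.im - (v.im + m * τ.im) = (v₀ - v).im := by simp
    rw [h6] at h5
    nlinarith [Real.pi_gt_three]

lemma eventually_differentiableAt_appell {c : ℤ → ℂ} (hc : Summable fun m => ‖c m‖) {τ : ℂ}
    (hτ : 0 < τ.im) {v₀ : ℂ} (h : ∀ m : ℤ, c m ≠ 0 → ∀ r : ℤ, v₀ + m * τ ≠ r) :
    ∀ᶠ v in 𝓝 v₀, DifferentiableAt ℂ (appell c τ) v := by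
  obtain ⟨δ, hδ, hev⟩ := exists_le_norm_sin hτ h
  obtain ⟨ε, hε, hball⟩ := Metric.eventually_nhds_iff_ball.1 hev
  have hd : DifferentiableOn ℂ (appell c τ) (Metric.ball v₀ ε) := by
    unfold appell
    refine differentiableOn_tsum_of_summable_norm (u := fun m => ‖c m‖ / δ) (hc.div_const δ) ?_
      Metric.isOpen_ball ?_
    · intro m
      by_cases hcm : c m = 0
      · simp [hcm]
      · refine DifferentiableOn.div (by fun_prop) (by fun_prop) ?_
        intro v hv h0
        have := hball v hv m hcm
        rw [h0, norm_zero] at this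
        linarith
    · intro m v hv
      by_cases hcm : c m = 0
      · simp [hcm]
      · rw [norm_div]
        exact div_le_div_of_nonneg_left (norm_nonneg _) hδ (hball v hv m hcm)
  filter_upwards [Metric.ball_mem_nhds v₀ hε] with v hv
  exact hd.differentiableAt (Metric.isOpen_ball.mem_nhds hv)

lemma appell_eq_add_update {c : ℤ → ℂ} (hc : Summable fun m => ‖c m‖) {τ : ℂ}
    (hτ : 0 < τ.im) (m₀ : ℤ) (v : ℂ) :
    appell c τ v = c m₀ / Complex.sin (Real.pi * (v + m₀ * τ)) +
      appell (Function.update c m₀ 0) τ v := by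
  rw [appell, (summable_appell hc hτ v).tsum_eq_add_tsum_ite m₀, appell]
  congr 1
  refine tsum_congr fun m => ?_
  by_cases h : m = m₀
  · subst h; simp
  · simp [h]

lemma summable_norm_update {c : ℤ → ℂ} (hc : Summable fun m => ‖c m‖) (m₀ : ℤ) :
    Summable fun m => ‖Function.update c m₀ 0 m‖ := by
  refine hc.of_nonneg_of_le (fun _ => norm_nonneg _) fun m => ?_
  by_cases h : m = m₀
  · subst h; simp
  · simp [h]

/-- Imaginary parts determine the index, so at most one term of the series is singular at a given
point. -/
lemma eq_of_add_mul_eq {τ : ℂ} (hτ : 0 < τ.im) {v₀ : ℂ} {m m₀ r r₀ : ℤ} (h : v₀ + m * τ = r)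
    (h₀ : v₀ + m₀ * τ = r₀) : m = m₀ := by
  have h1 := congrArg Complex.im h
  have h2 := congrArg Complex.im h₀
  simp at h1 h2
  have h3 : ((m : ℝ) - m₀) * τ.im = 0 := by linarith
  rcases mul_eq_zero.1 h3 with h3 | h3
  · exact_mod_cast sub_eq_zero.1 h3
  · exact absurd h3 hτ.ne'

lemma cos_int_mul_pi' (r : ℤ) : Complex.cos (r * Real.pi) = (-1) ^ r := by
  have := congrArg (fun x : ℝ => (x : ℂ)) (Real.cos_int_mul_pi r)
  push_cast at this
  exact this

lemma sin_int_mul_pi_add (r : ℤ) (t : ℂ) :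
    Complex.sin (Real.pi * (r + t)) = (-1) ^ r * Complex.sin (Real.pi * t) := by
  rw [show (Real.pi : ℂ) * (r + t) = r * Real.pi + Real.pi * t by ring, Complex.sin_add,
    Complex.sin_int_mul_pi, cos_int_mul_pi', zero_mul, zero_add]

lemma tendsto_mul_inv_sin (r : ℤ) (d v₀ : ℂ) (h : v₀ + d = r) :
    Tendsto (fun v : ℂ => (v - v₀) / Complex.sin (Real.pi * (v + d))) (𝓝[≠] v₀)
      (𝓝 ((-1) ^ r / Real.pi)) := by
  have hpi : (Real.pi : ℂ) ≠ 0 := by exact_mod_cast Real.pi_ne_zero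
  have hder : HasDerivAt (fun v : ℂ => Complex.sin (Real.pi * (v + d))) ((-1) ^ r * Real.pi) v₀ := by
    have h1 : HasDerivAt (fun v : ℂ => (Real.pi : ℂ) * (v + d)) Real.pi v₀ := by
      simpa using ((hasDerivAt_id v₀).add_const d).const_mul (Real.pi : ℂ)
    have h2 := h1.csin
    rw [h] at h2
    convert h2 using 2
    rw [← cos_int_mul_pi' r]; congr 1; ring
  have hs := hder.tendsto_slope
  have hne : ((-1 : ℂ) ^ r * Real.pi) ≠ 0 := mul_ne_zero (zpow_ne_zero _ (by norm_num)) hpi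
  have h3 := hs.inv₀ hne
  have h0 : Complex.sin (Real.pi * (v₀ + d)) = 0 := (sin_pi_mul_eq_zero_iff _).2 ⟨r, h⟩
  convert h3 using 2 with v
  · rw [slope_def_field, h0, sub_zero, inv_div]
  · rw [mul_inv, div_eq_mul_inv]
    congr 1
    rw [← inv_zpow]; norm_num

/-- Off an isolated pole, `appell` is differentiable, and its residue is read off from a term. -/
lemma appell_pole {c : ℤ → ℂ} (hc : Summable fun m => ‖c m‖) {τ : ℂ}
    (hτ : 0 < τ.im) {v₀ : ℂ} {m₀ r₀ : ℤ} (h : v₀ + m₀ * τ = r₀) :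
    (∀ᶠ v in 𝓝[≠] v₀, DifferentiableAt ℂ (appell c τ) v) ∧
    Tendsto (fun v => (v - v₀) * appell c τ v) (𝓝[≠] v₀) (𝓝 (c m₀ * (-1) ^ r₀ / Real.pi)) := by
  have hc' := summable_norm_update hc m₀
  have hreg := eventually_differentiableAt_appell hc' hτ (v₀ := v₀) (by
    intro m hm r hr
    have := eq_of_add_mul_eq hτ hr h
    subst this
    simp at hm)
  have hlim := tendsto_mul_inv_sin r₀ (m₀ * τ) v₀ h
  have hne : ∀ᶠ v in 𝓝[≠] v₀, Complex.sin (Real.pi * (v + m₀ * τ)) ≠ 0 := by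
    have hpi : (Real.pi : ℂ) ≠ 0 := by exact_mod_cast Real.pi_ne_zero
    have h1 := hlim.eventually_ne (div_ne_zero (zpow_ne_zero r₀ (by norm_num : (-1 : ℂ) ≠ 0)) hpi)
    filter_upwards [h1] with v hv h0
    rw [h0, div_zero] at hv
    exact hv rfl
  have heq : appell c τ = fun v => c m₀ / Complex.sin (Real.pi * (v + m₀ * τ)) +
      appell (Function.update c m₀ 0) τ v := funext fun v => appell_eq_add_update hc hτ m₀ v
  constructor
  · filter_upwards [hne, hreg.filter_mono nhdsWithin_le_nhds] with v h1 h2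
    rw [heq]
    exact DifferentiableAt.fun_add
      (DifferentiableAt.fun_div (differentiableAt_const _) (by fun_prop) h1) h2
  · have hcont : Tendsto (fun v => (v - v₀) * appell (Function.update c m₀ 0) τ v) (𝓝[≠] v₀)
        (𝓝 0) := by
      have hc1 : ContinuousAt (fun v => (v - v₀) * appell (Function.update c m₀ 0) τ v) v₀ :=
        (by fun_prop : ContinuousAt (fun v => v - v₀) v₀).mul hreg.self_of_nhds.continuousAt
      have := hc1.tendsto.mono_left (nhdsWithin_le_nhds (s := {v₀}ᶜ))
      simpa using this
    have := (hlim.const_mul (c m₀)).add hcont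
    rw [add_zero, ← mul_div_assoc] at this
    refine this.congr fun v => ?_
    rw [appell_eq_add_update hc hτ m₀ v]
    ring

lemma appell_add_int (c : ℤ → ℂ) (τ v : ℂ) (r : ℤ) :
    appell c τ (v + r) = (-1) ^ r * appell c τ v := by
  rw [appell, appell, ← tsum_mul_left]
  refine tsum_congr fun m => ?_
  rw [show v + r + m * τ = r + (v + m * τ) by ring, sin_int_mul_pi_add, mul_comm ((-1 : ℂ) ^ r),
    ← div_div, div_eq_mul_inv _ ((-1 : ℂ) ^ r), ← inv_zpow]
  norm_num
  ring

lemma norm_appell_le {c : ℤ → ℂ} (hc : Summable fun m => ‖c m‖) {τ v : ℂ} {δ : ℝ} (hδ : 0 < δ)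
    (h : ∀ m : ℤ, δ ≤ Real.pi * |v.im + m * τ.im|) :
    ‖appell c τ v‖ ≤ (∑' m, ‖c m‖) / Real.sinh δ := by
  have hs : 0 < Real.sinh δ := Real.sinh_pos_iff.2 hδ
  have h1 : ∀ m : ℤ, ‖c m / Complex.sin (Real.pi * (v + m * τ))‖ ≤ ‖c m‖ / Real.sinh δ := by
    intro m
    rw [norm_div]
    refine div_le_div_of_nonneg_left (norm_nonneg _) hs ?_
    refine le_trans ?_ (sinh_abs_im_le_norm_sin _)
    rw [Real.sinh_le_sinh, pi_mul_im, abs_mul, abs_of_pos Real.pi_pos]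
    exact h m
  rw [← tsum_div_const]
  exact tsum_of_norm_bounded (hc.div_const _).hasSum h1

/-- The coefficients `(-1)^m q^{3m²/2 + s m}`. -/
def gaussCoeff (s : ℤ) (τ : ℂ) (m : ℤ) : ℂ :=
  (-1) ^ m * Complex.exp (Real.pi * Complex.I * τ * (3 * m ^ 2 + 2 * s * m))

lemma neg_one_zpow_eq_exp (m : ℤ) : (-1 : ℂ) ^ m = Complex.exp (Real.pi * Complex.I * m) := by
  rw [← Complex.exp_pi_mul_I, ← Complex.exp_int_mul]; congr 1; ring

lemma norm_neg_one_zpow (m : ℤ) : ‖(-1 : ℂ) ^ m‖ = 1 := by simp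

lemma summable_norm_exp_quadratic {τ : ℂ} (hτ : 0 < τ.im) (j : ℂ) :
    Summable fun m : ℤ => ‖(-1 : ℂ) ^ m *
      Complex.exp (Real.pi * Complex.I * τ * (3 * m ^ 2 + j * m))‖ := by
  have h3 : 0 < (3 * τ).im := by simpa using hτ
  have := ((summable_jacobiTheta₂_term_iff (j * τ / 2) (3 * τ)).2 h3).norm
  refine this.congr fun m => ?_
  rw [norm_mul, norm_neg_one_zpow, one_mul, jacobiTheta₂_term]
  congr 2; ring

lemma summable_norm_gaussCoeff {τ : ℂ} (hτ : 0 < τ.im) (s : ℤ) :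
    Summable fun m => ‖gaussCoeff s τ m‖ := by
  unfold gaussCoeff
  exact summable_norm_exp_quadratic hτ (2 * s)


/-! ### Horizontal contour shifts, without and with a simple pole. -/

/-- Horizontal contour shift: the integrals over two horizontal lines agree if the integrand is
holomorphic in the closed strip between them and tends to `0` at the ends of the strip. -/
lemma integral_strip_sub_eq_zero {f : ℂ → ℂ} {a b : ℝ} (hab : a ≤ b)
    (hd : ∀ x : ℂ, x.im ∈ Set.Icc a b → DifferentiableAt ℂ f x)
    (hdecay : ∀ ε > 0, ∃ R : ℝ, ∀ x : ℝ, R ≤ |x| → ∀ y ∈ Set.Icc a b, ‖f (x + y * I)‖ ≤ ε)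
    (hint : Integrable fun x : ℝ => f (x + a * I) - f (x + b * I)) :
    ∫ x : ℝ, (f (x + a * I) - f (x + b * I)) = 0 := by
  have hlim := intervalIntegral_tendsto_integral hint tendsto_neg_atTop_atBot tendsto_id
  refine tendsto_nhds_unique hlim ?_
  rw [Metric.tendsto_atTop]
  intro ε hε
  have hba : 0 ≤ b - a := by linarith
  -- There are two vertical sides of length b - a; the extra 1 keeps the denominator positive when a
  -- = b and makes the final inequality strict.
  obtain ⟨R, hR⟩ := hdecay (ε / (2 * (b - a) + 1)) (by positivity)
  refine ⟨max R 0, fun T hT => ?_⟩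
  have hT0 : 0 ≤ T := (le_max_right _ _).trans hT
  have hTR : R ≤ T := (le_max_left _ _).trans hT
  have hcont : ∀ y ∈ Set.Icc a b, Continuous fun x : ℝ => f (x + y * I) := by
    intro y hy
    rw [continuous_iff_continuousAt]
    intro x
    exact ContinuousAt.comp (f := fun x : ℝ => (x + y * I : ℂ)) (hd _ (by simpa using hy)).continuousAt
      (by fun_prop)
  have hrect := Complex.integral_boundary_rect_eq_zero_of_differentiableOn f
    (((-T : ℝ) : ℂ) + a * I) ((T : ℝ) + b * I) (by
      intro x hx
      have h1 := (mem_reProdIm.1 hx).2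
      simp only [add_im, ofReal_im, mul_im, ofReal_re, I_im, I_re, mul_zero, mul_one, zero_add,
        add_zero] at h1
      rw [Set.uIcc_of_le hab] at h1
      exact (hd x h1).differentiableWithinAt)
  simp only [add_im, ofReal_im, mul_im, ofReal_re, I_im, I_re, mul_zero, mul_one, zero_add,
        add_zero, add_re, mul_re, sub_zero] at hrect
  have hside : ∀ S : ℝ, |S| = T → ‖∫ y : ℝ in a..b, f (S + y * I)‖ ≤
      ε / (2 * (b - a) + 1) * (b - a) := by
    intro S hS
    have := intervalIntegral.norm_integral_le_of_norm_le_const (a := a) (b := b)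
      (f := fun y : ℝ => f (S + y * I)) (C := ε / (2 * (b - a) + 1)) (by
        intro y hy
        rw [Set.uIoc_of_le hab] at hy
        exact hR S (by rw [hS]; exact hTR) y ⟨hy.1.le, hy.2⟩)
    rwa [abs_of_nonneg hba] at this
  have h1 := hside T (abs_of_nonneg hT0)
  have h2 := hside (-T) (by rw [abs_neg, abs_of_nonneg hT0])
  rw [dist_zero_right, id, intervalIntegral.integral_sub
    ((hcont a ⟨le_rfl, hab⟩).intervalIntegrable _ _) ((hcont b ⟨hab, le_rfl⟩).intervalIntegrable _ _)]
  have h3 : (∫ x : ℝ in -T..T, f (x + a * I)) - (∫ x : ℝ in -T..T, f (x + b * I)) =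
      I * (∫ y : ℝ in a..b, f ((-T : ℝ) + y * I)) - I * (∫ y : ℝ in a..b, f (T + y * I)) := by
    simp only [smul_eq_mul] at hrect
    linear_combination hrect
  rw [h3]
  refine (norm_sub_le _ _).trans_lt ?_
  rw [norm_mul, norm_mul, norm_I, one_mul, one_mul]
  refine (add_le_add h2 h1).trans_lt ?_
  rw [← two_mul, ← mul_assoc, mul_comm (2 : ℝ), mul_assoc, div_mul_eq_mul_div, div_lt_iff₀ (by positivity)]
  nlinarith

lemma integral_strip_eq {f : ℂ → ℂ} {a b : ℝ}
    (hd : ∀ x : ℂ, x.im ∈ Set.uIcc a b → DifferentiableAt ℂ f x)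
    (hdecay : ∀ ε > 0, ∃ R : ℝ, ∀ x : ℝ, R ≤ |x| → ∀ y ∈ Set.uIcc a b, ‖f (x + y * I)‖ ≤ ε)
    (ha : Integrable fun x : ℝ => f (x + a * I)) (hb : Integrable fun x : ℝ => f (x + b * I)) :
    ∫ x : ℝ, f (x + a * I) = ∫ x : ℝ, f (x + b * I) := by
  rcases le_total a b with hab | hab
  · rw [Set.uIcc_of_le hab] at hd hdecay
    have := integral_strip_sub_eq_zero hab hd hdecay (ha.sub hb)
    rw [integral_sub ha hb] at this
    exact sub_eq_zero.1 this
  · rw [Set.uIcc_of_ge hab] at hd hdecay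
    have := integral_strip_sub_eq_zero hab hd hdecay (hb.sub ha)
    rw [integral_sub hb ha] at this
    exact (sub_eq_zero.1 this).symm

lemma integrable_inv_sq_add_sq {δ : ℝ} (hδ : 0 < δ) : Integrable fun t : ℝ => (t ^ 2 + δ ^ 2)⁻¹ := by
  have := (integrable_inv_one_add_sq.comp_div hδ.ne').const_mul (δ ^ 2)⁻¹
  refine this.congr (Eventually.of_forall fun t => ?_)
  simp only
  field_simp
  ring

lemma integral_inv_sq_add_sq {δ : ℝ} (hδ : 0 < δ) :
    ∫ t : ℝ, (t ^ 2 + δ ^ 2)⁻¹ = Real.pi / δ := by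
  have h := Measure.integral_comp_div (fun t : ℝ => (1 + t ^ 2)⁻¹) δ
  rw [integral_univ_inv_one_add_sq, abs_of_pos hδ, smul_eq_mul] at h
  have h2 : (fun t : ℝ => (t ^ 2 + δ ^ 2)⁻¹) = fun t : ℝ => (δ ^ 2)⁻¹ * (1 + (t / δ) ^ 2)⁻¹ := by
    funext t; field_simp; ring
  rw [h2, integral_const_mul, h]
  field_simp

lemma inv_sub_inv_conj {δ : ℝ} (hδ : 0 < δ) (t : ℝ) :
    ((t : ℂ) - δ * I)⁻¹ - ((t : ℂ) + δ * I)⁻¹ = 2 * δ * I * ((t ^ 2 + δ ^ 2)⁻¹ : ℝ) := by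
  have h1 : (t : ℂ) - δ * I ≠ 0 := fun h => hδ.ne' (by simpa using congrArg Complex.im h)
  have h2 : (t : ℂ) + δ * I ≠ 0 := fun h => hδ.ne' (by simpa using congrArg Complex.im h)
  have h4 : ((t : ℂ) ^ 2 + (δ : ℂ) ^ 2) = ((t : ℂ) - δ * I) * ((t : ℂ) + δ * I) := by
    ring_nf; rw [I_sq]; ring
  push_cast
  rw [h4]
  field_simp
  ring

lemma integrable_inv_sub_inv {δ₁ δ₂ : ℝ} (h₁ : 0 < δ₁) (h₂ : 0 < δ₂) :
    Integrable fun t : ℝ => ((t : ℂ) - δ₁ * I)⁻¹ - ((t : ℂ) + δ₂ * I)⁻¹ := by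
  have hm : 0 < min δ₁ δ₂ := lt_min h₁ h₂
  have hne1 : ∀ t : ℝ, (t : ℂ) - δ₁ * I ≠ 0 :=
    fun t h => h₁.ne' (by simpa using congrArg Complex.im h)
  have hne2 : ∀ t : ℝ, (t : ℂ) + δ₂ * I ≠ 0 :=
    fun t h => h₂.ne' (by simpa using congrArg Complex.im h)
  refine Integrable.mono' ((integrable_inv_sq_add_sq hm).const_mul (δ₁ + δ₂)) ?_ ?_
  · refine Continuous.aestronglyMeasurable ?_
    refine Continuous.sub (Continuous.inv₀ (by fun_prop) hne1) (Continuous.inv₀ (by fun_prop) hne2)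
  · refine Eventually.of_forall fun t => ?_
    have heq : ((t : ℂ) - δ₁ * I)⁻¹ - ((t : ℂ) + δ₂ * I)⁻¹ =
        ((δ₁ + δ₂ : ℝ) * I) * (((t : ℂ) - δ₁ * I)⁻¹ * ((t : ℂ) + δ₂ * I)⁻¹) := by
      rw [inv_sub_inv (hne1 t) (hne2 t), div_eq_mul_inv, mul_inv]
      congr 1
      push_cast
      ring
    rw [heq, norm_mul, norm_mul, norm_I, mul_one, norm_real, Real.norm_of_nonneg (by positivity)]
    refine mul_le_mul_of_nonneg_left ?_ (by positivity)
    rw [← mul_inv, norm_inv, norm_mul]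
    have key : ∀ {δ : ℝ} (s : ℝ), min δ₁ δ₂ ≤ δ → δ ^ 2 = s ^ 2 →
        t ^ 2 + min δ₁ δ₂ ^ 2 ≤ ‖(t : ℂ) + s * I‖ ^ 2 := by
      intro δ s hle hs
      rw [← normSq_eq_norm_sq, normSq_add_mul_I, ← hs]
      nlinarith
    have k1 := key (δ := δ₁) (-δ₁) (min_le_left _ _) (by ring)
    have k2 := key (δ := δ₂) δ₂ (min_le_right _ _) rfl
    have k3 : (t : ℂ) + ((-δ₁ : ℝ) : ℂ) * I = (t : ℂ) - δ₁ * I := by push_cast; ring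
    rw [k3] at k1
    refine inv_anti₀ (by positivity) ?_
    refine le_of_sq_le_sq ?_ (by positivity)
    rw [mul_pow, sq]
    exact mul_le_mul k1 k2 (by positivity) (by positivity)

/-- Symmetrising t ↦ -t turns the integrand into two Lorentzians, each of integral 2πi whatever its
width. This evaluates the polar part directly, with a pole at unequal distances from the two lines.
-/
lemma integral_inv_sub_inv {δ₁ δ₂ : ℝ} (h₁ : 0 < δ₁) (h₂ : 0 < δ₂) :
    ∫ t : ℝ, (((t : ℂ) - δ₁ * I)⁻¹ - ((t : ℂ) + δ₂ * I)⁻¹) = 2 * Real.pi * I := by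
  set F : ℝ → ℂ := fun t => ((t : ℂ) - δ₁ * I)⁻¹ - ((t : ℂ) + δ₂ * I)⁻¹ with hF
  have hFi : Integrable F := integrable_inv_sub_inv h₁ h₂
  have hneg : ∫ t : ℝ, F (-t) = ∫ t : ℝ, F t := integral_neg_eq_self F volume
  have hsum : ∀ t : ℝ, F t + F (-t) =
      2 * δ₁ * I * ((t ^ 2 + δ₁ ^ 2)⁻¹ : ℝ) + 2 * δ₂ * I * ((t ^ 2 + δ₂ ^ 2)⁻¹ : ℝ) := by
    intro t
    rw [← inv_sub_inv_conj h₁, ← inv_sub_inv_conj h₂, hF]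
    simp only [ofReal_neg]
    rw [show -(t : ℂ) - δ₁ * I = -(t + δ₁ * I) by ring, show -(t : ℂ) + δ₂ * I = -(t - δ₂ * I) by ring,
      inv_neg, inv_neg]
    ring
  have h2 : 2 * ∫ t : ℝ, F t = 4 * Real.pi * I := by
    calc 2 * ∫ t : ℝ, F t = ∫ t : ℝ, (F t + F (-t)) := by
          rw [integral_add hFi hFi.comp_neg, hneg]; ring
      _ = ∫ t : ℝ, (2 * δ₁ * I * ((t ^ 2 + δ₁ ^ 2)⁻¹ : ℝ) +
            2 * δ₂ * I * ((t ^ 2 + δ₂ ^ 2)⁻¹ : ℝ)) := by simp_rw [hsum]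
      _ = _ := by
          rw [integral_add ((integrable_inv_sq_add_sq h₁).ofReal.const_mul _)
            ((integrable_inv_sq_add_sq h₂).ofReal.const_mul _), integral_const_mul,
            integral_const_mul, integral_complex_ofReal, integral_complex_ofReal, integral_inv_sq_add_sq h₁,
            integral_inv_sq_add_sq h₂]
          have : (δ₁ : ℂ) ≠ 0 := by exact_mod_cast h₁.ne'
          have : (δ₂ : ℂ) ≠ 0 := by exact_mod_cast h₂.ne'
          push_cast
          field_simp
          ring
  linear_combination h2 / 2

/-- Horizontal contour shift across one simple pole. -/
lemma integral_strip_sub_eq_residue {f : ℂ → ℂ} {a b : ℝ} {x₀ r : ℂ} (hx₀ : x₀.im ∈ Set.Ioo a b)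
    (hd : ∀ x : ℂ, x.im ∈ Set.Icc a b → x ≠ x₀ → DifferentiableAt ℂ f x)
    (hres : Tendsto (fun x => (x - x₀) * f x) (𝓝[≠] x₀) (𝓝 r))
    (hdecay : ∀ ε > 0, ∃ R : ℝ, ∀ x : ℝ, R ≤ |x| → ∀ y ∈ Set.Icc a b, ‖f (x + y * I)‖ ≤ ε)
    (ha : Integrable fun x : ℝ => f (x + a * I)) (hb : Integrable fun x : ℝ => f (x + b * I)) :
    (∫ x : ℝ, f (x + a * I)) - ∫ x : ℝ, f (x + b * I) = 2 * Real.pi * I * r := by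
  have hab : a ≤ b := (hx₀.1.trans hx₀.2).le
  set g : ℂ → ℂ := fun x => f x - r / (x - x₀) with hg
  have hgd : ∀ x : ℂ, x.im ∈ Set.Icc a b → x ≠ x₀ → DifferentiableAt ℂ g x := by
    intro x hx hne
    exact (hd x hx hne).fun_sub (DifferentiableAt.fun_div (by fun_prop) (by fun_prop) (sub_ne_zero.2 hne))
  set s : Set ℂ := Complex.im ⁻¹' Set.Ioo a b with hs
  have hso : IsOpen s := isOpen_Ioo.preimage continuous_im
  have hsn : s ∈ 𝓝 x₀ := hso.mem_nhds hx₀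
  -- After subtraction of the polar part, (x - x₀) g(x) tends to 0, so the singularity is removable.
  have hG := differentiableOn_update_limUnder_of_isLittleO (f := g) hsn
    (fun x hx => (hgd x ⟨hx.1.1.le, hx.1.2.le⟩ hx.2).differentiableWithinAt) (by
      have hne : ∀ᶠ x in 𝓝[≠] x₀, (x - x₀)⁻¹ = 0 → g x - g x₀ = 0 := by
        filter_upwards [self_mem_nhdsWithin] with x hx h0
        exact absurd (inv_eq_zero.1 h0) (sub_ne_zero.2 hx)
      rw [Asymptotics.isLittleO_iff_tendsto' hne]
      have h1 : Tendsto (fun x => (x - x₀) * f x - r - (x - x₀) * g x₀) (𝓝[≠] x₀) (𝓝 0) := by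
        have h2 : Tendsto (fun x : ℂ => (x - x₀) * g x₀) (𝓝[≠] x₀) (𝓝 0) := by
          have : Tendsto (fun x : ℂ => (x - x₀) * g x₀) (𝓝 x₀) (𝓝 ((x₀ - x₀) * g x₀)) := by
            apply Continuous.tendsto; fun_prop
          rw [sub_self, zero_mul] at this
          exact this.mono_left nhdsWithin_le_nhds
        simpa using (hres.sub_const r).sub h2
      refine h1.congr' ?_
      filter_upwards [self_mem_nhdsWithin] with x hx
      have : x - x₀ ≠ 0 := sub_ne_zero.2 hx
      rw [div_inv_eq_mul]
      simp only [hg]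
      field_simp)
  set G := Function.update g x₀ (limUnder (𝓝[≠] x₀) g) with hGdef
  have hGne : ∀ x, x ≠ x₀ → G x = g x := fun x hx => Function.update_of_ne hx _ _
  have hline : ∀ c : ℝ, c ≠ x₀.im → ∀ x : ℝ, (x + c * I : ℂ) ≠ x₀ := by
    intro c hc x h
    exact hc (by simpa using congrArg Complex.im h)
  have hca := hline a hx₀.1.ne
  have hcb := hline b hx₀.2.ne'
  set F : ℝ → ℂ := fun x => ((x : ℂ) - (x₀.im - a : ℝ) * I)⁻¹ - ((x : ℂ) + (b - x₀.im : ℝ) * I)⁻¹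
    with hF
  have h1 : 0 < x₀.im - a := by linarith [hx₀.1]
  have h2 : 0 < b - x₀.im := by linarith [hx₀.2]
  have hFi : Integrable F := integrable_inv_sub_inv h1 h2
  have hdiff : ∀ x : ℝ, G (x + a * I) - G (x + b * I) =
      (f (x + a * I) - f (x + b * I)) - r * F (x - x₀.re) := by
    intro x
    rw [hGne _ (hca x), hGne _ (hcb x)]
    have e1 : (x + a * I : ℂ) - x₀ = ((x - x₀.re : ℝ) : ℂ) - (x₀.im - a : ℝ) * I := by
      apply Complex.ext <;> simp
    have e2 : (x + b * I : ℂ) - x₀ = ((x - x₀.re : ℝ) : ℂ) + (b - x₀.im : ℝ) * I := by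
      apply Complex.ext <;> simp
    simp only [hg, hF]
    rw [e1, e2, div_eq_mul_inv, div_eq_mul_inv]
    ring
  have hFi' : Integrable fun x : ℝ => r * F (x - x₀.re) := (hFi.comp_sub_right x₀.re).const_mul r
  -- The subtracted polar part decays only like 1/x, so G need not be integrable on either line; its
  -- difference between the lines is.
  have hzero := integral_strip_sub_eq_zero (f := G) hab (by
      intro x hx
      by_cases hxx : x = x₀
      · rw [hxx]
        exact hG.differentiableAt hsn
      · refine (hgd x hx hxx).congr_of_eventuallyEq ?_
        filter_upwards [isOpen_ne.mem_nhds hxx] with y hy using hGne y hy) (by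
      intro ε hε
      obtain ⟨R, hR⟩ := hdecay (ε / 2) (by positivity)
      -- Beyond this abscissa the distance to x₀ is at least 1 + 2‖r‖/ε, which makes the polar part
      -- at most ε/2.
      refine ⟨max R (|x₀.re| + 1 + 2 * ‖r‖ / ε), fun x hx y hy => ?_⟩
      have hxR := hR x ((le_max_left _ _).trans hx) y hy
      have hx2 := (le_max_right _ _).trans hx
      have h3 : 1 + 2 * ‖r‖ / ε ≤ ‖(x + y * I : ℂ) - x₀‖ := by
        refine le_trans ?_ (Complex.abs_re_le_norm _)
        simp only [sub_re, add_re, ofReal_re, mul_re, I_re, mul_zero, ofReal_im, I_im, mul_one,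
          sub_self, add_zero]
        have := abs_sub_abs_le_abs_sub x x₀.re
        linarith
      have h4 : 0 < 1 + 2 * ‖r‖ / ε := by positivity
      have hne : (x + y * I : ℂ) ≠ x₀ := by
        intro h
        rw [h, sub_self, norm_zero] at h3
        linarith
      rw [hGne _ hne]
      refine (norm_sub_le _ _).trans ?_
      have h5 : ‖r / ((x + y * I : ℂ) - x₀)‖ ≤ ε / 2 := by
        rw [norm_div, div_le_iff₀ (h4.trans_le h3)]
        have : ε / 2 * (1 + 2 * ‖r‖ / ε) = ε / 2 + ‖r‖ := by field_simp
        nlinarith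
      linarith) (by
      simp_rw [hdiff]
      exact (ha.sub hb).sub hFi')
  simp_rw [hdiff] at hzero
  have hfi : Integrable fun x : ℝ => f (x + a * I) - f (x + b * I) := ha.sub hb
  rw [integral_sub hfi hFi', integral_const_mul, integral_sub_right_eq_self F x₀.re] at hzero
  have hFv : ∫ x, F x = 2 * Real.pi * I := integral_inv_sub_inv h1 h2
  rw [hFv] at hzero
  have h6 := integral_sub ha hb
  linear_combination hzero - h6


/-! ### The Mordell integral: entire continuation, functional equation and growth. -/

lemma sinh_abs_re_le_norm_sinh (x : ℂ) : Real.sinh |x.re| ≤ ‖Complex.sinh x‖ := by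
  have h := sinh_abs_im_le_norm_sin (x * I)
  rwa [Complex.sin_mul_I, norm_mul, norm_I, mul_one, mul_I_im] at h

lemma one_le_norm_sinh {x : ℂ} (hx : 1 ≤ |x.re|) : 1 ≤ ‖Complex.sinh x‖ :=
  (hx.trans (Real.self_le_sinh_iff.2 (abs_nonneg _))).trans (sinh_abs_re_le_norm_sinh x)

lemma sinh_pi_mul_eq_zero_iff (y : ℂ) :
    Complex.sinh (Real.pi * y) = 0 ↔ ∃ n : ℤ, y = n * I := by
  have h : Complex.sinh (Real.pi * y) = Complex.sin (Real.pi * (-(y * I))) * I := by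
    rw [show (Real.pi : ℂ) * -(y * I) = -(Real.pi * y * I) by ring, Complex.sin_neg,
      Complex.sin_mul_I, neg_mul, mul_assoc, I_mul_I]
    ring
  rw [h, mul_eq_zero, or_iff_left I_ne_zero, sin_pi_mul_eq_zero_iff]
  refine ⟨fun ⟨r, hr⟩ => ⟨r, ?_⟩, fun ⟨r, hr⟩ => ⟨r, ?_⟩⟩
  · rw [← hr]; ring_nf; rw [I_sq]; ring
  · rw [hr]; ring_nf; rw [I_sq]; ring

/-- The Gaussian `e^{-3πλx² - 6πiwx}`. -/
def gaussian (lam w x : ℂ) : ℂ := Complex.exp (-(3 * Real.pi * lam * x ^ 2) - 6 * Real.pi * I * w * x)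

/-- The kernel `e^{-3πλx² - 6πiwx} / sinh (π (λx - ib))`. -/
def kernel (lam : ℂ) (b : ℝ) (w x : ℂ) : ℂ :=
  gaussian lam w x / Complex.sinh (Real.pi * (lam * x - I * b))

/-- The integral of `kernel` over the real line; it is an entire function of `w`. -/
def kernelInt (lam : ℂ) (b : ℝ) (w : ℂ) : ℂ := ∫ x : ℝ, kernel lam b w x

/-- The term linear in x is absorbed by giving up two thirds of the Gaussian decay. Uniformity in y
serves the contour shifts, uniformity in w the differentiation under the integral. -/
lemma exists_norm_gaussian_le {lam : ℂ} (hlam : 0 < lam.re) (R : ℝ) :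
    ∃ C : ℝ, 0 < C ∧ ∀ w : ℂ, ‖w‖ ≤ R → ∀ x y : ℝ, |y| ≤ R →
      ‖gaussian lam w (x + y * I)‖ ≤ C * Real.exp (-(Real.pi * lam.re) * x ^ 2) := by
  have hpi := Real.pi_pos
  set M : ℝ := 6 * Real.pi * (|lam.im| * |R| + |R|) with hM
  refine ⟨Real.exp (M ^ 2 / (8 * Real.pi * lam.re) + 3 * Real.pi * lam.re * R ^ 2
    + 6 * Real.pi * (|R| * |R|)), Real.exp_pos _, fun w hw x y hy => ?_⟩
  rw [gaussian, Complex.norm_exp, ← Real.exp_add, Real.exp_le_exp]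
  have hre : (-(3 * Real.pi * lam * ((x : ℂ) + y * I) ^ 2) - 6 * Real.pi * I * w * (x + y * I)).re =
      -(3 * Real.pi * lam.re * x ^ 2) + x * (6 * Real.pi * (lam.im * y + w.im)) +
        3 * Real.pi * lam.re * y ^ 2 + 6 * Real.pi * (w.re * y) := by
    simp [pow_two]
    ring
  rw [hre]
  have hR : R ≤ |R| := le_abs_self R
  have h1 : |6 * Real.pi * (lam.im * y + w.im)| ≤ M := by
    rw [abs_mul, abs_of_pos (by positivity), hM]
    refine mul_le_mul_of_nonneg_left ((abs_add_le _ _).trans (add_le_add ?_ ?_)) (by positivity)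
    · rw [abs_mul]
      exact mul_le_mul_of_nonneg_left (hy.trans hR) (abs_nonneg _)
    · exact (Complex.abs_im_le_norm w).trans (hw.trans hR)
  have h2 : w.re * y ≤ |R| * |R| := by
    refine (le_abs_self _).trans ?_
    rw [abs_mul]
    exact mul_le_mul ((Complex.abs_re_le_norm w).trans (hw.trans hR)) (hy.trans hR) (abs_nonneg _)
      (abs_nonneg _)
  have h3 : y ^ 2 ≤ R ^ 2 := sq_le_sq' (by linarith [(abs_le.1 hy).1]) (abs_le.1 hy).2
  have h4 : x * (6 * Real.pi * (lam.im * y + w.im)) ≤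
      2 * Real.pi * lam.re * x ^ 2 + M ^ 2 / (8 * Real.pi * lam.re) := by
    have h5 : x * (6 * Real.pi * (lam.im * y + w.im)) ≤ |x| * M := by
      refine (le_abs_self _).trans ?_
      rw [abs_mul]
      exact mul_le_mul_of_nonneg_left h1 (abs_nonneg _)
    refine h5.trans ?_
    have h6 : 0 ≤ (4 * Real.pi * lam.re * |x| - M) ^ 2 / (8 * Real.pi * lam.re) := by positivity
    have h7 : (4 * Real.pi * lam.re * |x| - M) ^ 2 / (8 * Real.pi * lam.re) =
        2 * Real.pi * lam.re * x ^ 2 - |x| * M + M ^ 2 / (8 * Real.pi * lam.re) := by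
      rw [← sq_abs x]
      field_simp
      ring
    linarith
  have h8 : 3 * Real.pi * lam.re * y ^ 2 ≤ 3 * Real.pi * lam.re * R ^ 2 :=
    mul_le_mul_of_nonneg_left h3 (by positivity)
  have h9 : 6 * Real.pi * (w.re * y) ≤ 6 * Real.pi * (|R| * |R|) :=
    mul_le_mul_of_nonneg_left h2 (by positivity)
  linarith

lemma exists_one_le_norm_sinh {lam : ℂ} (hlam : 0 < lam.re) (b R : ℝ) :
    ∃ T : ℝ, ∀ x : ℝ, T ≤ |x| → ∀ y : ℝ, |y| ≤ R →
      1 ≤ ‖Complex.sinh (Real.pi * (lam * (x + y * I) - I * b))‖ := by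
  refine ⟨(1 + |lam.im| * R) / lam.re, fun x hx y hy => one_le_norm_sinh ?_⟩
  have hre : ((Real.pi : ℂ) * (lam * (x + y * I) - I * b)).re =
      Real.pi * (lam.re * x - lam.im * y) := by simp
  rw [hre, abs_mul, abs_of_pos Real.pi_pos]
  have h1 : 1 + |lam.im| * R ≤ lam.re * |x| := by
    rw [div_le_iff₀ hlam] at hx; linarith
  have h2 : |lam.im * y| ≤ |lam.im| * R := by
    rw [abs_mul]; exact mul_le_mul_of_nonneg_left hy (abs_nonneg _)
  have h3 := abs_sub_abs_le_abs_sub (lam.re * x) (lam.im * y)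
  rw [abs_mul, abs_of_pos hlam] at h3
  nlinarith [Real.pi_gt_three]

lemma kernel_decay {lam : ℂ} (hlam : 0 < lam.re) (b : ℝ) (w : ℂ) (R : ℝ) :
    ∃ C T : ℝ, 0 < C ∧ ∀ x : ℝ, T ≤ |x| → ∀ y : ℝ, |y| ≤ R →
      ‖kernel lam b w (x + y * I)‖ ≤ C * Real.exp (-(Real.pi * lam.re) * x ^ 2) := by
  obtain ⟨C, hC, h1⟩ := exists_norm_gaussian_le hlam (max R ‖w‖)
  obtain ⟨T, h2⟩ := exists_one_le_norm_sinh hlam b R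
  refine ⟨C, T, hC, fun x hx y hy => ?_⟩
  rw [kernel, norm_div]
  exact (div_le_self (norm_nonneg _) (h2 x hx y hy)).trans
    (h1 w (le_max_right _ _) x y (hy.trans (le_max_left _ _)))

lemma differentiableAt_kernel {lam : ℂ} {b : ℝ} {w x : ℂ}
    (h : Complex.sinh (Real.pi * (lam * x - I * b)) ≠ 0) :
    DifferentiableAt ℂ (kernel lam b w) x := by
  unfold kernel gaussian
  exact DifferentiableAt.fun_div (by fun_prop) (by fun_prop) h

lemma tendsto_exp_neg_sq {A : ℝ} (hA : 0 < A) (C : ℝ) {ε : ℝ} (hε : 0 < ε) :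
    ∃ T : ℝ, ∀ x : ℝ, T ≤ |x| → C * Real.exp (-A * x ^ 2) ≤ ε := by
  have h1 : Tendsto (fun x : ℝ => C * Real.exp (-(A * x))) atTop (𝓝 0) := by
    have h2 : Tendsto (fun x : ℝ => Real.exp (-(A * x))) atTop (𝓝 0) :=
      Real.tendsto_exp_atBot.comp
        (tendsto_neg_atTop_atBot.comp (tendsto_id.const_mul_atTop hA))
    simpa using h2.const_mul C
  obtain ⟨T, hT⟩ := eventually_atTop.1 (h1.eventually_le_const hε)
  refine ⟨max T 1, fun x hx => ?_⟩
  have hx1 : 1 ≤ |x| := (le_max_right _ _).trans hx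
  have h3 : T ≤ x ^ 2 := by
    rw [← sq_abs]
    have := (le_max_left _ _).trans hx
    nlinarith
  have := hT _ h3
  rwa [neg_mul]

lemma kernel_uniform_decay {lam : ℂ} (hlam : 0 < lam.re) (b : ℝ) (w : ℂ) (R : ℝ) :
    ∀ ε > 0, ∃ T : ℝ, ∀ x : ℝ, T ≤ |x| → ∀ y : ℝ, |y| ≤ R → ‖kernel lam b w (x + y * I)‖ ≤ ε := by
  intro ε hε
  obtain ⟨C, T, hC, h⟩ := kernel_decay hlam b w R
  obtain ⟨T', hT'⟩ := tendsto_exp_neg_sq (mul_pos Real.pi_pos hlam) C hε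
  exact ⟨max T T', fun x hx y hy => (h x ((le_max_left _ _).trans hx) y hy).trans
    (hT' x ((le_max_right _ _).trans hx))⟩

lemma integrable_kernel_line {lam : ℂ} (hlam : 0 < lam.re) (b : ℝ) (w : ℂ) (y : ℝ)
    (h : ∀ x : ℝ, Complex.sinh (Real.pi * (lam * (x + y * I) - I * b)) ≠ 0) :
    Integrable fun x : ℝ => kernel lam b w (x + y * I) := by
  obtain ⟨C, T, hC, hb⟩ := kernel_decay hlam b w |y|
  have hcont : Continuous fun x : ℝ => kernel lam b w (x + y * I) := by
    unfold kernel gaussian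
    exact Continuous.div (by fun_prop) (by fun_prop) h
  refine hcont.locallyIntegrable.integrable_of_isBigO_cocompact
    (g := fun x : ℝ => Real.exp (-(Real.pi * lam.re) * x ^ 2)) ?_
    ((integrable_exp_neg_mul_sq (mul_pos Real.pi_pos hlam)).integrableAtFilter _)
  refine Asymptotics.IsBigO.of_bound C ?_
  have h1 : ∀ᶠ x : ℝ in cocompact ℝ, T ≤ |x| := by
    have := tendsto_norm_cocompact_atTop (E := ℝ)
    exact this.eventually_ge_atTop T
  filter_upwards [h1] with x hx
  rw [Real.norm_of_nonneg (Real.exp_pos _).le]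
  exact hb x hx y le_rfl

/-- Location of the zeros of the denominator of `kernel`. -/
lemma sinh_kernel_eq_zero {lam : ℂ} (hlam : 0 < lam.re) {b : ℝ} {x : ℂ}
    (h : Complex.sinh (Real.pi * (lam * x - I * b)) = 0) :
    ∃ n : ℤ, x = I * (b + n) / lam := by
  have hl : lam ≠ 0 := fun h0 => by simp [h0] at hlam
  obtain ⟨n, hn⟩ := (sinh_pi_mul_eq_zero_iff _).1 h
  refine ⟨n, ?_⟩
  field_simp
  linear_combination hn

lemma im_I_mul_div (t : ℝ) (lam : ℂ) : (I * t / lam).im = t * (lam⁻¹).re := by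
  rw [div_eq_mul_inv, mul_assoc, I_mul_im, Complex.re_ofReal_mul]

lemma inv_re_pos {lam : ℂ} (hlam : 0 < lam.re) : 0 < (lam⁻¹).re := by
  rw [Complex.inv_re]
  have : lam ≠ 0 := fun h0 => by simp [h0] at hlam
  exact div_pos hlam (Complex.normSq_pos.2 this)

lemma sinh_kernel_ne_zero {lam : ℂ} (hlam : 0 < lam.re) {b : ℝ} {x : ℂ}
    (h : ∀ n : ℤ, x.im ≠ (b + n) * (lam⁻¹).re) :
    Complex.sinh (Real.pi * (lam * x - I * b)) ≠ 0 := by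
  intro h0
  obtain ⟨n, hn⟩ := sinh_kernel_eq_zero hlam h0
  refine h n ?_
  rw [hn]
  have := im_I_mul_div (b + n) lam
  push_cast at this
  exact this

lemma sinh_kernel_real_ne_zero {lam : ℂ} (hlam : 0 < lam.re) {b : ℝ} (hb : ∀ n : ℤ, b ≠ n) (x : ℝ) :
    Complex.sinh (Real.pi * (lam * x - I * b)) ≠ 0 := by
  refine sinh_kernel_ne_zero hlam fun n => ?_
  rw [ofReal_im]
  refine (mul_ne_zero ?_ (inv_re_pos hlam).ne').symm
  have := hb (-n)
  intro h
  push_cast at this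
  exact this (by linarith)

lemma exists_le_norm_sinh_kernel {lam : ℂ} (hlam : 0 < lam.re) {b : ℝ} (hb : ∀ n : ℤ, b ≠ n) :
    ∃ δ > 0, ∀ x : ℝ, δ ≤ ‖Complex.sinh (Real.pi * (lam * x - I * b))‖ := by
  obtain ⟨T, hT⟩ := exists_one_le_norm_sinh hlam b 0
  have hcont : ContinuousOn (fun x : ℝ => ‖Complex.sinh (Real.pi * (lam * x - I * b))‖)
      (Set.Icc (-|T|) |T|) := by fun_prop
  obtain ⟨x₀, hx₀, hmin⟩ := isCompact_Icc.exists_isMinOn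
    (Set.nonempty_Icc.2 (by linarith [abs_nonneg T])) hcont
  refine ⟨min 1 ‖Complex.sinh (Real.pi * (lam * x₀ - I * b))‖,
    lt_min one_pos (norm_pos_iff.2 (sinh_kernel_real_ne_zero hlam hb x₀)), fun x => ?_⟩
  by_cases hx : |x| ≤ |T|
  · exact (min_le_right _ _).trans (hmin (abs_le.1 hx))
  · refine (min_le_left _ _).trans ?_
    have := hT x ((le_abs_self T).trans (not_le.1 hx).le) 0 (by simp)
    simpa using this

lemma integrable_kernel {lam : ℂ} (hlam : 0 < lam.re) {b : ℝ} (hb : ∀ n : ℤ, b ≠ n) (w : ℂ) :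
    Integrable fun x : ℝ => kernel lam b w x := by
  have := integrable_kernel_line hlam b w 0 (fun x => by
    simpa using sinh_kernel_real_ne_zero hlam hb x)
  simpa using this

/-- The variable w occurs only in the exponent, so the poles of the kernel do not move with it and
dominated differentiation applies on a unit ball about any point. -/
lemma differentiable_kernelInt {lam : ℂ} (hlam : 0 < lam.re) {b : ℝ} (hb : ∀ n : ℤ, b ≠ n) :
    Differentiable ℂ (kernelInt lam b) := by
  intro w₀
  obtain ⟨δ, hδ, hδb⟩ := exists_le_norm_sinh_kernel hlam hb
  obtain ⟨C, hC, hCb⟩ := exists_norm_gaussian_le hlam (‖w₀‖ + 1)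
  have hA : 0 < Real.pi * lam.re := mul_pos Real.pi_pos hlam
  have hcont : ∀ w : ℂ, Continuous fun x : ℝ => kernel lam b w x := by
    intro w
    unfold kernel gaussian
    exact Continuous.div (by fun_prop) (by fun_prop) (sinh_kernel_real_ne_zero hlam hb)
  have := hasDerivAt_integral_of_dominated_loc_of_deriv_le (μ := volume)
    (F := fun w (x : ℝ) => kernel lam b w x)
    (F' := fun w (x : ℝ) => -(6 * Real.pi * I * x) * kernel lam b w x) (x₀ := w₀)
    (bound := fun x => 6 * Real.pi * (C / δ) * (|x| * Real.exp (-(Real.pi * lam.re) * x ^ 2)))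
    (s := Metric.ball w₀ 1) (Metric.ball_mem_nhds w₀ one_pos)
    (Eventually.of_forall fun w => (hcont w).aestronglyMeasurable)
    (integrable_kernel hlam hb w₀)
    ((Continuous.mul (by fun_prop) (hcont w₀)).aestronglyMeasurable) ?_ ?_ ?_
  · exact this.2.differentiableAt
  · refine Eventually.of_forall fun x w hw => ?_
    have hw' : ‖w‖ ≤ ‖w₀‖ + 1 := by
      have := norm_sub_norm_le w w₀
      rw [Metric.mem_ball, dist_eq_norm] at hw
      linarith
    have h1 := hCb w hw' x 0 (by rw [abs_zero]; positivity)
    rw [ofReal_zero, zero_mul, add_zero] at h1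
    have h2 : ‖kernel lam b w x‖ ≤ C * Real.exp (-(Real.pi * lam.re) * x ^ 2) / δ := by
      rw [kernel, norm_div]
      exact div_le_div₀ (by positivity) h1 hδ (hδb x)
    have h3 : ‖-(6 * Real.pi * I * x : ℂ)‖ = 6 * Real.pi * |x| := by
      simp [abs_of_pos Real.pi_pos]
    rw [norm_mul, h3]
    calc 6 * Real.pi * |x| * ‖kernel lam b w x‖
        ≤ 6 * Real.pi * |x| * (C * Real.exp (-(Real.pi * lam.re) * x ^ 2) / δ) :=
          mul_le_mul_of_nonneg_left h2 (by positivity)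
      _ = _ := by ring
  · have h1 := (integrable_mul_exp_neg_mul_sq hA).norm
    refine (h1.const_mul (6 * Real.pi * (C / δ))).congr (Eventually.of_forall fun x => ?_)
    simp only
    rw [norm_mul, Real.norm_eq_abs, Real.norm_of_nonneg (Real.exp_pos _).le]
  · refine Eventually.of_forall fun x w _ => ?_
    unfold kernel gaussian
    have h1 : HasDerivAt (fun w : ℂ => -(3 * Real.pi * lam * (x : ℂ) ^ 2) - 6 * Real.pi * I * w * x)
        (-(6 * Real.pi * I * x)) w := by
      have := (((hasDerivAt_id w).const_mul (6 * Real.pi * I)).mul_const (x : ℂ)).const_sub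
        (-(3 * Real.pi * lam * (x : ℂ) ^ 2))
      simpa using this
    have h2 := (h1.cexp).div_const (Complex.sinh (Real.pi * (lam * x - I * b)))
    refine h2.congr_deriv ?_
    ring

/-- The entire extension of `∫ e^{-3πλx²} / sinh (π (λx - i (w + b))) dx`. -/
def mordellExt (lam : ℂ) (b : ℝ) (w : ℂ) : ℂ :=
  Complex.exp (3 * Real.pi * w ^ 2 / lam) * kernelInt lam b w

lemma differentiable_mordellExt {lam : ℂ} (hlam : 0 < lam.re) {b : ℝ} (hb : ∀ n : ℤ, b ≠ n) :
    Differentiable ℂ (mordellExt lam b) := by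
  unfold mordellExt
  exact Differentiable.fun_mul (by fun_prop) (differentiable_kernelInt hlam hb)

lemma ne_int_of_mem_Ioo {b : ℝ} (hb : b ∈ Set.Ioo (0 : ℝ) 1) (n : ℤ) : b ≠ n := by
  rintro rfl
  have h1 : (0 : ℤ) < n := by exact_mod_cast hb.1
  have h2 : n < (1 : ℤ) := by exact_mod_cast hb.2
  omega

/-- Moving x by i/λ changes the sign of sinh and multiplies the Gaussian by just the factor that
separates w from w + 1. So the sum is a difference of integrals over the lines of heights 0 and
Re(1/λ), that is, 2πi times the residue at ib/λ. The condition 0 < b < 1 makes this the only pole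
between the lines. -/
lemma mordellExt_add_one {lam : ℂ} (hlam : 0 < lam.re) {b : ℝ} (hb : b ∈ Set.Ioo (0 : ℝ) 1) (w : ℂ) :
    mordellExt lam b (w + 1) + mordellExt lam b w =
      2 * I / lam * Complex.exp (3 * Real.pi * (w + b) ^ 2 / lam) := by
  have hl : lam ≠ 0 := fun h0 => by simp [h0] at hlam
  have hpi : (Real.pi : ℂ) ≠ 0 := by exact_mod_cast Real.pi_ne_zero
  set ρ := (lam⁻¹).re with hρ
  have hρ0 : 0 < ρ := inv_re_pos hlam
  set x₀ : ℂ := I * b / lam with hx₀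
  have hx₀im : x₀.im = b * ρ := im_I_mul_div b lam
  have hS0 : Complex.sinh (Real.pi * (lam * x₀ - I * b)) = 0 := by
    rw [hx₀, mul_div_cancel₀ _ hl, sub_self, mul_zero, Complex.sinh_zero]
  have hlim : Tendsto (fun x => (x - x₀) * kernel lam b w x) (𝓝[≠] x₀)
      (𝓝 (gaussian lam w x₀ * (Real.pi * lam)⁻¹)) := by
    have hder : HasDerivAt (fun x : ℂ => Complex.sinh (Real.pi * (lam * x - I * b)))
        (Real.pi * lam) x₀ := by
      have h1 : HasDerivAt (fun x : ℂ => (Real.pi : ℂ) * (lam * x - I * b)) (Real.pi * lam) x₀ := by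
        simpa using ((((hasDerivAt_id x₀).const_mul lam).sub_const (I * b)).const_mul (Real.pi : ℂ))
      have h2 := h1.csinh
      have h3 : (Real.pi : ℂ) * (lam * x₀ - I * b) = 0 := by
        rw [hx₀, mul_div_cancel₀ _ hl, sub_self, mul_zero]
      rwa [h3, Complex.cosh_zero, one_mul] at h2
    have h4 := hder.tendsto_slope.inv₀ (mul_ne_zero hpi hl)
    have h5 : Tendsto (gaussian lam w) (𝓝[≠] x₀) (𝓝 (gaussian lam w x₀)) := by
      have : Continuous (gaussian lam w) := by unfold gaussian; fun_prop
      exact (this.tendsto x₀).mono_left nhdsWithin_le_nhds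
    refine (h5.mul h4).congr fun x => ?_
    rw [slope_def_field, hS0, sub_zero, inv_div, kernel]
    ring
  have hne : ∀ y : ℝ, y = 0 ∨ y = ρ → ∀ x : ℝ,
      Complex.sinh (Real.pi * (lam * (x + y * I) - I * b)) ≠ 0 := by
    intro y hy x
    refine sinh_kernel_ne_zero hlam fun n h => ?_
    simp only [add_im, ofReal_im, mul_im, ofReal_re, I_im, I_re, mul_zero, mul_one, zero_add,
      add_zero] at h
    rw [← hρ] at h
    rcases hy with hy | hy
    · rw [hy] at h
      have h1 : b + n = 0 := (mul_eq_zero.1 h.symm).resolve_right hρ0.ne'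
      exact ne_int_of_mem_Ioo hb (-n) (by push_cast; linarith)
    · rw [hy] at h
      have h1 : b + n = 1 := by
        have : (b + n - 1) * ρ = 0 := by linarith
        have := (mul_eq_zero.1 this).resolve_right hρ0.ne'
        linarith
      exact ne_int_of_mem_Ioo hb (1 - n) (by push_cast; linarith)
  have key := integral_strip_sub_eq_residue (f := kernel lam b w) (a := 0) (b := ρ) (x₀ := x₀)
    (by rw [hx₀im]; constructor <;> nlinarith [hb.1, hb.2])
    (fun x hx hxx => by
      refine differentiableAt_kernel fun h0 => ?_
      obtain ⟨n, hn⟩ := sinh_kernel_eq_zero hlam h0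
      have him : x.im = (b + n) * ρ := by
        rw [hn]
        have := im_I_mul_div (b + n) lam
        push_cast at this
        exact this
      rw [him] at hx
      have hn0 : n = 0 := by
        have h1 : 0 ≤ b + n := le_of_mul_le_mul_right (by linarith [hx.1]) hρ0
        have h2 : b + n ≤ 1 := le_of_mul_le_mul_right (by linarith [hx.2]) hρ0
        have h3 : (-1 : ℝ) < n := by linarith [hb.2]
        have h4 : (n : ℝ) < 1 := by linarith [hb.1]
        have h5 : (-1 : ℤ) < n := by exact_mod_cast h3
        have h6 : n < (1 : ℤ) := by exact_mod_cast h4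
        omega
      apply hxx
      rw [hn, hn0, hx₀]
      simp)
    hlim
    (fun ε hε => by
      obtain ⟨T, hT⟩ := kernel_uniform_decay hlam b w ρ ε hε
      refine ⟨T, fun x hx y hy => hT x hx y ?_⟩
      rw [abs_of_nonneg hy.1]; exact hy.2)
    (integrable_kernel_line hlam b w 0 (hne 0 (Or.inl rfl)))
    (integrable_kernel_line hlam b w ρ (hne ρ (Or.inr rfl)))
  -- The point i/λ is not purely imaginary in general; its real part is removed by translating the
  -- integration variable.
  have hshift : kernelInt lam b (w + 1) = -Complex.exp (-(6 * Real.pi * w / lam) - 3 * Real.pi / lam) *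
      ∫ x : ℝ, kernel lam b w (x + ρ * I) := by
    have h1 : ∫ x : ℝ, kernel lam b w (x + ρ * I) =
        ∫ x : ℝ, kernel lam b w (((x + (I / lam).re : ℝ) : ℂ) + ρ * I) :=
      (integral_add_right_eq_self (fun x : ℝ => kernel lam b w (x + ρ * I)) (I / lam).re).symm
    rw [h1, kernelInt, ← integral_const_mul]
    refine integral_congr_ae (Eventually.of_forall fun x => ?_)
    have h2 : (((x + (I / lam).re : ℝ) : ℂ) + ρ * I) = x + I / lam := by
      have : (I / lam).im = ρ := by rw [div_eq_mul_inv, I_mul_im]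
      rw [← this]
      push_cast
      rw [add_assoc, Complex.re_add_im]
    simp only
    rw [h2, kernel, kernel]
    have h3 : Complex.sinh (Real.pi * (lam * (x + I / lam) - I * b)) =
        -Complex.sinh (Real.pi * (lam * x - I * b)) := by
      rw [← Complex.sinh_add_pi_mul_I]
      congr 1
      field_simp
      ring
    have h4 : gaussian lam (w + 1) x =
        Complex.exp (-(6 * Real.pi * w / lam) - 3 * Real.pi / lam) * gaussian lam w (x + I / lam) := by
      rw [gaussian, gaussian, ← Complex.exp_add]
      congr 1
      field_simp
      ring_nf
      simp only [I_sq]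
      ring
    rw [h3, h4]
    ring
  rw [mordellExt, mordellExt, hshift]
  have h5 : Complex.exp (3 * Real.pi * (w + 1) ^ 2 / lam) *
      (-Complex.exp (-(6 * Real.pi * w / lam) - 3 * Real.pi / lam) *
      ∫ x : ℝ, kernel lam b w (x + ρ * I)) = -(Complex.exp (3 * Real.pi * w ^ 2 / lam) *
      ∫ x : ℝ, kernel lam b w (x + ρ * I)) := by
    rw [neg_mul, mul_neg, ← mul_assoc, ← Complex.exp_add]
    congr 3
    field_simp
    ring
  have h6 : Complex.exp (3 * Real.pi * w ^ 2 / lam) * gaussian lam w x₀ =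
      Complex.exp (3 * Real.pi * (w + b) ^ 2 / lam) := by
    rw [gaussian, ← Complex.exp_add]
    congr 1
    rw [hx₀]
    field_simp
    ring_nf
    simp only [I_sq]
    ring
  simp only [ofReal_zero, zero_mul, add_zero] at key
  rw [h5, kernelInt, ← h6]
  have h7 : (∫ x : ℝ, kernel lam b w x) = 2 * Real.pi * I * (gaussian lam w x₀ * (Real.pi * lam)⁻¹) +
      ∫ x : ℝ, kernel lam b w (x + ρ * I) := by linear_combination key
  rw [h7]
  field_simp
  ring

/-- Along the direction iλ the prefactor completes the square: the modulus of the numerator becomes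
a Gaussian centred at x = y, whose integral does not depend on y. -/
lemma norm_mordellExt_le {lam : ℂ} (hlam : 0 < lam.re) {b : ℝ} (hb : ∀ n : ℤ, b ≠ n) :
    ∃ C : ℝ, ∀ α ∈ Set.Icc (-1 : ℝ) 1, ∀ y : ℝ, ‖mordellExt lam b (α + lam * I * y)‖ ≤ C := by
  obtain ⟨δ, hδ, hδb⟩ := exists_le_norm_sinh_kernel hlam hb
  have hA : 0 < 3 * Real.pi * lam.re := by have := Real.pi_pos; positivity
  have hl : lam ≠ 0 := fun h0 => by simp [h0] at hlam
  have hG := integrable_exp_neg_mul_sq hA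
  refine ⟨Real.exp (3 * Real.pi * (lam⁻¹).re) / δ * ∫ x : ℝ, Real.exp (-(3 * Real.pi * lam.re) * x ^ 2),
    fun α hα y => ?_⟩
  have h1 : ∫ x : ℝ, Real.exp (-(3 * Real.pi * lam.re) * x ^ 2) =
      ∫ x : ℝ, Real.exp (-(3 * Real.pi * lam.re) * (x - y) ^ 2) :=
    (integral_sub_right_eq_self (fun x : ℝ => Real.exp (-(3 * Real.pi * lam.re) * x ^ 2)) y).symm
  rw [h1, mordellExt, kernelInt, ← integral_const_mul, ← integral_const_mul]
  refine norm_integral_le_of_norm_le ((hG.comp_sub_right y).const_mul _) (Eventually.of_forall fun x => ?_)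
  rw [kernel, norm_mul, norm_div, ← mul_div_assoc, ← norm_mul, gaussian, ← Complex.exp_add]
  have h2 : 3 * Real.pi * ((α : ℂ) + lam * I * y) ^ 2 / lam +
      (-(3 * Real.pi * lam * (x : ℂ) ^ 2) - 6 * Real.pi * I * (α + lam * I * y) * x) =
      ((3 * Real.pi * α ^ 2 : ℝ) : ℂ) * lam⁻¹ + (-(3 * Real.pi * (x - y) ^ 2) : ℝ) * lam
        + (6 * Real.pi * α * (y - x) : ℝ) * I := by
    push_cast
    field_simp
    ring_nf
    simp only [I_sq]
    ring
  have h3 : (((3 * Real.pi * α ^ 2 : ℝ) : ℂ) * lam⁻¹ + (-(3 * Real.pi * (x - y) ^ 2) : ℝ) * lam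
        + (6 * Real.pi * α * (y - x) : ℝ) * I).re =
      3 * Real.pi * α ^ 2 * (lam⁻¹).re + -(3 * Real.pi * lam.re) * (x - y) ^ 2 := by
    rw [add_re, add_re, re_ofReal_mul, re_ofReal_mul, re_ofReal_mul, I_re]
    ring
  rw [h2, Complex.norm_exp, h3, Real.exp_add, div_mul_eq_mul_div]
  refine div_le_div₀ (by positivity) (mul_le_mul_of_nonneg_right ?_ (Real.exp_pos _).le) hδ (hδb x)
  rw [Real.exp_le_exp]
  have h4 : α ^ 2 ≤ 1 := by nlinarith [hα.1, hα.2]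
  have h5 : 0 ≤ 3 * Real.pi * (lam⁻¹).re := by have := inv_re_pos hlam; positivity
  nlinarith

/-- Completing the square moves w from the denominator into the exponent, at the price of
translating x by -iw/λ. -/
lemma kernel_shift {lam : ℂ} (hl : lam ≠ 0) (b : ℝ) (w x : ℂ) :
    Complex.exp (-(3 * Real.pi * lam * x ^ 2)) / Complex.sinh (Real.pi * (lam * x - I * (w + b))) =
      Complex.exp (3 * Real.pi * w ^ 2 / lam) * kernel lam b w (x - I * w / lam) := by
  rw [kernel, gaussian, ← mul_div_assoc, ← Complex.exp_add]
  congr 2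
  · field_simp
    ring_nf
    simp only [I_sq]
    ring
  · field_simp
    ring_nf

/-- In the strip around the origin free of poles, `mordellExt` is the Mordell integral. -/
lemma integral_eq_mordellExt {lam : ℂ} (hlam : 0 < lam.re) {b : ℝ} {w : ℂ}
    (h : ∀ t ∈ Set.Icc (0 : ℝ) 1, ∀ n : ℤ, t * (w / lam).re + (b + n) * (lam⁻¹).re ≠ 0) :
    Integrable (fun x : ℝ => Complex.exp (-(3 * Real.pi * lam * (x : ℂ) ^ 2)) /
      Complex.sinh (Real.pi * (lam * x - I * (w + b)))) ∧
    ∫ x : ℝ, Complex.exp (-(3 * Real.pi * lam * (x : ℂ) ^ 2)) /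
      Complex.sinh (Real.pi * (lam * x - I * (w + b))) = mordellExt lam b w := by
  have hl : lam ≠ 0 := fun h0 => by simp [h0] at hlam
  set y := -(w / lam).re with hy
  have hseg : ∀ s ∈ Set.uIcc 0 y, ∃ t ∈ Set.Icc (0 : ℝ) 1, s = t * y := by
    intro s hs
    rw [← segment_eq_uIcc, segment_eq_image'] at hs
    obtain ⟨t, ht, rfl⟩ := hs
    exact ⟨t, ht, by simp⟩
  have hne : ∀ x : ℂ, x.im ∈ Set.uIcc 0 y → Complex.sinh (Real.pi * (lam * x - I * b)) ≠ 0 := by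
    intro x hx
    refine sinh_kernel_ne_zero hlam fun n hn => ?_
    obtain ⟨t, ht, hts⟩ := hseg _ hx
    refine h t ht n ?_
    rw [← hn, hts, hy]; ring
  have hline : ∀ s ∈ Set.uIcc 0 y, Integrable fun x : ℝ => kernel lam b w (x + s * I) :=
    fun s hs => integrable_kernel_line hlam b w s fun x => hne _ (by simpa using hs)
  -- The hypothesis over all t in [0,1] says that no pole lies at any height between 0 and y, so the
  -- contour may be moved there.
  have hshift := integral_strip_eq (f := kernel lam b w) (a := 0) (b := y)
    (fun x hx => differentiableAt_kernel (hne x hx))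
    (fun ε hε => by
      obtain ⟨T, hT⟩ := kernel_uniform_decay hlam b w |y| ε hε
      refine ⟨T, fun x hx s hs => hT x hx s ?_⟩
      obtain ⟨t, ht, rfl⟩ := hseg _ hs
      rw [abs_mul, abs_of_nonneg ht.1]
      exact mul_le_of_le_one_left (abs_nonneg _) ht.2)
    (hline 0 Set.left_mem_uIcc) (hline y Set.right_mem_uIcc)
  set F : ℝ → ℂ := fun x => kernel lam b w (x + y * I) with hF
  have hpt : ∀ x : ℝ, Complex.exp (-(3 * Real.pi * lam * (x : ℂ) ^ 2)) /
      Complex.sinh (Real.pi * (lam * x - I * (w + b))) =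
      Complex.exp (3 * Real.pi * w ^ 2 / lam) * F (x + (w / lam).im) := by
    intro x
    rw [kernel_shift hl, hF]
    congr 2
    have : I * w / lam = I * ((w / lam).re + (w / lam).im * I) := by
      rw [Complex.re_add_im]; ring
    rw [this, hy]
    push_cast
    linear_combination (-(w / lam).im : ℂ) * I_sq
  simp_rw [hpt]
  constructor
  · exact ((hline y Set.right_mem_uIcc).comp_add_right (w / lam).im).const_mul _
  · rw [integral_const_mul, integral_add_right_eq_self F, mordellExt, kernelInt, ← hshift]
    simp


/-! ### A vanishing principle for antiperiodic functions. -/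

/-- A function with removable singularities that is antiperiodic and bounded on a family of
equally spaced horizontal lines vanishes. -/
lemma eq_zero_of_antiperiodic_of_bounded_on_lines {D : ℂ → ℂ}
    (hdiff : ∀ w₀, ∀ᶠ w in 𝓝[≠] w₀, DifferentiableAt ℂ D w)
    (hres : ∀ w₀, Tendsto (fun w => (w - w₀) * D w) (𝓝[≠] w₀) (𝓝 0))
    (hper : ∀ w₀, ∀ᶠ w in 𝓝[≠] w₀, D (w + 1) = -D w)
    {C η ρ : ℝ} (hη : 0 < η) {p : ℤ → ℂ} (hp : ∀ j : ℤ, (p j).im = ρ + j * η)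
    (hcont : ∀ j : ℤ, ∀ α ∈ Set.Icc (0 : ℝ) 1, ContinuousAt D (α + p j))
    (hbound : ∀ j : ℤ, ∀ α ∈ Set.Icc (0 : ℝ) 1, ‖D (α + p j)‖ ≤ C)
    {w : ℂ} (hw : ContinuousAt D w) : D w = 0 := by
  -- E is the entire function obtained by filling in all the singularities at once with limits.
  set E : ℂ → ℂ := fun w₀ => limUnder (𝓝[≠] w₀) D with hE
  have hlim : ∀ w₀, Tendsto D (𝓝[≠] w₀) (𝓝 (E w₀)) := by
    intro w₀
    refine tendsto_limUnder_of_differentiable_on_punctured_nhds_of_isLittleO (hdiff w₀) ?_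
    have hne : ∀ᶠ x in 𝓝[≠] w₀, (x - w₀)⁻¹ = 0 → D x - D w₀ = 0 := by
      filter_upwards [self_mem_nhdsWithin] with x hx h0
      exact absurd (inv_eq_zero.1 h0) (sub_ne_zero.2 hx)
    rw [Asymptotics.isLittleO_iff_tendsto' hne]
    have h2 : Tendsto (fun x : ℂ => (x - w₀) * D w₀) (𝓝[≠] w₀) (𝓝 0) := by
      have : Tendsto (fun x : ℂ => (x - w₀) * D w₀) (𝓝 w₀) (𝓝 ((w₀ - w₀) * D w₀)) := by
        apply Continuous.tendsto; fun_prop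
      rw [sub_self, zero_mul] at this
      exact this.mono_left nhdsWithin_le_nhds
    have h1 := (hres w₀).sub h2
    rw [sub_zero] at h1
    refine h1.congr fun x => ?_
    rw [div_inv_eq_mul]
    ring
  have hEq : ∀ w₀, ContinuousAt D w₀ → E w₀ = D w₀ := fun w₀ h =>
    tendsto_nhds_unique (hlim w₀) (h.tendsto.mono_left nhdsWithin_le_nhds)
  have hEev : ∀ w₀, ∀ᶠ w in 𝓝[≠] w₀, E w = D w := fun w₀ =>
    (hdiff w₀).mono fun w hw => hEq w hw.continuousAt
  have hEdiff : Differentiable ℂ E := by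
    intro w₀
    refine (analyticAt_of_differentiable_on_punctured_nhds_of_continuousAt ?_ ?_).differentiableAt
    · have h1 := (hEev w₀)
      rw [eventually_nhdsWithin_iff] at h1
      have h2 := h1.eventually_nhds
      have h3 : ∀ᶠ w in 𝓝[≠] w₀, w ≠ w₀ := self_mem_nhdsWithin
      filter_upwards [h2.filter_mono nhdsWithin_le_nhds, hdiff w₀, h3] with w hw hwd hne
      refine hwd.congr_of_eventuallyEq ?_
      filter_upwards [hw, isOpen_ne.mem_nhds hne] with x hx hx2 using hx hx2
    · rw [continuousAt_iff_punctured_nhds]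
      exact (hlim w₀).congr' ((hEev w₀).mono fun _ h => h.symm)
  have hEper : ∀ w₀, E (w₀ + 1) = -E w₀ := by
    intro w₀
    have h1 : Tendsto (fun w : ℂ => w + 1) (𝓝[≠] w₀) (𝓝[≠] (w₀ + 1)) := by
      refine tendsto_nhdsWithin_of_tendsto_nhds_of_eventually_within _ ?_ ?_
      · exact ((continuous_id.add continuous_const).tendsto w₀).mono_left nhdsWithin_le_nhds
      · filter_upwards [self_mem_nhdsWithin] with w hw h
        exact hw (add_right_cancel h)
    have h2 := (hlim (w₀ + 1)).comp h1
    have h3 := (hlim w₀).neg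
    refine tendsto_nhds_unique (h2.congr' ?_) h3
    filter_upwards [hper w₀] with w hw using hw
  have hEnorm : ∀ (n : ℤ) w₀, ‖E (w₀ + n)‖ = ‖E w₀‖ := by
    have hper' : Function.Periodic (fun w₀ => ‖E w₀‖) 1 := fun w₀ => by
      simp only [hEper, norm_neg]
    intro n w₀
    have := hper'.int_mul n w₀
    simpa using this
  have hfrac : ∀ w₀ q : ℂ, w₀.im = q.im → ∃ α ∈ Set.Icc (0 : ℝ) 1, ∃ n : ℤ, w₀ = α + q + n := by
    intro w₀ q h
    refine ⟨Int.fract (w₀.re - q.re), ⟨Int.fract_nonneg _, (Int.fract_lt_one _).le⟩,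
      ⌊w₀.re - q.re⌋, ?_⟩
    have h1 := Int.fract_add_floor (w₀.re - q.re)
    apply Complex.ext
    · simp only [add_re, ofReal_re, intCast_re]
      linarith
    · simp [h]
  have hline : ∀ (j : ℤ) (w₀ : ℂ), w₀.im = ρ + j * η → ‖E w₀‖ ≤ C := by
    intro j w₀ h
    obtain ⟨α, hα, n, rfl⟩ := hfrac w₀ (p j) (by rw [h, hp])
    rw [hEnorm, hEq _ (hcont j α hα)]
    exact hbound j α hα
  have hall : ∀ w₀ : ℂ, ‖E w₀‖ ≤ C := by
    intro w₀
    set j := ⌊(w₀.im - ρ) / η⌋ with hj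
    have h1 : ρ + j * η ≤ w₀.im := by
      have := Int.floor_le ((w₀.im - ρ) / η)
      rw [le_div_iff₀ hη] at this
      linarith
    have h2 : w₀.im ≤ ρ + (j + 1 : ℤ) * η := by
      have := (Int.lt_floor_add_one ((w₀.im - ρ) / η)).le
      rw [div_le_iff₀ hη] at this
      push_cast
      linarith
    set a := ρ + j * η
    set b := ρ + (j + 1 : ℤ) * η with hb
    have hab : a < b := by
      have : b = a + η := by rw [hb]; push_cast; ring
      linarith
    -- The growth condition holds trivially: the norm has period 1, so E is already bounded on the
    -- strip by compactness of one period. Phragmén–Lindelöf replaces that bound by C, uniformly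
    -- over the strips.
    refine PhragmenLindelof.horizontal_strip (a := a) (b := b) hEdiff.diffContOnCl ?_
      (hline j) (hline (j + 1)) h1 h2
    refine ⟨0, div_pos Real.pi_pos (by linarith), 0, ?_⟩
    have hcomp : IsCompact ((Set.Icc (0 : ℝ) 1) ×ℂ (Set.Icc a b)) :=
      isCompact_Icc.reProdIm isCompact_Icc
    obtain ⟨M, hM⟩ := hcomp.exists_bound_of_continuousOn hEdiff.continuous.continuousOn
    refine Asymptotics.IsBigO.of_bound M ?_
    have hmem : ∀ᶠ x in comap (_root_.abs ∘ re) atTop ⊓ 𝓟 (im ⁻¹' Set.Ioo a b),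
        x ∈ im ⁻¹' Set.Ioo a b := mem_inf_of_right (mem_principal_self _)
    refine hmem.mono fun x hx => ?_
    simp only [zero_mul, Real.exp_zero, norm_one, mul_one]
    obtain ⟨α, hα, n, hxe⟩ := hfrac x (x.im * I) (by simp)
    rw [hxe, hEnorm]
    refine hM _ ?_
    rw [mem_reProdIm]
    constructor
    · simpa using hα
    · simpa using ⟨hx.1.le, hx.2.le⟩
  -- By Liouville E is constant, while antiperiodicity gives E(w + 1) = -E(w).
  have hconst : E (w + 1) = E w := hEdiff.apply_eq_apply_of_bounded
    (isBounded_iff_forall_norm_le.2 ⟨C, by rintro _ ⟨y, rfl⟩; exact hall y⟩) _ _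
  have h0 : E w = 0 := by
    have := hEper w
    rw [hconst] at this
    have h2 : 2 * E w = 0 := by linear_combination this
    simpa using h2
  rw [← hEq w hw, h0]

/-! ### Theta values, the dual series and the matching of poles. -/

/-- The point `(h + iz)/k` of the upper half-plane. -/
def modPt (k : ℕ) (h : ℤ) (z : ℂ) : ℂ := (h + I * z) / k

lemma modPt_im (k : ℕ) (h : ℤ) (z : ℂ) : (modPt k h z).im = z.re / k := by
  rw [modPt, Complex.div_natCast_im]; simp

lemma modPt_im_pos {k : ℕ} (hk : 0 < k) (h : ℤ) {z : ℂ} (hz : 0 < z.re) : 0 < (modPt k h z).im := by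
  rw [modPt_im]; positivity

/-- The series `∑ (-1)^m q^{(3m²+jm)/2}`. -/
def oddTheta (τ : ℂ) (j : ℤ) : ℂ :=
  ∑' m : ℤ, (-1) ^ m * Complex.exp (Real.pi * I * τ * (3 * m ^ 2 + j * m))

/-- For j = 3t with t odd, the reflection m ↦ -m - t preserves the exponent 3m(m + t) and reverses
the sign (-1)^m. -/
lemma oddTheta_three_mul (τ : ℂ) {j : ℤ} (hj : Odd j) (h3 : 3 ∣ j) : oddTheta τ j = 0 := by
  obtain ⟨t, rfl⟩ := h3
  have ht : Odd t := by
    rw [Int.odd_mul] at hj; exact hj.2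
  have h1 : oddTheta τ (3 * t) = -oddTheta τ (3 * t) := by
    rw [oddTheta, ← tsum_neg, ← ((Equiv.neg ℤ).trans (Equiv.addRight (-t))).tsum_eq]
    refine tsum_congr fun m => ?_
    simp only [Equiv.trans_apply, Equiv.neg_apply, Equiv.coe_addRight]
    rw [show -m + -t = -(m + t) by ring, zpow_neg, ← inv_zpow, show ((-1 : ℂ)⁻¹) = -1 by norm_num,
      zpow_add₀ (by norm_num : (-1 : ℂ) ≠ 0), ht.neg_one_zpow, mul_neg_one, neg_mul]
    congr 3
    push_cast
    ring
  have h2 : 2 * oddTheta τ (3 * t) = 0 := by linear_combination h1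
  simpa using h2

lemma oddTheta_neg (τ : ℂ) (j : ℤ) : oddTheta τ (-j) = oddTheta τ j := by
  rw [oddTheta, ← (Equiv.neg ℤ).tsum_eq, oddTheta]
  refine tsum_congr fun m => ?_
  simp only [Equiv.neg_apply]
  rw [zpow_neg, ← inv_zpow, show ((-1 : ℂ)⁻¹) = -1 by norm_num]
  push_cast
  congr 3
  ring

/-- Translating m by t completes the square; up to elementary factors only j modulo 6 matters. -/
lemma oddTheta_add (τ : ℂ) (j t : ℤ) :
    oddTheta τ (j + 6 * t) =
      (-1) ^ t * Complex.exp (-(Real.pi * I * τ * (3 * t ^ 2 + j * t))) * oddTheta τ j := by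
  rw [oddTheta, ← (Equiv.subRight t).tsum_eq, oddTheta, ← tsum_mul_left]
  refine tsum_congr fun m => ?_
  simp only [Equiv.subRight_apply]
  have h1 : (-1 : ℂ) ^ (m - t) = (-1) ^ t * (-1) ^ m := by
    rw [sub_eq_add_neg, zpow_add₀ (by norm_num : (-1 : ℂ) ≠ 0), zpow_neg, ← inv_zpow,
      show ((-1 : ℂ)⁻¹) = -1 by norm_num, mul_comm]
  rw [h1, mul_mul_mul_comm, ← Complex.exp_add, ]
  congr 2
  push_cast
  ring

/-- The dual series `e^{3πku²/z - 2πsu/z} ∑ (-1)^m q₁^{3m²/2+sm} / sin (π (iu/z + mτ₁))`. -/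
def appellDual (k : ℕ) (s : ℤ) (z τ u : ℂ) : ℂ :=
  Complex.exp (3 * Real.pi * k * u ^ 2 / z - 2 * Real.pi * s * u / z) *
    appell (gaussCoeff s τ) τ (I * u / z)

lemma eventually_forall_add_mul_ne {τ : ℂ} (hτ : 0 < τ.im) (v₀ : ℂ) :
    ∀ᶠ v in 𝓝[≠] v₀, ∀ m r : ℤ, v + m * τ ≠ r := by
  have key : ∀ c : ℤ → ℂ, (∀ m : ℤ, c m ≠ 0 → ∀ r : ℤ, v₀ + m * τ ≠ r) →
      ∀ᶠ v in 𝓝 v₀, ∀ m : ℤ, c m ≠ 0 → ∀ r : ℤ, v + m * τ ≠ r := by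
    intro c hc
    obtain ⟨δ, hδ, h⟩ := exists_le_norm_sin hτ hc
    filter_upwards [h] with v hv m hm r hr
    have := hv m hm
    rw [(sin_pi_mul_eq_zero_iff _).2 ⟨r, hr⟩, norm_zero] at this
    linarith
  by_cases h : ∃ m₀ r₀ : ℤ, v₀ + m₀ * τ = r₀
  · obtain ⟨m₀, r₀, h₀⟩ := h
    have h1 := key (Function.update 1 m₀ 0) (by
      intro m hm r hr
      have := eq_of_add_mul_eq hτ hr h₀
      subst this
      simp at hm)
    have h2 : ∀ᶠ v in 𝓝[≠] v₀, v ≠ v₀ := self_mem_nhdsWithin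
    filter_upwards [h1.filter_mono nhdsWithin_le_nhds, h2,
      mem_nhdsWithin_of_mem_nhds (Metric.ball_mem_nhds v₀ (zero_lt_one' ℝ))] with v hv hne hball m r hr
    by_cases hm : m = m₀
    · subst hm
      have h3 : v - v₀ = ((r - r₀ : ℤ) : ℂ) := by push_cast; linear_combination hr - h₀
      rw [Metric.mem_ball, dist_eq_norm, h3, Complex.norm_intCast] at hball
      have h4 : |r - r₀| < 1 := by exact_mod_cast hball
      rw [Int.abs_lt_one_iff] at h4
      rw [h4, Int.cast_zero, sub_eq_zero] at h3
      exact hne h3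
    · exact hv m (by simp [hm]) r hr
  · push Not at h
    have h1 := key 1 (fun m _ r => h m r)
    filter_upwards [h1.filter_mono nhdsWithin_le_nhds] with v hv m r
    exact hv m (by simp) r

/-- A finite geometric sum cancels the pole. It is applied with N = 3k, which is where the number of
Mordell integrals comes from. -/
lemma one_sub_exp_div_sin {x : ℂ} (hx : Complex.sin (Real.pi * x) ≠ 0) (N : ℕ) :
    (1 - Complex.exp (-(2 * Real.pi * I * N * x))) / Complex.sin (Real.pi * x) =
      2 * I * ∑ l ∈ Finset.range N, Complex.exp (-(Real.pi * I * (2 * l + 1) * x)) := by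
  rw [div_eq_iff hx, Complex.sin]
  set y := Complex.exp (-(Real.pi * I * x)) with hy
  have hy0 : y ≠ 0 := Complex.exp_ne_zero _
  have h1 : Complex.exp (-(2 * Real.pi * I * N * x)) = (y ^ 2) ^ N := by
    rw [hy, ← Complex.exp_nat_mul, ← Complex.exp_nat_mul]; congr 1; push_cast; ring
  have h2 : ∀ l : ℕ, Complex.exp (-(Real.pi * I * (2 * l + 1) * x)) = y * (y ^ 2) ^ l := by
    intro l
    rw [hy, ← Complex.exp_nat_mul, ← Complex.exp_nat_mul, ← Complex.exp_add]
    congr 1; push_cast; ring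
  have h3 : Complex.exp (-(Real.pi * x) * I) = y := by rw [hy]; congr 1; ring
  have h4 : Complex.exp (Real.pi * x * I) = y⁻¹ := by rw [hy, ← Complex.exp_neg]; congr 1; ring
  simp_rw [h2]
  rw [h1, h3, h4, ← Finset.mul_sum]
  have hg := mul_neg_geom_sum (y ^ 2) N
  rw [← hg]
  field_simp
  linear_combination (∑ i ∈ Finset.range N, (y ^ 2) ^ i) * (1 - y ^ 2) * I_sq


lemma natCast_mul_modPt {k : ℕ} (hk : 0 < k) (h : ℤ) (z : ℂ) : (k : ℂ) * modPt k h z = h + I * z := by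
  have : (k : ℂ) ≠ 0 := by exact_mod_cast hk.ne'
  rw [modPt]; field_simp

lemma neg_one_zpow_eq_neg_one {n : ℤ} (h : Odd n) : (-1 : ℂ) ^ n = -1 := h.neg_one_zpow

lemma neg_one_zpow_neg (n : ℤ) : (-1 : ℂ) ^ (-n) = (-1) ^ n := by
  rw [zpow_neg, ← inv_zpow, show ((-1 : ℂ)⁻¹) = -1 by norm_num]

/-- Since kτ₁ = h' + i/z, replacing (u, m) by (u + 1, m - k) moves the argument x = iu/z + mτ₁ of
the sine by the integer -h', and the Gaussian factors contribute e^(-6πikx). The parity condition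
makes the total sign -1, so the two values add up to terms (1 - e^(-6πikx))/sin πx. Expanding these
geometrically and summing over m gives the theta values. -/
lemma appellDual_add_one {k : ℕ} (hk : 0 < k) {h' s : ℤ} {z : ℂ} (hz : 0 < z.re)
    (hpar : Even ((1 + (k : ℤ)) * (1 + h'))) {u : ℂ}
    (hu : ∀ m r : ℤ, I * u / z + m * modPt k h' z⁻¹ ≠ r) :
    appellDual k s z (modPt k h' z⁻¹) (u + 1) + appellDual k s z (modPt k h' z⁻¹) u =
      2 * I * ∑ l ∈ Finset.range (3 * k), oddTheta (modPt k h' z⁻¹) (2 * s - 1 - 2 * l) *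
        Complex.exp (3 * Real.pi * k * u ^ 2 / z - Real.pi * (2 * s - 1 - 2 * l) * u / z) := by
  have hz0 : z ≠ 0 := fun h0 => by simp [h0] at hz
  set τ := modPt k h' z⁻¹ with hτdef
  have hkτ : (k : ℂ) * τ = h' + I * z⁻¹ := natCast_mul_modPt hk h' z⁻¹
  have hτ : 0 < τ.im := modPt_im_pos hk h' (inv_re_pos hz)
  set A := Complex.exp (3 * Real.pi * k * u ^ 2 / z - 2 * Real.pi * s * u / z) with hA
  set A' := Complex.exp (3 * Real.pi * k * (u + 1) ^ 2 / z - 2 * Real.pi * s * (u + 1) / z) with hA'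
  have hodd : Odd (h' * k + k + h') := by
    have : h' * k + k + h' = (1 + (k : ℤ)) * (1 + h') - 1 := by ring
    rw [this]; exact hpar.sub_odd odd_one
  have hcoef : ∀ m : ℤ, A' * gaussCoeff s τ (m - k) =
      (-1) ^ (h' * k + k) * (A * gaussCoeff s τ m *
        Complex.exp (-(2 * Real.pi * I * (3 * k : ℕ) * (I * u / z + m * τ)))) := by
    intro m
    have h1 : (-1 : ℂ) ^ (m - k) = (-1) ^ m * (-1) ^ (k : ℤ) := by
      rw [sub_eq_add_neg, zpow_add₀ (by norm_num : (-1 : ℂ) ≠ 0), neg_one_zpow_neg]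
    have h2 : (-1 : ℂ) ^ (h' * k) = Complex.exp (Real.pi * I * h' * (3 * k - 2 * s)) := by
      have h3 : Complex.exp (Real.pi * I * h' * (3 * k - 2 * s)) =
          (-1) ^ (h' * k + 2 * (h' * k - h' * s)) := by
        rw [neg_one_zpow_eq_exp]; congr 1; push_cast; ring
      rw [h3, zpow_add₀ (by norm_num : (-1 : ℂ) ≠ 0), (even_two_mul _).neg_one_zpow, mul_one]
    rw [gaussCoeff, gaussCoeff, h1, zpow_add₀ (by norm_num : (-1 : ℂ) ≠ 0), h2]
    have h4 : A' * Complex.exp (Real.pi * I * τ * (3 * ((m - k : ℤ) : ℂ) ^ 2 + 2 * s * ((m - k : ℤ) : ℂ))) =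
        Complex.exp (Real.pi * I * h' * (3 * k - 2 * s)) * (A *
          Complex.exp (Real.pi * I * τ * (3 * m ^ 2 + 2 * s * m)) *
          Complex.exp (-(2 * Real.pi * I * (3 * k : ℕ) * (I * u / z + m * τ)))) := by
      rw [hA, hA', ← Complex.exp_add, ← Complex.exp_add, ← Complex.exp_add, ← Complex.exp_add]
      congr 1
      have h5 : Real.pi * I * τ * (3 * ((m - k : ℤ) : ℂ) ^ 2 + 2 * s * ((m - k : ℤ) : ℂ)) =
          Real.pi * I * τ * (3 * m ^ 2 + 2 * s * m) - 6 * Real.pi * I * m * (k * τ)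
            + Real.pi * I * (3 * k - 2 * s) * (k * τ) := by push_cast; ring
      have h6 : 2 * Real.pi * I * (3 * k : ℕ) * (I * u / z + m * τ) =
          6 * Real.pi * I * m * (k * τ) + 6 * Real.pi * k * I ^ 2 * u / z := by
        push_cast; ring
      rw [h5, h6, hkτ, I_sq]
      field_simp
      ring_nf
      simp only [I_sq]
      ring
    linear_combination ((-1 : ℂ) ^ m * (-1) ^ (k : ℤ)) * h4
  have hshift : appellDual k s z τ (u + 1) = ∑' m : ℤ, -(A * (gaussCoeff s τ m *
      Complex.exp (-(2 * Real.pi * I * (3 * k : ℕ) * (I * u / z + m * τ))) /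
        Complex.sin (Real.pi * (I * u / z + m * τ)))) := by
    rw [appellDual, appell, ← (Equiv.subRight (k : ℤ)).tsum_eq, ← tsum_mul_left]
    refine tsum_congr fun m => ?_
    simp only [Equiv.subRight_apply]
    have h1 : I * (u + 1) / z + ((m - k : ℤ) : ℂ) * τ = ((-h' : ℤ) : ℂ) + (I * u / z + m * τ) := by
      push_cast
      rw [sub_mul, hkτ]
      ring
    rw [h1, sin_int_mul_pi_add, neg_one_zpow_neg, ← mul_div_assoc, hcoef]
    have h2 : (-1 : ℂ) ^ (h' * k + k) = -(-1) ^ h' := by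
      have h3 := neg_one_zpow_eq_neg_one hodd
      rw [zpow_add₀ (by norm_num : (-1 : ℂ) ≠ 0)] at h3
      have h4 : (-1 : ℂ) ^ h' * (-1) ^ h' = 1 := by
        rw [← zpow_add₀ (by norm_num : (-1 : ℂ) ≠ 0), Even.neg_one_zpow ⟨h', rfl⟩]
      linear_combination (-1 : ℂ) ^ h' * h3 - (-1 : ℂ) ^ (h' * k + k) * h4
    have h5 : (-1 : ℂ) ^ h' ≠ 0 := zpow_ne_zero _ (by norm_num)
    rw [h2, neg_mul, neg_div, mul_div_mul_left _ _ h5]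
    ring
  have hsum1 : Summable fun m : ℤ => A * (gaussCoeff s τ m / Complex.sin (Real.pi * (I * u / z + m * τ))) :=
    (summable_appell (summable_norm_gaussCoeff hτ s) hτ _).mul_left A
  have hterm : ∀ m : ℤ, A * (gaussCoeff s τ m / Complex.sin (Real.pi * (I * u / z + m * τ))) -
      A * (gaussCoeff s τ m * Complex.exp (-(2 * Real.pi * I * (3 * k : ℕ) * (I * u / z + m * τ))) /
        Complex.sin (Real.pi * (I * u / z + m * τ))) =
      ∑ l ∈ Finset.range (3 * k), 2 * I * (Complex.exp (3 * Real.pi * k * u ^ 2 / z -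
        Real.pi * (2 * s - 1 - 2 * l) * u / z) * ((-1) ^ m * Complex.exp (Real.pi * I * τ *
          (3 * m ^ 2 + ((2 * s - 1 - 2 * l : ℤ) : ℂ) * m)))) := by
    intro m
    have hsin : Complex.sin (Real.pi * (I * u / z + m * τ)) ≠ 0 := by
      rw [Ne, sin_pi_mul_eq_zero_iff]
      rintro ⟨r, hr⟩
      exact hu m r hr
    have h1 := one_sub_exp_div_sin hsin (3 * k)
    calc _ = A * gaussCoeff s τ m * ((1 - Complex.exp (-(2 * Real.pi * I * (3 * k : ℕ) *
          (I * u / z + m * τ)))) / Complex.sin (Real.pi * (I * u / z + m * τ))) := by ring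
      _ = _ := by
        rw [h1, Finset.mul_sum, Finset.mul_sum]
        refine Finset.sum_congr rfl fun l _ => ?_
        have h2 : A * Complex.exp (Real.pi * I * τ * (3 * m ^ 2 + 2 * s * m)) *
            Complex.exp (-(Real.pi * I * (2 * l + 1) * (I * u / z + m * τ))) =
            Complex.exp (3 * Real.pi * k * u ^ 2 / z - Real.pi * (2 * s - 1 - 2 * l) * u / z) *
              Complex.exp (Real.pi * I * τ * (3 * m ^ 2 + ((2 * s - 1 - 2 * l : ℤ) : ℂ) * m)) := by
          rw [hA, ← Complex.exp_add, ← Complex.exp_add, ← Complex.exp_add]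
          congr 1
          push_cast
          field_simp
          ring_nf
          simp only [I_sq]
          ring
        rw [gaussCoeff]
        linear_combination (2 * I * (-1) ^ m) * h2
  have hsl : ∀ l ∈ Finset.range (3 * k), Summable fun m : ℤ =>
      2 * I * (Complex.exp (3 * Real.pi * k * u ^ 2 / z -
        Real.pi * (2 * s - 1 - 2 * l) * u / z) * ((-1) ^ m * Complex.exp (Real.pi * I * τ *
          (3 * m ^ 2 + ((2 * s - 1 - 2 * l : ℤ) : ℂ) * m)))) := fun l _ =>
    (((summable_norm_exp_quadratic hτ _).of_norm).mul_left _).mul_left _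
  have hsum2 : Summable fun m : ℤ => A * (gaussCoeff s τ m *
      Complex.exp (-(2 * Real.pi * I * (3 * k : ℕ) * (I * u / z + m * τ))) /
        Complex.sin (Real.pi * (I * u / z + m * τ))) := by
    have := hsum1.sub (summable_sum hsl)
    refine this.congr fun m => ?_
    rw [← hterm m]
    ring
  rw [hshift, appellDual, appell, ← tsum_mul_left, ← hsum2.neg.tsum_add hsum1, Finset.mul_sum]
  have h3 : ∀ m : ℤ, -(A * (gaussCoeff s τ m *
      Complex.exp (-(2 * Real.pi * I * (3 * k : ℕ) * (I * u / z + m * τ))) /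
        Complex.sin (Real.pi * (I * u / z + m * τ)))) +
      A * (gaussCoeff s τ m / Complex.sin (Real.pi * (I * u / z + m * τ))) =
      ∑ l ∈ Finset.range (3 * k), 2 * I * (Complex.exp (3 * Real.pi * k * u ^ 2 / z -
        Real.pi * (2 * s - 1 - 2 * l) * u / z) * ((-1) ^ m * Complex.exp (Real.pi * I * τ *
          (3 * m ^ 2 + ((2 * s - 1 - 2 * l : ℤ) : ℂ) * m)))) := by
    intro m
    rw [← hterm m]
    ring
  simp_rw [h3]
  rw [Summable.tsum_finsetSum hsl]
  refine Finset.sum_congr rfl fun l _ => ?_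
  rw [tsum_mul_left, tsum_mul_left, oddTheta]
  ring

/-- The substitution (n, j) ↦ (nh - jk, nB - jh') has determinant kB - hh' = 1, so it is a bijection
between the pole lattices of the two series. -/
lemma modPt_transform {k : ℕ} (hk : 0 < k) {h h' B : ℤ} {z : ℂ} (hz : z ≠ 0)
    (hB : h * h' + 1 = k * B) (u : ℂ) (n j : ℤ) :
    I * u / z + ((n * h - j * k : ℤ) : ℂ) * modPt k h' z⁻¹ - ((n * B - j * h' : ℤ) : ℂ) =
      I / z * (u + n * modPt k h z - j) := by
  have hk0 : (k : ℂ) ≠ 0 := by exact_mod_cast hk.ne'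
  have hB' : (B : ℂ) = (h * h' + 1) / k := by
    rw [eq_div_iff hk0]; exact_mod_cast (by linarith : B * k = h * h' + 1)
  push_cast
  rw [hB', modPt, modPt]
  field_simp
  ring_nf
  simp only [I_sq]
  ring

/-- At a common pole the two exponents differ by πi times an explicit integer; the two parity
conditions make it even, whatever s is. -/
lemma residue_match {k : ℕ} (hk : 0 < k) {h h' B s : ℤ} {z : ℂ} (hz : z ≠ 0)
    (hB : h * h' + 1 = k * B) (hpar : Even ((1 + (k : ℤ)) * (1 + h')))
    (hpar' : Even ((1 + h) * (1 + B))) {u : ℂ} {n j : ℤ} (hu : u + n * modPt k h z = j) :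
    Complex.exp (3 * Real.pi * k * u ^ 2 / z - 2 * Real.pi * s * u / z) *
      (gaussCoeff s (modPt k h' z⁻¹) (n * h - j * k) * (-1) ^ (n * B - j * h')) =
    gaussCoeff 0 (modPt k h z) n * (-1) ^ j := by
  have hk0 : (k : ℂ) ≠ 0 := by exact_mod_cast hk.ne'
  have hB' : (B : ℂ) = (h * h' + 1) / k := by
    rw [eq_div_iff hk0]; exact_mod_cast (by linarith : B * k = h * h' + 1)
  have hu' : u = j - n * modPt k h z := by linear_combination hu
  -- Modulo 2 this integer is a combination of the two parity hypotheses and of products of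
  -- consecutive integers.
  obtain ⟨N, hN⟩ : Even ((n * h - j * k) + (n * B - j * h') - n - j +
      3 * (n ^ 2 * h * B - 2 * n * j * k * B + j ^ 2 * k * h') + 2 * s * (n * B - j * h')) := by
    have e1 : Even (n * (n - 1)) := Int.even_mul_pred_self n
    have e2 : Even (j * (j + 1)) := Int.even_mul_succ_self j
    have : (n * h - j * k) + (n * B - j * h') - n - j +
      3 * (n ^ 2 * h * B - 2 * n * j * k * B + j ^ 2 * k * h') + 2 * s * (n * B - j * h') =
      n * ((1 + h) * (1 + B)) - j * ((1 + (k : ℤ)) * (1 + h')) + (h * B) * (n * (n - 1))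
        + (k * h') * (j * (j + 1))
        + 2 * (h * B * n ^ 2 - n + k * h' * j ^ 2 - 3 * n * j * k * B + s * (n * B - j * h')) := by ring
    rw [this]
    exact ((((hpar'.mul_left n).sub (hpar.mul_left j)).add (e1.mul_left _)).add (e2.mul_left _)).add
      (even_two_mul _)
  rw [gaussCoeff, gaussCoeff]
  simp only [neg_one_zpow_eq_exp, ← Complex.exp_add]
  rw [Complex.exp_eq_exp_iff_exists_int]
  refine ⟨N, ?_⟩
  have hN' : (N : ℂ) = (((n * h - j * k) + (n * B - j * h') - n - j +
      3 * (n ^ 2 * h * B - 2 * n * j * k * B + j ^ 2 * k * h') + 2 * s * (n * B - j * h') : ℤ) : ℂ) / 2 := by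
    rw [hN]; push_cast; ring
  rw [hN', hu']
  push_cast
  rw [hB', modPt, modPt]
  field_simp
  ring_nf
  simp only [I_sq]
  ring


/-! ### The defect of the transformation law vanishes. -/

/-- The coefficient of the `l`-th Mordell integral in the transformation law. -/
def oddThetaHat (k : ℕ) (z τ : ℂ) (j : ℤ) : ℂ :=
  Complex.exp (-(Real.pi * j ^ 2 / (12 * k * z))) * oddTheta τ j

/-- The `l`-th Mordell integral, continued to an entire function of `w`, with its coefficient. -/
def mordellTerm (k : ℕ) (z τ : ℂ) (b₀ : ℝ) (j : ℤ) (w : ℂ) : ℂ :=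
  if 3 ∣ j then 0 else oddThetaHat k z τ j * mordellExt (z / k) (b₀ - j / (6 * k)) w

lemma div_natCast_re_pos {k : ℕ} (hk : 0 < k) {z : ℂ} (hz : 0 < z.re) : 0 < (z / k).re := by
  rw [Complex.div_natCast_re]; positivity

lemma differentiable_mordellTerm {k : ℕ} (hk : 0 < k) {z : ℂ} (hz : 0 < z.re) (τ : ℂ) {b₀ : ℝ} {j : ℤ}
    (hb : ¬ 3 ∣ j → b₀ - j / (6 * k) ∈ Set.Ioo (0 : ℝ) 1) : Differentiable ℂ (mordellTerm k z τ b₀ j) := by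
  unfold mordellTerm
  split_ifs with h
  · exact differentiable_const 0
  · exact (differentiable_mordellExt (div_natCast_re_pos hk hz)
      (ne_int_of_mem_Ioo (hb h))).const_mul _

/-- With b = b₀ - j/(6k), the factor e^(-πj²/(12kz)) turns the residue Gaussian into the exponential
found in `appellDual_add_one`. For 3 ∣ j both sides vanish, so the window condition is not needed
there. -/
lemma mordellTerm_add_one {k : ℕ} (hk : 0 < k) {z : ℂ} (hz : 0 < z.re) (τ : ℂ) {b₀ : ℝ} {j : ℤ}
    (hj : Odd j) (hb : ¬ 3 ∣ j → b₀ - j / (6 * k) ∈ Set.Ioo (0 : ℝ) 1) (w : ℂ) :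
    mordellTerm k z τ b₀ j (w + 1) + mordellTerm k z τ b₀ j w =
      2 * I * k / z * (oddTheta τ j *
        Complex.exp (3 * Real.pi * k * (w + b₀) ^ 2 / z - Real.pi * j * (w + b₀) / z)) := by
  have hz0 : z ≠ 0 := fun h0 => by simp [h0] at hz
  have hk0 : (k : ℂ) ≠ 0 := by exact_mod_cast hk.ne'
  unfold mordellTerm
  split_ifs with h
  · rw [oddTheta_three_mul τ hj h]; ring
  · rw [← mul_add, mordellExt_add_one (div_natCast_re_pos hk hz) (hb h), oddThetaHat]
    have h1 : Complex.exp (-(Real.pi * j ^ 2 / (12 * k * z))) *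
        Complex.exp (3 * Real.pi * (w + (b₀ - j / (6 * k) : ℝ)) ^ 2 / (z / k)) =
        Complex.exp (3 * Real.pi * k * (w + b₀) ^ 2 / z - Real.pi * j * (w + b₀) / z) := by
      rw [← Complex.exp_add]
      congr 1
      push_cast
      field_simp
      ring
    rw [← h1]
    field_simp

lemma norm_mordellTerm_le {k : ℕ} (hk : 0 < k) {z : ℂ} (hz : 0 < z.re) (τ : ℂ) {b₀ : ℝ} {j : ℤ}
    (hb : ¬ 3 ∣ j → b₀ - j / (6 * k) ∈ Set.Ioo (0 : ℝ) 1) :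
    ∃ C : ℝ, ∀ α ∈ Set.Icc (-1 : ℝ) 1, ∀ y : ℝ, ‖mordellTerm k z τ b₀ j (α + I * z * y)‖ ≤ C := by
  have hk0 : (k : ℂ) ≠ 0 := by exact_mod_cast hk.ne'
  by_cases h : 3 ∣ j
  · exact ⟨0, fun α _ y => by simp [mordellTerm, h]⟩
  · obtain ⟨C, hC⟩ := norm_mordellExt_le (div_natCast_re_pos hk hz) (ne_int_of_mem_Ioo (hb h))
    refine ⟨‖oddThetaHat k z τ j‖ * C, fun α hα y => ?_⟩
    rw [mordellTerm, if_neg h, norm_mul]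
    refine mul_le_mul_of_nonneg_left ?_ (norm_nonneg _)
    have := hC α hα (k * y)
    have e : (α : ℂ) + I * z * y = α + z / k * I * (k * y : ℝ) := by
      push_cast
      field_simp
    rwa [e]

lemma tendsto_sub_mul_zero {f : ℂ → ℂ} {w₀ : ℂ} (hf : ContinuousAt f w₀) :
    Tendsto (fun w => (w - w₀) * f w) (𝓝[≠] w₀) (𝓝 0) := by
  have h1 : ContinuousAt (fun w => (w - w₀) * f w) w₀ :=
    (by fun_prop : ContinuousAt (fun w => w - w₀) w₀).mul hf
  have := h1.tendsto.mono_left (nhdsWithin_le_nhds (s := {w₀}ᶜ))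
  simpa using this

lemma tendsto_affine_punctured {a : ℂ} (ha : a ≠ 0) (b w₀ : ℂ) :
    Tendsto (fun w : ℂ => a * w + b) (𝓝[≠] w₀) (𝓝[≠] (a * w₀ + b)) := by
  refine tendsto_nhdsWithin_of_tendsto_nhds_of_eventually_within _ ?_ ?_
  · have : Continuous fun w : ℂ => a * w + b := by fun_prop
    exact (this.tendsto w₀).mono_left nhdsWithin_le_nhds
  · filter_upwards [self_mem_nhdsWithin] with w hw h
    exact hw (mul_left_cancel₀ ha (add_right_cancel h))

lemma differentiableAt_appell {c : ℤ → ℂ} (hc : Summable fun m => ‖c m‖) {τ : ℂ}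
    (hτ : 0 < τ.im) {v : ℂ} (h : ∀ m r : ℤ, v + m * τ ≠ r) : DifferentiableAt ℂ (appell c τ) v :=
  (eventually_differentiableAt_appell hc hτ fun m _ r => h m r).self_of_nhds

lemma differentiableAt_appellDual {k : ℕ} {s : ℤ} {z τ : ℂ} (hτ : 0 < τ.im) {u : ℂ}
    (h : ∀ m r : ℤ, I * u / z + m * τ ≠ r) : DifferentiableAt ℂ (appellDual k s z τ) u := by
  unfold appellDual
  have h1 := differentiableAt_appell (summable_norm_gaussCoeff hτ s) hτ h
  have h2 : DifferentiableAt ℂ (fun u => appell (gaussCoeff s τ) τ (I * u / z)) u :=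
    DifferentiableAt.comp (f := fun u => I * u / z) u h1 (by fun_prop)
  exact DifferentiableAt.fun_mul (by fun_prop) h2

/-- The difference of the two sides of the transformation law. -/
def transformDefect (k : ℕ) (h h' s : ℤ) (z : ℂ) (b₀ : ℝ) (w : ℂ) : ℂ :=
  appell (gaussCoeff 0 (modPt k h z)) (modPt k h z) (w + b₀) -
    I / z * appellDual k s z (modPt k h' z⁻¹) (w + b₀) +
    I / k * ∑ l ∈ Finset.range (3 * k), mordellTerm k z (modPt k h' z⁻¹) b₀ (2 * s - 1 - 2 * l) w

section
variable {k : ℕ} (hk : 0 < k) {h h' B s : ℤ} {z : ℂ} (hz : 0 < z.re)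
    (hB : h * h' + 1 = k * B) (hpar : Even ((1 + (k : ℤ)) * (1 + h')))
    (hpar' : Even ((1 + h) * (1 + B))) {b₀ : ℝ}
    (hb : ∀ l ∈ Finset.range (3 * k), ¬ (3 : ℤ) ∣ 2 * s - 1 - 2 * l →
      b₀ - (2 * s - 1 - 2 * l : ℤ) / (6 * k) ∈ Set.Ioo (0 : ℝ) 1)

include hk hz hB

/-- One direction uses `modPt_transform`, the other the inverse integer matrix. -/
lemma dual_pole_iff (u : ℂ) :
    (∀ m r : ℤ, I * u / z + m * modPt k h' z⁻¹ ≠ r) ↔ ∀ n j : ℤ, u + n * modPt k h z ≠ j := by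
  have hz0 : z ≠ 0 := fun h0 => by simp [h0] at hz
  have hIz : I / z ≠ 0 := div_ne_zero I_ne_zero hz0
  constructor
  · intro H n j hnj
    refine H (n * h - j * k) (n * B - j * h') ?_
    have := modPt_transform hk hz0 hB u n j
    rw [sub_eq_zero.2 hnj, mul_zero] at this
    exact sub_eq_zero.1 this
  · intro H m r hmr
    refine H (-h' * m + k * r) (-B * m + h * r) ?_
    have := modPt_transform hk hz0 hB u (-h' * m + k * r) (-B * m + h * r)
    have e1 : (-h' * m + k * r) * h - (-B * m + h * r) * k = m := by linear_combination (-m) * hB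
    have e2 : (-h' * m + k * r) * B - (-B * m + h * r) * h' = r := by linear_combination (-r) * hB
    rw [e1, e2, sub_eq_zero.2 hmr] at this
    exact sub_eq_zero.1 ((mul_eq_zero.1 this.symm).resolve_left hIz)

include hb in
lemma differentiableAt_transformDefect {w : ℂ}
    (hw : ∀ n j : ℤ, (w + b₀) + n * modPt k h z ≠ j) :
    DifferentiableAt ℂ (transformDefect k h h' s z b₀) w := by
  have hτ := modPt_im_pos hk h hz
  have hτ' := modPt_im_pos hk h' (inv_re_pos hz)
  have h1 := differentiableAt_appell (summable_norm_gaussCoeff hτ 0) hτ hw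
  have h2 := differentiableAt_appellDual (k := k) (s := s) hτ' ((dual_pole_iff hk hz hB (w + b₀)).2 hw)
  have h3 : DifferentiableAt ℂ (fun w => appell (gaussCoeff 0 (modPt k h z)) (modPt k h z) (w + b₀)) w :=
    DifferentiableAt.comp (f := fun w : ℂ => w + b₀) w h1 (by fun_prop)
  have h4 : DifferentiableAt ℂ (fun w => appellDual k s z (modPt k h' z⁻¹) (w + b₀)) w :=
    DifferentiableAt.comp (f := fun w : ℂ => w + b₀) w h2 (by fun_prop)
  unfold transformDefect
  refine DifferentiableAt.fun_add (h3.fun_sub (h4.const_mul _)) (DifferentiableAt.const_mul ?_ _)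
  exact DifferentiableAt.fun_sum fun l hl => (differentiable_mordellTerm hk hz _ (hb l hl)) w

omit hB in
lemma eventually_no_pole (w₀ : ℂ) :
    ∀ᶠ w in 𝓝[≠] w₀, ∀ n j : ℤ, (w + b₀) + n * modPt k h z ≠ j := by
  have h1 := eventually_forall_add_mul_ne (modPt_im_pos hk h hz) (w₀ + b₀)
  have h2 := tendsto_affine_punctured one_ne_zero (b₀ : ℂ) w₀
  simp only [one_mul] at h2
  exact h2.eventually h1

include hpar hpar' hb

/-- The coefficient i/z of the dual series is the derivative of its argument iu/z, so it cancels out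
of the residue and `residue_match` compares what is left. The Mordell terms are entire. -/
lemma tendsto_transformDefect (w₀ : ℂ) :
    Tendsto (fun w => (w - w₀) * transformDefect k h h' s z b₀ w) (𝓝[≠] w₀) (𝓝 0) := by
  have hz0 : z ≠ 0 := fun h0 => by simp [h0] at hz
  have hIz : I / z ≠ 0 := div_ne_zero I_ne_zero hz0
  by_cases hp : ∀ n j : ℤ, (w₀ + b₀) + n * modPt k h z ≠ j
  · exact tendsto_sub_mul_zero
      (differentiableAt_transformDefect hk hz hB hb hp).continuousAt
  · push Not at hp
    obtain ⟨n, j, hnj⟩ := hp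
    have hτ := modPt_im_pos hk h hz
    have hτ' := modPt_im_pos hk h' (inv_re_pos hz)
    have hdual : I * (w₀ + b₀) / z + ((n * h - j * k : ℤ) : ℂ) * modPt k h' z⁻¹ =
        ((n * B - j * h' : ℤ) : ℂ) := by
      have := modPt_transform hk hz0 hB (w₀ + b₀) n j
      rw [sub_eq_zero.2 hnj, mul_zero] at this
      exact sub_eq_zero.1 this
    have r1 := (appell_pole (summable_norm_gaussCoeff hτ 0) hτ hnj).2
    have r2 := (appell_pole (summable_norm_gaussCoeff hτ' s) hτ' hdual).2
    have t1 := tendsto_affine_punctured one_ne_zero (b₀ : ℂ) w₀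
    simp only [one_mul] at t1
    have t2 := tendsto_affine_punctured hIz (I / z * b₀) w₀
    have e2 : I / z * w₀ + I / z * b₀ = I * (w₀ + b₀) / z := by ring
    rw [e2] at t2
    have q1 := r1.comp t1
    have q2 := r2.comp t2
    set A : ℂ → ℂ := fun u => Complex.exp (3 * Real.pi * k * u ^ 2 / z - 2 * Real.pi * s * u / z) with hA
    have hAc : Tendsto (fun w => A (w + b₀)) (𝓝[≠] w₀) (𝓝 (A (w₀ + b₀))) := by
      have : Continuous fun w => A (w + b₀) := by fun_prop
      exact (this.tendsto w₀).mono_left nhdsWithin_le_nhds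
    have q3 := hAc.mul q2
    have hE : ContinuousAt (fun w => I / k * ∑ l ∈ Finset.range (3 * k),
        mordellTerm k z (modPt k h' z⁻¹) b₀ (2 * s - 1 - 2 * l) w) w₀ := by
      have hE' : DifferentiableAt ℂ (fun w => ∑ l ∈ Finset.range (3 * k),
          mordellTerm k z (modPt k h' z⁻¹) b₀ (2 * s - 1 - 2 * l) w) w₀ :=
        DifferentiableAt.fun_sum fun l hl => (differentiable_mordellTerm hk hz _ (hb l hl)) w₀
      exact (hE'.const_mul _).continuousAt
    have q4 := (q1.sub q3).add (tendsto_sub_mul_zero hE)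
    have hzero : gaussCoeff 0 (modPt k h z) n * (-1) ^ j / Real.pi -
        A (w₀ + b₀) * (gaussCoeff s (modPt k h' z⁻¹) (n * h - j * k) * (-1) ^ (n * B - j * h') / Real.pi)
        + 0 = 0 := by
      have := residue_match hk hz0 hB hpar hpar' (s := s) hnj
      rw [← this, hA]
      ring
    rw [hzero] at q4
    refine q4.congr fun w => ?_
    simp only [Function.comp, transformDefect, appellDual, hA]
    rw [show I / z * w + I / z * b₀ = I * (w + b₀) / z by ring]
    ring

omit hpar' in
-- The first series is antiperiodic by itself; the inhomogeneous parts of the dual series and of the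
-- Mordell terms are equal and enter with opposite signs.
lemma transformDefect_add_one (w : ℂ) (hw : ∀ n j : ℤ, (w + b₀) + n * modPt k h z ≠ j) :
    transformDefect k h h' s z b₀ (w + 1) = -transformDefect k h h' s z b₀ w := by
  have hz0 : z ≠ 0 := fun h0 => by simp [h0] at hz
  have hk0 : (k : ℂ) ≠ 0 := by exact_mod_cast hk.ne'
  have h1 := appell_add_int (gaussCoeff 0 (modPt k h z)) (modPt k h z) (w + b₀) 1
  have h2 := appellDual_add_one hk hz hpar (s := s) ((dual_pole_iff hk hz hB (w + b₀)).2 hw)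
  have h3 : ∀ l ∈ Finset.range (3 * k), mordellTerm k z (modPt k h' z⁻¹) b₀ (2 * s - 1 - 2 * l) (w + 1) +
      mordellTerm k z (modPt k h' z⁻¹) b₀ (2 * s - 1 - 2 * l) w = 2 * I * k / z *
      (oddTheta (modPt k h' z⁻¹) (2 * s - 1 - 2 * l) *
        Complex.exp (3 * Real.pi * k * (w + b₀) ^ 2 / z - Real.pi * (2 * s - 1 - 2 * l) * (w + b₀) / z)) := by
    intro l hl
    rw [mordellTerm_add_one hk hz _ ⟨s - 1 - l, by ring⟩ (hb l hl)]
    push_cast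
    rfl
  have h4 := Finset.sum_congr rfl h3
  rw [Finset.sum_add_distrib, ← Finset.mul_sum] at h4
  simp only [Int.cast_one, zpow_one] at h1
  rw [transformDefect, transformDefect, show w + 1 + b₀ = w + b₀ + 1 by ring, h1]
  have h5 := eq_sub_of_add_eq h2
  have h6 := eq_sub_of_add_eq h4
  rw [h5, h6]
  field_simp
  ring

omit hb hpar hpar' hB in
-- The imaginary part is an odd multiple of Re z/(2k): the offset 1/(2k) puts these lines halfway
-- between neighbouring rows of poles.
lemma line_no_pole {α : ℝ} {j : ℤ} (n r : ℤ) :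
    (α : ℂ) + I * z * ((j : ℝ) + 1 / (2 * k) : ℝ) + n * modPt k h z ≠ r := by
  intro hr
  have h1 := congrArg Complex.im hr
  have h2 : ((n : ℂ) * modPt k h z).im = n * (z.re / k) := by
    rw [show (n : ℂ) = ((n : ℝ) : ℂ) by push_cast; rfl, Complex.im_ofReal_mul, modPt_im]
  rw [add_im, h2, add_im, Complex.im_mul_ofReal] at h1
  simp only [ofReal_im, I_mul_im, intCast_im, zero_add] at h1
  have hk' : (0 : ℝ) < k := by exact_mod_cast hk
  field_simp at h1
  have h3 : (2 * k * j + 1 + 2 * n : ℝ) = 0 := by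
    rw [mul_zero] at h1
    rcases mul_eq_zero.1 h1 with h1 | h1
    · exact absurd h1 hz.ne'
    · linarith
  have h4 : 2 * (k * j + n : ℤ) + 1 = 0 := by
    have : (2 * k * j + 1 + 2 * n : ℤ) = 0 := by exact_mod_cast h3
    linarith
  omega

omit hb hpar hpar' hB in
lemma norm_appell_line_le : ∃ C : ℝ, ∀ (α : ℝ) (j : ℤ),
    ‖appell (gaussCoeff 0 (modPt k h z)) (modPt k h z)
      (α + I * z * ((j : ℝ) + 1 / (2 * k) : ℝ))‖ ≤ C := by
  have hk' : (0 : ℝ) < k := by exact_mod_cast hk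
  have hδ : 0 < Real.pi * (z.re / (2 * k)) := by have := Real.pi_pos; positivity
  refine ⟨_, fun α j => norm_appell_le (summable_norm_gaussCoeff (modPt_im_pos hk h hz) 0) hδ fun m => ?_⟩
  refine mul_le_mul_of_nonneg_left ?_ Real.pi_pos.le
  have h1 : ((α : ℂ) + I * z * ((j : ℝ) + 1 / (2 * k) : ℝ)).im + m * (modPt k h z).im =
      (z.re / (2 * k)) * ((2 * k * j + 1 + 2 * m : ℤ) : ℝ) := by
    rw [add_im, Complex.im_mul_ofReal, modPt_im]
    simp only [ofReal_im, I_mul_im, zero_add]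
    push_cast
    field_simp
  rw [h1, abs_mul, abs_of_pos (by positivity)]
  refine le_mul_of_one_le_right (by positivity) ?_
  have h2 : (2 * k * j + 1 + 2 * m : ℤ) ≠ 0 := by
    rw [show (2 * k * j + 1 + 2 * m : ℤ) = 2 * (k * j + m) + 1 by ring]
    omega
  exact_mod_cast Int.one_le_abs h2

omit hb hpar hpar' in
-- On these lines the argument iu/z depends on j only through the integer -j, which changes a sign,
-- so compactness in α bounds the series. In the prefactor the height contributes the nonpositive
-- exponent -3πkβ² Re z.
lemma norm_appellDual_line_le : ∃ C : ℝ, ∀ α ∈ Set.Icc (0 : ℝ) 1, ∀ j : ℤ,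
    ‖appellDual k s z (modPt k h' z⁻¹) (α + I * z * ((j : ℝ) + 1 / (2 * k) : ℝ))‖ ≤ C := by
  have hz0 : z ≠ 0 := fun h0 => by simp [h0] at hz
  set τ := modPt k h' z⁻¹ with hτdef
  have hτ : 0 < τ.im := modPt_im_pos hk h' (inv_re_pos hz)
  have hρ := inv_re_pos hz
  set c := gaussCoeff s τ with hc
  have harg : ∀ (α : ℝ) (j : ℤ), I * (α + I * z * ((j : ℝ) + 1 / (2 * k) : ℝ)) / z =
      (I * α / z - 1 / (2 * k)) + ((-j : ℤ) : ℂ) := by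
    intro α j
    push_cast
    field_simp
    ring_nf
    simp only [I_sq]
    ring
  have hcont : ContinuousOn (fun α : ℝ => appell c τ (I * α / z - 1 / (2 * k))) (Set.Icc 0 1) := by
    intro α _
    refine ContinuousAt.continuousWithinAt ?_
    have hne : ∀ m r : ℤ, (I * α / z - 1 / (2 * k)) + m * τ ≠ r := by
      have h1 := (dual_pole_iff hk hz hB (α + I * z * (((0 : ℤ) : ℝ) + 1 / (2 * k) : ℝ))).2
        (fun n r => line_no_pole hk hz n r)
      intro m r
      have := h1 m r
      rwa [harg, neg_zero, Int.cast_zero, add_zero] at this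
    exact ContinuousAt.comp (f := fun α : ℝ => (I * α / z - 1 / (2 * k) : ℂ))
      (differentiableAt_appell (summable_norm_gaussCoeff hτ s) hτ hne).continuousAt
      (by fun_prop)
  obtain ⟨M, hM⟩ := isCompact_Icc.exists_bound_of_continuousOn hcont
  refine ⟨Real.exp (3 * Real.pi * k * (z⁻¹).re + 2 * Real.pi * |(s : ℝ)| * (z⁻¹).re) * M, fun α hα j => ?_⟩
  rw [appellDual, harg, appell_add_int, norm_mul, norm_mul, norm_neg_one_zpow, one_mul]
  refine mul_le_mul ?_ (hM α hα) (norm_nonneg _) (Real.exp_pos _).le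
  rw [Complex.norm_exp, Real.exp_le_exp]
  set β : ℝ := (j : ℝ) + 1 / (2 * k) with hβ
  have h1 : 3 * Real.pi * k * ((α : ℂ) + I * z * β) ^ 2 / z - 2 * Real.pi * s * (α + I * z * β) / z =
      ((3 * Real.pi * k * α ^ 2 - 2 * Real.pi * s * α : ℝ) : ℂ) * z⁻¹ +
      (-(3 * Real.pi * k * β ^ 2) : ℝ) * z + (6 * Real.pi * k * α * β - 2 * Real.pi * s * β : ℝ) * I := by
    push_cast
    field_simp
    ring_nf
    simp only [I_sq]
    ring
  rw [h1, add_re, add_re, re_ofReal_mul, re_ofReal_mul, re_ofReal_mul, I_re, mul_zero, add_zero]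
  have hpi := Real.pi_pos
  have hk' : (0 : ℝ) < k := by exact_mod_cast hk
  have h2 : 0 ≤ 3 * Real.pi * k * β ^ 2 * z.re := by positivity
  have h3 : 3 * Real.pi * k * α ^ 2 - 2 * Real.pi * s * α ≤ 3 * Real.pi * k + 2 * Real.pi * |(s : ℝ)| := by
    have h4 : α ^ 2 ≤ 1 := by nlinarith [hα.1, hα.2]
    have h5 : -(s * α) ≤ |(s : ℝ)| := by
      refine (neg_le_abs _).trans ?_
      rw [abs_mul, abs_of_nonneg hα.1]
      exact mul_le_of_le_one_right (abs_nonneg _) hα.2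
    have h6 : 3 * Real.pi * k * α ^ 2 ≤ 3 * Real.pi * k := mul_le_of_le_one_right (by positivity) h4
    have h7 : 2 * Real.pi * (-(s * α)) ≤ 2 * Real.pi * |(s : ℝ)| :=
      mul_le_mul_of_nonneg_left h5 (by positivity)
    linarith
  have h8 := mul_le_mul_of_nonneg_right h3 hρ.le
  linarith

/-- The transformation law before dividing by `(q; q)_∞`, for the continued integrals. -/
theorem transformDefect_eq_zero (hb₀ : b₀ ∈ Set.Icc (0 : ℝ) 1) {w : ℂ}
    (hw : ∀ n j : ℤ, (w + b₀) + n * modPt k h z ≠ j) :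
    transformDefect k h h' s z b₀ w = 0 := by
  have hk' : (0 : ℝ) < k := by exact_mod_cast hk
  obtain ⟨C₁, hC₁⟩ := norm_appell_line_le (h := h) hk hz
  obtain ⟨C₂, hC₂⟩ := norm_appellDual_line_le (s := s) hk hz hB
  choose! C₃ hC₃ using fun l (hl : l ∈ Finset.range (3 * k)) =>
    norm_mordellTerm_le hk hz (modPt k h' z⁻¹) (hb l hl)
  -- Subtracting b₀ puts w + b₀ = α + p j + b₀ on the good lines. The Mordell terms, bounded in
  -- terms of w itself, then see α - b₀, hence the interval [-1,1] in their bound.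
  set p : ℤ → ℂ := fun j => I * z * ((j : ℝ) + 1 / (2 * k) : ℝ) - b₀ with hp
  refine eq_zero_of_antiperiodic_of_bounded_on_lines (D := transformDefect k h h' s z b₀)
    (fun w₀ => (eventually_no_pole hk hz w₀).mono fun w hw =>
      differentiableAt_transformDefect hk hz hB hb hw)
    (tendsto_transformDefect hk hz hB hpar hpar' hb)
    (fun w₀ => (eventually_no_pole hk hz w₀).mono fun w hw =>
      transformDefect_add_one hk hz hB hpar hb w hw)
    (C := C₁ + ‖I / z‖ * C₂ + ‖I / (k : ℂ)‖ * ∑ l ∈ Finset.range (3 * k), C₃ l)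
    (η := z.re) (ρ := z.re / (2 * k)) hz (p := p) ?_ ?_ ?_
    (differentiableAt_transformDefect hk hz hB hb hw).continuousAt
  · intro j
    simp only [hp]
    rw [sub_im, Complex.im_mul_ofReal, I_mul_im, ofReal_im]
    ring
  · intro j α _
    refine (differentiableAt_transformDefect hk hz hB hb fun n r => ?_).continuousAt
    have := line_no_pole (h := h) (α := α) (j := j) hk hz n r
    have e1 : (α : ℂ) + p j + b₀ = α + I * z * ((j : ℝ) + 1 / (2 * k) : ℝ) := by simp only [hp]; ring
    rwa [e1]
  · intro j α hα
    have e1 : (α : ℂ) + p j + b₀ = α + I * z * ((j : ℝ) + 1 / (2 * k) : ℝ) := by simp only [hp]; ring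
    have e2 : (α : ℂ) + p j = (α - b₀ : ℝ) + I * z * ((j : ℝ) + 1 / (2 * k) : ℝ) := by
      simp only [hp]; push_cast; ring
    have hα' : α - b₀ ∈ Set.Icc (-1 : ℝ) 1 := ⟨by linarith [hα.1, hb₀.2], by linarith [hα.2, hb₀.1]⟩
    rw [transformDefect, e1]
    refine (norm_add_le _ _).trans (add_le_add ((norm_sub_le _ _).trans (add_le_add (hC₁ α j) ?_)) ?_)
    · rw [norm_mul]
      exact mul_le_mul_of_nonneg_left (hC₂ α hα j) (norm_nonneg _)
    · rw [norm_mul]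
      refine mul_le_mul_of_nonneg_left (norm_sum_le_of_le _ fun l hl => ?_) (norm_nonneg _)
      rw [e2]
      exact hC₃ l hl _ hα' _

end


/-! ### Dedekind sums and the reciprocity law. -/

lemma sawtooth_eq_fract (x : ℝ) : sawtooth x = if Int.fract x = 0 then 0 else Int.fract x - 1 / 2 := by
  unfold sawtooth Int.fract
  rfl

lemma sawtooth_add_int (x : ℝ) (n : ℤ) : sawtooth (x + n) = sawtooth x := by
  simp [sawtooth_eq_fract]

lemma sawtooth_neg (x : ℝ) : sawtooth (-x) = -sawtooth x := by
  rw [sawtooth_eq_fract, sawtooth_eq_fract]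
  by_cases h : Int.fract x = 0
  · simp [h]
  · rw [if_neg (by rwa [Int.fract_neg_eq_zero]), if_neg h, Int.fract_neg h]
    ring

lemma dedekindSum_add_mul (h t : ℤ) {k : ℕ} (hk : 0 < k) :
    dedekindSum (h + k * t) k = dedekindSum h k := by
  unfold dedekindSum
  refine Finset.sum_congr rfl fun μ _ => ?_
  have hk' : (k : ℝ) ≠ 0 := by exact_mod_cast hk.ne'
  rw [← sawtooth_add_int ((h : ℝ) * μ / k) (t * μ)]
  congr 2
  push_cast
  field_simp

lemma dedekindSum_neg (h : ℤ) (k : ℕ) : dedekindSum (-h) k = -dedekindSum h k := by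
  unfold dedekindSum
  rw [← Finset.sum_neg_distrib]
  refine Finset.sum_congr rfl fun μ _ => ?_
  push_cast
  rw [neg_mul, neg_div, sawtooth_neg, mul_neg]

lemma sawtooth_natCast_div {m k : ℕ} (hk : 0 < k) (h : m % k ≠ 0) :
    sawtooth ((m : ℝ) / k) = ((m % k : ℕ) : ℝ) / k - 1 / 2 := by
  rw [sawtooth_eq_fract, Int.fract_div_natCast_eq_div_natCast_mod, if_neg]
  exact div_ne_zero (by exact_mod_cast h) (by exact_mod_cast hk.ne')

lemma sum_mul_mod {h k : ℕ} (hk : 0 < k) (hc : Nat.Coprime h k) (f : ℕ → ℝ) :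
    ∑ μ ∈ Finset.range k, f (h * μ % k) = ∑ μ ∈ Finset.range k, f μ := by
  have hmaps : Set.MapsTo (fun μ => h * μ % k) (Finset.range k) (Finset.range k) := by
    intro μ _
    simpa using Nat.mod_lt _ hk
  have hinj : Set.InjOn (fun μ => h * μ % k) (Finset.range k) := by
    intro a ha b hb hab
    simp only [Finset.coe_range, Set.mem_Iio] at ha hb
    have h1 : a ≡ b [MOD k] := Nat.ModEq.cancel_left_of_coprime (by rwa [Nat.coprime_comm] at hc) hab
    rwa [Nat.ModEq, Nat.mod_eq_of_lt ha, Nat.mod_eq_of_lt hb] at h1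
  exact Finset.sum_nbij (fun μ => h * μ % k) hmaps hinj
    (Finset.surjOn_of_injOn_of_card_le _ hmaps hinj le_rfl) (fun _ _ => rfl)

lemma sum_range_cast (k : ℕ) : ∑ μ ∈ Finset.range k, (μ : ℝ) = k * (k - 1) / 2 := by
  induction k with
  | zero => simp
  | succ n ih => rw [Finset.sum_range_succ, ih]; push_cast; ring

lemma sum_range_sq_cast (k : ℕ) :
    ∑ μ ∈ Finset.range k, (μ : ℝ) ^ 2 = k * (k - 1) * (2 * k - 1) / 6 := by
  induction k with
  | zero => simp
  | succ n ih => rw [Finset.sum_range_succ, ih]; push_cast; ring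

lemma cast_mod_eq (m k : ℕ) : ((m % k : ℕ) : ℝ) = m - k * (m / k : ℕ) := by
  have := Nat.div_add_mod m k
  have h2 : (k : ℝ) * (m / k : ℕ) + (m % k : ℕ) = m := by exact_mod_cast this
  linarith

lemma dedekindSum_eq {h k : ℕ} (hk : 0 < k) (hc : Nat.Coprime h k) :
    dedekindSum h k = h * ((k - 1) * (2 * k - 1) / 6) / k -
      (∑ μ ∈ Finset.range k, (μ : ℝ) * (h * μ / k : ℕ)) / k - (k - 1) / 4 := by
  have hk' : (k : ℝ) ≠ 0 := by exact_mod_cast hk.ne'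
  -- At μ = 0 the sawtooth is 0 while the formula for nonintegers gives (-1/2)² = 1/4, hence the
  -- correction.
  have h1 : ∀ μ ∈ Finset.range k, sawtooth ((μ : ℝ) / k) * sawtooth (((h : ℤ) : ℝ) * μ / k) =
      ((μ : ℝ) / k - 1 / 2) * (((h * μ % k : ℕ) : ℝ) / k - 1 / 2) - if μ = 0 then 1 / 4 else 0 := by
    intro μ hμ
    have hlt := Finset.mem_range.1 hμ
    split_ifs with h0
    · subst h0
      norm_num [sawtooth_eq_fract]
    · have e1 : μ % k ≠ 0 := by rwa [Nat.mod_eq_of_lt hlt]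
      have e2 : (h * μ) % k ≠ 0 := by
        intro h3
        have h4 := (Nat.Coprime.dvd_of_dvd_mul_left (by rwa [Nat.coprime_comm] at hc)
          (Nat.dvd_of_mod_eq_zero h3))
        exact e1 (Nat.mod_eq_zero_of_dvd h4)
      have e3 := sawtooth_natCast_div hk e2
      push_cast at e3 ⊢
      rw [sawtooth_natCast_div hk e1, e3, Nat.mod_eq_of_lt hlt, sub_zero]
  rw [dedekindSum, Finset.sum_congr rfl h1, Finset.sum_sub_distrib, Finset.sum_ite_eq',
    if_pos (Finset.mem_range.2 hk)]
  have h2 : ∀ μ ∈ Finset.range k, ((μ : ℝ) / k - 1 / 2) * (((h * μ % k : ℕ) : ℝ) / k - 1 / 2) =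
      h / k ^ 2 * (μ : ℝ) ^ 2 - 1 / k * ((μ : ℝ) * (h * μ / k : ℕ)) - 1 / (2 * k) * μ
        - 1 / (2 * k) * ((h * μ % k : ℕ) : ℝ) + 1 / 4 := by
    intro μ _
    have := cast_mod_eq (h * μ) k
    have e : ((μ : ℝ) / k - 1 / 2) * (((h * μ % k : ℕ) : ℝ) / k - 1 / 2) =
      (μ : ℝ) / k ^ 2 * ((h * μ % k : ℕ) : ℝ) - 1 / (2 * k) * μ
        - 1 / (2 * k) * ((h * μ % k : ℕ) : ℝ) + 1 / 4 := by field_simp; ring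
    rw [e]
    nth_rewrite 1 [this]
    push_cast
    field_simp
  rw [Finset.sum_congr rfl h2, Finset.sum_add_distrib, Finset.sum_sub_distrib, Finset.sum_sub_distrib,
    Finset.sum_sub_distrib, ← Finset.mul_sum, ← Finset.mul_sum, ← Finset.mul_sum, ← Finset.mul_sum,
    sum_mul_mod hk hc (fun m => (m : ℝ)), sum_range_cast, sum_range_sq_cast, Finset.sum_const,
    Finset.card_range, nsmul_eq_mul]
  field_simp
  ring

lemma sum_div_eq {h k : ℕ} (hk : 0 < k) (hc : Nat.Coprime h k) :
    ∑ μ ∈ Finset.range k, ((h * μ / k : ℕ) : ℝ) = (h - 1) * (k - 1) / 2 := by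
  have hk' : (k : ℝ) ≠ 0 := by exact_mod_cast hk.ne'
  have h1 := sum_mul_mod hk hc (fun m => (m : ℝ))
  simp_rw [cast_mod_eq] at h1
  rw [Finset.sum_sub_distrib, ← Finset.mul_sum] at h1
  push_cast at h1
  rw [← Finset.mul_sum, sum_range_cast] at h1
  have h2 : (k : ℝ) * ∑ μ ∈ Finset.range k, ((h * μ / k : ℕ) : ℝ) = k * ((h - 1) * (k - 1) / 2) := by
    linear_combination -h1
  exact mul_left_cancel₀ hk' h2

lemma sum_odd_eq_sq {q h : ℕ} (hq : q < h) :
    ∑ ν ∈ Finset.range h, (if 1 ≤ ν ∧ ν ≤ q then (2 * (ν : ℝ) - 1) else 0) = (q : ℝ) ^ 2 := by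
  rw [← Finset.sum_filter]
  have : (Finset.range h).filter (fun ν => 1 ≤ ν ∧ ν ≤ q) = Finset.Icc 1 q := by
    ext ν; simp only [Finset.mem_filter, Finset.mem_range, Finset.mem_Icc]; omega
  rw [this]
  clear this hq
  induction q with
  | zero => simp
  | succ n ih => rw [Finset.sum_Icc_succ_top (by omega), ih]; push_cast; ring

/-- Each square is a sum of consecutive odd numbers; exchanging the summations counts, for each ν,
the μ with kν ≤ hμ. Coprimality rules out equality for ν ≥ 1, and the last k - 1 offsets the
spurious ν = 0 term. -/
lemma sum_div_sq_eq {h k : ℕ} (hh : 0 < h) (hk : 0 < k) (hc : Nat.Coprime h k) :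
    ∑ μ ∈ Finset.range k, ((h * μ / k : ℕ) : ℝ) ^ 2 =
      ∑ ν ∈ Finset.range h, (2 * (ν : ℝ) - 1) * ((k : ℝ) - 1 - (k * ν / h : ℕ)) + (k - 1) := by
  have h1 : ∀ μ ∈ Finset.range k, ((h * μ / k : ℕ) : ℝ) ^ 2 =
      ∑ ν ∈ Finset.range h, (if 1 ≤ ν ∧ k * ν ≤ h * μ then (2 * (ν : ℝ) - 1) else 0) := by
    intro μ hμ
    have hlt := Finset.mem_range.1 hμ
    have hq : h * μ / k < h := by
      rw [Nat.div_lt_iff_lt_mul hk]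
      exact Nat.mul_lt_mul_of_pos_left hlt hh
    rw [← sum_odd_eq_sq hq]
    refine Finset.sum_congr rfl fun ν _ => ?_
    simp only [Nat.le_div_iff_mul_le hk, mul_comm k ν]
  rw [Finset.sum_congr rfl h1, Finset.sum_comm]
  have h2 : ∀ ν ∈ Finset.range h, ∑ μ ∈ Finset.range k,
      (if 1 ≤ ν ∧ k * ν ≤ h * μ then (2 * (ν : ℝ) - 1) else 0) =
      (2 * (ν : ℝ) - 1) * ((k : ℝ) - 1 - (k * ν / h : ℕ)) + if ν = 0 then ((k : ℝ) - 1) else 0 := by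
    intro ν hν
    have hνh := Finset.mem_range.1 hν
    split_ifs with h0
    · subst h0
      simp
    · rw [add_zero, ← Finset.sum_filter, Finset.sum_const, nsmul_eq_mul, mul_comm]
      congr 1
      have hset : (Finset.range k).filter (fun μ => 1 ≤ ν ∧ k * ν ≤ h * μ) =
          Finset.Ico (k * ν / h + 1) k := by
        ext μ
        simp only [Finset.mem_filter, Finset.mem_range, Finset.mem_Ico, Nat.succ_le_iff]
        have hne : k * ν ≠ h * μ := by
          intro he
          have : h ∣ ν := Nat.Coprime.dvd_of_dvd_mul_left hc ⟨μ, he⟩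
          exact absurd (Nat.le_of_dvd (by omega) this) (by omega)
        rw [Nat.div_lt_iff_lt_mul hh, mul_comm μ h]
        constructor
        · rintro ⟨a, b, c⟩; exact ⟨lt_of_le_of_ne c hne, a⟩
        · rintro ⟨a, b⟩; exact ⟨b, by omega, a.le⟩
      rw [hset, Nat.card_Ico]
      have hlt : k * ν / h + 1 ≤ k := by
        rw [Nat.succ_le_iff, Nat.div_lt_iff_lt_mul hh]
        exact Nat.mul_lt_mul_of_pos_left hνh hk
      rw [Nat.cast_sub hlt]
      push_cast
      ring
  rw [Finset.sum_congr rfl h2, Finset.sum_add_distrib, Finset.sum_ite_eq', if_pos (Finset.mem_range.2 hh)]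

/-- Dedekind's reciprocity law. -/
lemma dedekindSum_reciprocity {h k : ℕ} (hh : 0 < h) (hk : 0 < k) (hc : Nat.Coprime h k) :
    dedekindSum h k + dedekindSum k h =
      -1 / 4 + 1 / 12 * ((h : ℝ) / k + (k : ℝ) / h + 1 / (h * k)) := by
  have hk' : (k : ℝ) ≠ 0 := by exact_mod_cast hk.ne'
  have hh' : (h : ℝ) ≠ 0 := by exact_mod_cast hh.ne'
  rw [dedekindSum_eq hk hc, dedekindSum_eq hh hc.symm]
  set A := ∑ μ ∈ Finset.range k, (μ : ℝ) * (h * μ / k : ℕ) with hA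
  set A' := ∑ μ ∈ Finset.range h, (μ : ℝ) * (k * μ / h : ℕ) with hA'
  have hQ := sum_div_sq_eq hh hk hc
  -- The residues hμ mod k permute 0, …, k - 1, so the sum of their squares is known. Expanding them
  -- as hμ - k⌊hμ/k⌋ gives a linear relation between A and A', the only unknowns in the reciprocity
  -- law.
  have hr := sum_mul_mod hk hc (fun m => (m : ℝ) ^ 2)
  have e1 : ∀ μ ∈ Finset.range k, ((h * μ % k : ℕ) : ℝ) ^ 2 =
      h ^ 2 * (μ : ℝ) ^ 2 - 2 * h * k * ((μ : ℝ) * (h * μ / k : ℕ)) +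
        k ^ 2 * ((h * μ / k : ℕ) : ℝ) ^ 2 := by
    intro μ _
    rw [cast_mod_eq]
    push_cast
    ring
  rw [Finset.sum_congr rfl e1, Finset.sum_add_distrib, Finset.sum_sub_distrib, ← Finset.mul_sum,
    ← Finset.mul_sum, ← Finset.mul_sum, hQ, sum_range_sq_cast] at hr
  have e2 : ∀ ν ∈ Finset.range h, (2 * (ν : ℝ) - 1) * ((k : ℝ) - 1 - (k * ν / h : ℕ)) =
      2 * (k - 1) * ν - (k - 1) - 2 * ((ν : ℝ) * (k * ν / h : ℕ)) + ((k * ν / h : ℕ) : ℝ) := by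
    intro ν _; ring
  rw [Finset.sum_congr rfl e2, Finset.sum_add_distrib, Finset.sum_sub_distrib, Finset.sum_sub_distrib,
    ← Finset.mul_sum, ← Finset.mul_sum, sum_range_cast, sum_div_eq hh hc.symm, Finset.sum_const,
    Finset.card_range, nsmul_eq_mul] at hr
  have hk2 : (h : ℝ) * A + k * A' = ((h ^ 2 - 1) * ((k - 1) * (2 * k - 1) / 6) +
      k * (2 * (k - 1) * (h * (h - 1) / 2) - h * (k - 1) + (k - 1) * (h - 1) / 2 + (k - 1))) / 2 := by
    have : (2 * k : ℝ) * ((h : ℝ) * A + k * A') = (2 * k : ℝ) * (((h ^ 2 - 1) * ((k - 1) * (2 * k - 1) / 6) +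
      k * (2 * (k - 1) * (h * (h - 1) / 2) - h * (k - 1) + (k - 1) * (h - 1) / 2 + (k - 1))) / 2) := by
      linear_combination -hr
    exact mul_left_cancel₀ (by positivity) this
  field_simp
  linear_combination (-288 : ℝ) * hk2


/-! ### Dedekind's transformation of the Euler product. -/

lemma qProd_exp_eq (τ : ℂ) :
    qProd (Complex.exp (2 * Real.pi * I * τ)) = ∏' n, (1 - ModularForm.eta_q n τ) := by
  unfold qProd
  simp_rw [ModularForm.eta_q_eq_pow]

lemma eta_eq_mul_qProd (τ : ℂ) :
    ModularForm.eta τ = Complex.exp (Real.pi * I * τ / 12) * qProd (Complex.exp (2 * Real.pi * I * τ)) := by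
  rw [ModularForm.eta, qProd_exp_eq, Function.Periodic.qParam]
  congr 2
  push_cast
  ring

lemma qProd_ne_zero {τ : ℂ} (hτ : 0 < τ.im) : qProd (Complex.exp (2 * Real.pi * I * τ)) ≠ 0 := by
  rw [qProd_exp_eq]
  exact ModularForm.eta_tprod_ne_zero hτ

lemma qProd_exp_add_int (τ : ℂ) (n : ℤ) :
    qProd (Complex.exp (2 * Real.pi * I * (τ + n))) = qProd (Complex.exp (2 * Real.pi * I * τ)) := by
  congr 1
  rw [Complex.exp_eq_exp_iff_exists_int]
  exact ⟨n, by ring⟩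

lemma I_cpow_half : I ^ (1 / 2 : ℂ) = Complex.exp (Real.pi * I / 4) := by
  rw [Complex.cpow_def_of_ne_zero I_ne_zero, Complex.log_I]
  congr 1; ring

lemma qProd_neg_inv {τ : ℂ} (hτ : 0 < τ.im) :
    qProd (Complex.exp (2 * Real.pi * I * (-1 / τ))) =
      Complex.exp (Real.pi * I / 12 * (τ + 1 / τ) - Real.pi * I / 4) * τ ^ (1 / 2 : ℂ) *
        qProd (Complex.exp (2 * Real.pi * I * τ)) := by
  have h := ModularForm.eta_comp_eq_csqrt_I_inv hτ
  simp only [Function.comp, Pi.smul_apply, Pi.mul_apply, smul_eq_mul] at h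
  rw [eta_eq_mul_qProd, eta_eq_mul_qProd, sqrt, sqrt,
    show (2⁻¹ : ℂ) = 1 / 2 by norm_num, I_cpow_half, ← Complex.exp_neg] at h
  have e : Complex.exp (Real.pi * I / 12 * (τ + 1 / τ) - Real.pi * I / 4) =
      Complex.exp (-(Real.pi * I * (-1 / τ) / 12)) * (Complex.exp (-(Real.pi * I / 4)) *
        Complex.exp (Real.pi * I * τ / 12)) := by
    rw [← Complex.exp_add, ← Complex.exp_add]; congr 1; ring
  have h2 : qProd (Complex.exp (2 * Real.pi * I * (-1 / τ))) =
      Complex.exp (-(Real.pi * I * (-1 / τ) / 12)) * (Complex.exp (Real.pi * I * (-1 / τ) / 12) *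
        qProd (Complex.exp (2 * Real.pi * I * (-1 / τ)))) := by
    rw [← mul_assoc, ← Complex.exp_add, neg_add_cancel, Complex.exp_zero, one_mul]
  rw [h2, h, e]
  ring

lemma abs_arg_lt_of_re_pos {z : ℂ} (hz : 0 < z.re) : |z.arg| < Real.pi / 2 :=
  Complex.abs_arg_lt_pi_div_two_iff.2 (Or.inl hz)

lemma mul_cpow_half {x y : ℂ} (hx : x ≠ 0) (hy : y ≠ 0)
    (h : x.arg + y.arg ∈ Set.Ioc (-Real.pi) Real.pi) :
    (x * y) ^ (1 / 2 : ℂ) = x ^ (1 / 2 : ℂ) * y ^ (1 / 2 : ℂ) := by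
  rw [Complex.cpow_def_of_ne_zero (mul_ne_zero hx hy), Complex.cpow_def_of_ne_zero hx,
    Complex.cpow_def_of_ne_zero hy, Complex.log_mul hx hy h, ← Complex.exp_add, add_mul]

lemma I_mul_cpow_half {z : ℂ} (hz : 0 < z.re) :
    (I * z) ^ (1 / 2 : ℂ) = Complex.exp (Real.pi * I / 4) * z ^ (1 / 2 : ℂ) := by
  have hz0 : z ≠ 0 := fun h0 => by simp [h0] at hz
  have := abs_lt.1 (abs_arg_lt_of_re_pos hz)
  rw [mul_cpow_half I_ne_zero hz0, I_cpow_half]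
  rw [Complex.arg_I]
  constructor <;> linarith [this.1, this.2, Real.pi_pos]

/-- The arguments of z and z/τ lie in (-π/2, π/2) and that of τ in [0, π], so arg z cannot differ
from arg(z/τ) + arg τ by a nonzero multiple of 2π. -/
lemma div_cpow_half_mul {z τ : ℂ} (hz : 0 < z.re) (hτ : 0 < τ.im) (hd : 0 < (z / τ).re) :
    (z / τ) ^ (1 / 2 : ℂ) * τ ^ (1 / 2 : ℂ) = z ^ (1 / 2 : ℂ) := by
  have hz0 : z ≠ 0 := fun h0 => by simp [h0] at hz
  have hτ0 : τ ≠ 0 := fun h0 => by simp [h0] at hτ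
  have hd0 : z / τ ≠ 0 := div_ne_zero hz0 hτ0
  have h1 := abs_lt.1 (abs_arg_lt_of_re_pos hz)
  have h2 := abs_lt.1 (abs_arg_lt_of_re_pos hd)
  have h3 : 0 ≤ τ.arg := Complex.arg_nonneg_iff.2 hτ.le
  have h4 := Complex.arg_le_pi τ
  have hang : ((z.arg : ℝ) : Real.Angle) = ((z / τ).arg + τ.arg : ℝ) := by
    rw [Real.Angle.coe_add, ← Complex.arg_mul_coe_angle hd0 hτ0, div_mul_cancel₀ _ hτ0]
  obtain ⟨n, hn⟩ := Real.Angle.angle_eq_iff_two_pi_dvd_sub.1 hang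
  have hpi := Real.pi_pos
  have hn0 : n = 0 := by
    have a1 : (-1 : ℝ) < n := by
      by_contra hc
      nlinarith [not_lt.1 hc]
    have a2 : (n : ℝ) < 1 := by
      by_contra hc
      nlinarith [not_lt.1 hc]
    have b1 : (-1 : ℤ) < n := by exact_mod_cast a1
    have b2 : n < (1 : ℤ) := by exact_mod_cast a2
    omega
  rw [hn0] at hn
  have hsum : (z / τ).arg + τ.arg = z.arg := by
    push_cast at hn; linarith
  rw [← mul_cpow_half hd0 hτ0, div_mul_cancel₀ _ hτ0]
  rw [hsum]
  exact ⟨Complex.neg_pi_lt_arg z, Complex.arg_le_pi z⟩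

lemma omega_one (h : ℤ) : omega h 1 = 1 := by
  simp [omega, dedekindSum, sawtooth_eq_fract]

/-- Dedekind's transformation formula for `(q; q)_∞`. -/
theorem qProd_modPt {k : ℕ} (hk : 0 < k) {h h' B : ℤ} (hB : h * h' + 1 = k * B) {z : ℂ}
    (hz : 0 < z.re) :
    qProd (Complex.exp (2 * Real.pi * I * modPt k h' z⁻¹)) =
      omega h k * z ^ (1 / 2 : ℂ) * Complex.exp (Real.pi / (12 * k) * (z⁻¹ - z)) *
        qProd (Complex.exp (2 * Real.pi * I * modPt k h z)) := by
  -- Euclidean descent: reduce h modulo k to H, apply τ ↦ -1/τ, and use the formula with the smaller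
  -- denominator H.
  induction k using Nat.strong_induction_on generalizing h h' B z with
  | _ k ih =>
  have hz0 : z ≠ 0 := fun h0 => by simp [h0] at hz
  have hk0 : (k : ℂ) ≠ 0 := by exact_mod_cast hk.ne'
  by_cases hk1 : k = 1
  · subst hk1
    have e1 : modPt 1 h' z⁻¹ = -1 / (I * z) + h' := by
      rw [modPt]
      field_simp
      push_cast
      linear_combination I_sq
    have e2 : modPt 1 h z = I * z + h := by rw [modPt]; push_cast; ring
    rw [e1, e2, qProd_exp_add_int, qProd_exp_add_int, qProd_neg_inv (by simpa using hz),
      I_mul_cpow_half hz, omega_one, one_mul, mul_comm (z ^ (1 / 2 : ℂ)), ← mul_assoc,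
      ← Complex.exp_add]
    congr 3
    push_cast
    field_simp
    linear_combination (4 * z ^ 2) * I_sq
  · obtain ⟨H, hH⟩ : ∃ H : ℕ, (H : ℤ) = h % k :=
      ⟨(h % k).toNat, Int.toNat_of_nonneg (Int.emod_nonneg _ (by omega))⟩
    have hHlt : H < k := by
      have := Int.emod_lt_of_pos h (by exact_mod_cast hk : (0 : ℤ) < k)
      omega
    have hdecomp : h = H + k * (h / k) := by rw [hH]; exact (Int.emod_add_mul_ediv h k).symm
    set t := h / (k : ℤ)
    set B₁ : ℤ := B - t * h' with hB₁
    have hB' : (H : ℤ) * h' + 1 = k * B₁ := by rw [hB₁]; linear_combination hB - h' * hdecomp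
    have hHpos : 0 < H := by
      rcases Nat.eq_zero_or_pos H with h0 | h0
      · exfalso
        rw [h0, Nat.cast_zero, zero_mul, zero_add] at hB'
        have : (k : ℤ) ∣ 1 := ⟨B₁, hB'⟩
        have := Int.le_of_dvd one_pos this
        omega
      · exact h0
    have hcop : Nat.Coprime H k := by
      rw [← Nat.isCoprime_iff_coprime]
      exact ⟨-h', B₁, by linear_combination -hB'⟩
    have hH0 : (H : ℂ) ≠ 0 := by exact_mod_cast hHpos.ne'
    set τ := modPt k H z with hτ
    have hτim : 0 < τ.im := modPt_im_pos hk H hz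
    have hτ0 : τ ≠ 0 := fun h0 => by rw [h0] at hτim; simp at hτim
    have hτk : (k : ℂ) * τ = H + I * z := natCast_mul_modPt hk H z
    have hI : I * z = k * τ - H := by linear_combination -hτk
    have e1 : modPt k h z = τ + t := by
      rw [hτ, modPt, modPt]
      have : (h : ℂ) = H + k * t := by exact_mod_cast hdecomp
      rw [this]
      push_cast
      field_simp
      ring
    -- This is the parameter at level H: it makes (-k + iζ)/H equal to -1/τ and leaves the dual
    -- point unchanged.
    set ζ := z / τ with hζ
    have hζinv : ζ⁻¹ = H / (k * z) + I / k := by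
      rw [hζ, inv_div, hτ, modPt]
      field_simp
      push_cast
      ring
    have hζre : 0 < ζ.re := by
      have h1 : 0 < (ζ⁻¹).re := by
        have : (H : ℂ) / (k * z) + I / k = ((H / k : ℝ) : ℂ) * z⁻¹ + ((1 / k : ℝ) : ℂ) * I := by
          push_cast; field_simp
        rw [hζinv, this, add_re, re_ofReal_mul, re_ofReal_mul, I_re, mul_zero, add_zero]
        exact mul_pos (by positivity) (inv_re_pos hz)
      have := inv_re_pos h1
      rwa [inv_inv] at this
    have hIH := ih H hHlt hHpos (h := -k) (h' := B₁) (B := -h') (by linear_combination hB') hζre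
    have e2 : modPt H B₁ ζ⁻¹ = modPt k h' z⁻¹ := by
      rw [hζinv, modPt, modPt]
      have hB'' : (H : ℂ) * h' + 1 = k * B₁ := by exact_mod_cast hB'
      have : (B₁ : ℂ) = (H * h' + 1) / k := by rw [hB'']; field_simp
      rw [this]
      field_simp
      ring_nf
      simp only [I_sq]
      ring
    have e3 : modPt H (-k) ζ = -1 / τ := by
      rw [modPt, hζ]
      field_simp
      push_cast
      linear_combination hI
    rw [e2, e3, qProd_neg_inv hτim] at hIH
    rw [hIH, e1, qProd_exp_add_int]
    -- Reciprocity compares the multipliers; the exponential left over is absorbed by the factor of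
    -- η(-1/τ) in `hexp`.
    have hω : omega (-k) H = omega h k * Complex.exp (Real.pi * I / 4 -
        Real.pi * I / 12 * (H / k + k / H + 1 / (H * k))) := by
      rw [omega, omega, ← Complex.exp_add]
      congr 1
      have hr := dedekindSum_reciprocity hHpos hk hcop
      rw [dedekindSum_neg, hdecomp, dedekindSum_add_mul _ _ hk]
      have hr' : (dedekindSum H k : ℂ) + dedekindSum k H =
          -1 / 4 + 1 / 12 * ((H : ℂ) / k + (k : ℂ) / H + 1 / (H * k)) := by
        have := congrArg (fun x : ℝ => (x : ℂ)) hr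
        push_cast at this
        exact this
      push_cast
      linear_combination (-(Real.pi : ℂ) * I) * hr'
    rw [hω]
    have hsq := div_cpow_half_mul hz hτim hζre
    rw [← hsq]
    have hexp : Complex.exp (Real.pi * I / 4 - Real.pi * I / 12 * (H / k + k / H + 1 / (H * k))) *
        Complex.exp (Real.pi / (12 * H) * (ζ⁻¹ - ζ)) *
        Complex.exp (Real.pi * I / 12 * (τ + 1 / τ) - Real.pi * I / 4) =
        Complex.exp (Real.pi / (12 * k) * (z⁻¹ - z)) := by
      rw [← Complex.exp_add, ← Complex.exp_add]
      congr 1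
      have hz' : z = -I * (k * τ - H) := by linear_combination (-I) * hI + z * I_sq
      have hζ2 : ζ = -I * (k - H / τ) := by
        rw [hζ, hz']; field_simp
      have hτ2 : τ = (H + I * z) / k := by rw [hτ, modPt]; push_cast; rfl
      have hinv : Real.pi / (12 * H) * (-ζ) + Real.pi * I / 12 * (1 / τ) = Real.pi * I * k / (12 * H) := by
        rw [hζ2]; field_simp; ring
      have hinv2 : Real.pi / (12 * H) * ζ⁻¹ = Real.pi / (12 * k * z) + Real.pi * I / (12 * H * k) := by
        rw [hζinv]; field_simp
      have hτ3 : Real.pi * I / 12 * τ = Real.pi * I * H / (12 * k) - Real.pi * z / (12 * k) := by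
        rw [hτ2]; field_simp; linear_combination z * I_sq
      have : Real.pi / (12 * k) * (z⁻¹ - z) = Real.pi / (12 * k * z) - Real.pi * z / (12 * k) := by
        field_simp
      rw [this]
      linear_combination hinv + hinv2 + hτ3
    rw [← hexp]
    ring


/-! ### The pentagonal number theorem and the theta coefficients. -/

lemma exists_norm_prod_one_sub_pow_le {x : ℂ} (hx : ‖x‖ < 1) :
    ∃ C : ℝ, 0 ≤ C ∧ ∀ k n : ℕ, ‖∏ i ∈ Finset.range n, (1 - x ^ (k + i + 1))‖ ≤ C := by
  have hs := summable_geometric_of_lt_one (norm_nonneg x) hx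
  refine ⟨Real.exp (∑' i, ‖x‖ ^ i), (Real.exp_pos _).le, fun k n => ?_⟩
  rw [norm_prod]
  calc ∏ i ∈ Finset.range n, ‖1 - x ^ (k + i + 1)‖
      ≤ ∏ i ∈ Finset.range n, Real.exp (‖x‖ ^ i) := by
        refine Finset.prod_le_prod (fun _ _ => norm_nonneg _) fun i _ => ?_
        have h1 : ‖1 - x ^ (k + i + 1)‖ ≤ 1 + ‖x‖ ^ i := by
          refine (norm_sub_le _ _).trans ?_
          rw [norm_one, norm_pow]
          have := pow_le_pow_of_le_one (norm_nonneg x) hx.le (by omega : i ≤ k + i + 1)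
          linarith
        have := Real.add_one_le_exp (‖x‖ ^ i)
        linarith
    _ = Real.exp (∑ i ∈ Finset.range n, ‖x‖ ^ i) := (Real.exp_sum _ _).symm
    _ ≤ _ := Real.exp_le_exp.2 (hs.sum_le_tsum _ fun _ _ => by positivity)

lemma multipliable_one_sub_pow_add {x : ℂ} (hx : ‖x‖ < 1) (k : ℕ) :
    Multipliable fun n : ℕ => 1 - x ^ (n + k + 1) := by
  have hs : Summable fun n : ℕ => ‖-x ^ (n + k + 1)‖ := by
    have := (summable_nat_add_iff (k + 1)).2 (summable_geometric_of_lt_one (norm_nonneg x) hx)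
    refine this.congr fun n => ?_
    rw [norm_neg, norm_pow, add_assoc]
  have := multipliable_one_add_of_summable hs
  simpa [sub_eq_add_neg] using this

/-- **Euler's pentagonal number theorem** over the complex numbers. -/
lemma tprod_one_sub_pow_eq_tsum_pentagonal {x : ℂ} (hx : ‖x‖ < 1) :
    ∏' n : ℕ, (1 - x ^ (n + 1)) =
      ∑' k : ℕ, (-1) ^ k * (x ^ pentagonal (-k) - x ^ pentagonal (k + 1)) := by
  obtain ⟨C, hC0, hC⟩ := exists_norm_prod_one_sub_pow_le hx
  have hgeo := summable_geometric_of_lt_one (norm_nonneg x) hx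
  have hbound : ∀ k n : ℕ, ‖x ^ ((k + 1) * n) * ∏ i ∈ Finset.range (n + 1), (1 - x ^ (k + i + 1))‖ ≤
      ‖x‖ ^ n * C := by
    intro k n
    rw [norm_mul, norm_pow]
    refine mul_le_mul ?_ (hC _ _) (norm_nonneg _) (by positivity)
    exact pow_le_pow_of_le_one (norm_nonneg x) hx.le (Nat.le_mul_of_pos_left n (by omega))
  refine Pentagonal.tprod_one_sub_pow (tendsto_pow_atTop_nhds_zero_of_norm_lt_one hx)
    (fun k => Summable.of_norm_bounded (hgeo.mul_right C) (hbound k))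
    (multipliable_one_sub_pow_add hx) ?_ ?_
  · refine Summable.of_norm_bounded (hgeo.mul_left 2) fun k => ?_
    rw [norm_mul, norm_pow, norm_neg, norm_one, one_pow, one_mul]
    refine (norm_sub_le _ _).trans ?_
    rw [norm_pow, norm_pow, two_mul]
    refine add_le_add ?_ ?_
    · refine pow_le_pow_of_le_one (norm_nonneg x) hx.le ?_
      have := two_mul_natCast_pentagonal_neg k
      zify
      nlinarith
    · refine pow_le_pow_of_le_one (norm_nonneg x) hx.le ?_
      have := two_mul_natCast_pentagonal (k + 1)
      zify
      nlinarith
  · have hlim : Tendsto (fun k : ℕ => ‖x‖ ^ k * ∑' n : ℕ, ‖x‖ ^ n * C) atTop (𝓝 0) := by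
      have := (tendsto_pow_atTop_nhds_zero_of_lt_one (norm_nonneg x) hx).mul_const
        (∑' n : ℕ, ‖x‖ ^ n * C)
      simpa using this
    refine squeeze_zero_norm (fun k => ?_) hlim
    rw [norm_mul, norm_mul, norm_pow, norm_neg, norm_one, one_pow, one_mul, norm_pow]
    refine mul_le_mul ?_ (tsum_of_norm_bounded (hgeo.mul_right C).hasSum (hbound k)) (norm_nonneg _)
      (by positivity)
    refine pow_le_pow_of_le_one (norm_nonneg x) hx.le ?_
    rw [Nat.le_div_iff_mul_le two_pos]
    nlinarith

lemma norm_exp_two_pi_mul_lt_one {τ : ℂ} (hτ : 0 < τ.im) : ‖Complex.exp (2 * Real.pi * I * τ)‖ < 1 := by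
  rw [Complex.norm_exp, Real.exp_lt_one_iff]
  have : (2 * Real.pi * I * τ).re = -(2 * Real.pi * τ.im) := by simp
  rw [this]
  have := Real.pi_pos
  have : 0 < 2 * Real.pi * τ.im := by positivity
  linarith

/-- Pairing m = k with m = -(k + 1) turns the bilateral theta series into Euler's one-sided
pentagonal series. -/
lemma qProd_eq_oddTheta {τ : ℂ} (hτ : 0 < τ.im) :
    qProd (Complex.exp (2 * Real.pi * I * τ)) = oddTheta τ 1 := by
  rw [qProd, tprod_one_sub_pow_eq_tsum_pentagonal (norm_exp_two_pi_mul_lt_one hτ), oddTheta]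
  have hs := ((summable_norm_exp_quadratic hτ (1 : ℤ)).of_norm).hasSum.nat_add_neg_add_one
  rw [← hs.tsum_eq]
  refine tsum_congr fun k => ?_
  have h1 : Complex.exp (2 * Real.pi * I * τ) ^ pentagonal (-k) =
      Complex.exp (Real.pi * I * τ * (3 * ((k : ℤ) : ℂ) ^ 2 + (1 : ℤ) * ((k : ℤ) : ℂ))) := by
    rw [← Complex.exp_nat_mul]
    congr 1
    have h := congrArg (fun n : ℤ => (n : ℂ)) (two_mul_natCast_pentagonal_neg k)
    push_cast at h ⊢
    linear_combination (Real.pi * I * τ) * h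
  have h2 : Complex.exp (2 * Real.pi * I * τ) ^ pentagonal (k + 1) =
      Complex.exp (Real.pi * I * τ * (3 * ((-((k : ℤ) + 1) : ℤ) : ℂ) ^ 2 +
        (1 : ℤ) * ((-((k : ℤ) + 1) : ℤ) : ℂ))) := by
    rw [← Complex.exp_nat_mul]
    congr 1
    have h := congrArg (fun n : ℤ => (n : ℂ)) (two_mul_natCast_pentagonal (k + 1))
    push_cast at h ⊢
    linear_combination (Real.pi * I * τ) * h
  rw [h1, h2, neg_one_zpow_neg, zpow_add₀ (by norm_num : (-1 : ℂ) ≠ 0), zpow_one, zpow_natCast]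
  ring

lemma oddThetaHat_neg (k : ℕ) (z τ : ℂ) (j : ℤ) : oddThetaHat k z τ (-j) = oddThetaHat k z τ j := by
  rw [oddThetaHat, oddThetaHat, oddTheta_neg]
  push_cast
  rw [neg_sq]

/-- Quasi-periodicity reduces j = 6ν - 1 to j = -1, which gives the Euler product. The Gaussian
weight cancels the part of the exponent coming from i/z, except for a ν-independent factor, and
leaves a root of unity. -/
lemma oddThetaHat_six_mul_sub_one {k : ℕ} (hk : 0 < k) (h' : ℤ) {z : ℂ} (hz : 0 < z.re) (ν : ℤ) :
    oddThetaHat k z (modPt k h' z⁻¹) (6 * ν - 1) =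
      (-1) ^ ν * Complex.exp (Real.pi * I * h' / k * (-3 * (ν : ℂ) ^ 2 + ν)) *
        Complex.exp (-(Real.pi / (12 * k * z))) *
        qProd (Complex.exp (2 * Real.pi * I * modPt k h' z⁻¹)) := by
  have hz0 : z ≠ 0 := fun h0 => by simp [h0] at hz
  have hk0 : (k : ℂ) ≠ 0 := by exact_mod_cast hk.ne'
  have e : Complex.exp (-(Real.pi * ((6 * ν - 1 : ℤ) : ℂ) ^ 2 / (12 * k * z))) *
      Complex.exp (-(Real.pi * I * modPt k h' z⁻¹ * (3 * ν ^ 2 + ((-1 : ℤ) : ℂ) * ν))) =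
      Complex.exp (Real.pi * I * h' / k * (-3 * (ν : ℂ) ^ 2 + ν)) *
        Complex.exp (-(Real.pi / (12 * k * z))) := by
    rw [← Complex.exp_add, ← Complex.exp_add]
    congr 1
    rw [modPt]
    push_cast
    field_simp
    ring_nf
    simp only [I_sq]
    ring
  rw [oddThetaHat, show (6 * ν - 1 : ℤ) = -1 + 6 * ν by ring, oddTheta_add, oddTheta_neg,
    ← qProd_eq_oddTheta (modPt_im_pos hk h' (inv_re_pos hz)), show (-1 + 6 * ν : ℤ) = 6 * ν - 1 by ring]
  linear_combination ((-1 : ℂ) ^ ν * qProd (Complex.exp (2 * Real.pi * I * modPt k h' z⁻¹))) * e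

/-- This sign matches that of the Mordell integral when its pole moves by 1, so coefficient times
integral has period 6k in j. -/
lemma oddThetaHat_add_period {k : ℕ} (hk : 0 < k) {h' : ℤ} {z : ℂ} (hz : 0 < z.re)
    (hpar : Even ((1 + (k : ℤ)) * (1 + h'))) {j : ℤ} (hj : Odd j) :
    oddThetaHat k z (modPt k h' z⁻¹) (j + 6 * k) = -oddThetaHat k z (modPt k h' z⁻¹) j := by
  have hz0 : z ≠ 0 := fun h0 => by simp [h0] at hz
  have hk0 : (k : ℂ) ≠ 0 := by exact_mod_cast hk.ne'
  have hodd : Odd (k + -(h' * (3 * k + j))) := by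
    obtain ⟨i, rfl⟩ := hj
    have : (k : ℤ) + -(h' * (3 * k + (2 * i + 1))) =
        (1 + (k : ℤ)) * (1 + h') - 1 - 2 * (2 * h' * k + h' * i + h') := by ring
    rw [this]
    exact (hpar.sub_odd odd_one).sub_even (even_two_mul _)
  have e : Complex.exp (-(Real.pi * ((j + 6 * k : ℤ) : ℂ) ^ 2 / (12 * k * z))) * ((-1) ^ (k : ℤ) *
      Complex.exp (-(Real.pi * I * modPt k h' z⁻¹ * (3 * ((k : ℤ) : ℂ) ^ 2 + (j : ℂ) * ((k : ℤ) : ℂ))))) =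
      -Complex.exp (-(Real.pi * (j : ℂ) ^ 2 / (12 * k * z))) := by
    have hm : (-1 : ℂ) = Complex.exp (Real.pi * I * ((k + -(h' * (3 * k + j)) : ℤ) : ℂ)) := by
      rw [← neg_one_zpow_eq_exp, hodd.neg_one_zpow]
    rw [neg_one_zpow_eq_exp, ← neg_one_mul (Complex.exp (-(Real.pi * (j : ℂ) ^ 2 / (12 * k * z)))), hm,
      ← Complex.exp_add, ← Complex.exp_add, ← Complex.exp_add]
    congr 1
    rw [modPt]
    push_cast
    field_simp
    ring_nf
    simp only [I_sq]
    ring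
  rw [oddThetaHat, oddTheta_add, ← mul_assoc, e, oddThetaHat, neg_mul]


/-! ### R₂ and T₂ as bilateral sine series. -/

lemma exp_div_one_sub_exp (x : ℂ) :
    Complex.exp (Real.pi * I * x) / (1 - Complex.exp (2 * Real.pi * I * x)) =
      I / 2 / Complex.sin (Real.pi * x) := by
  have h : 1 - Complex.exp (2 * Real.pi * I * x) =
      -(2 * I) * Complex.exp (Real.pi * I * x) * Complex.sin (Real.pi * x) := by
    have h1 : Complex.exp (2 * Real.pi * I * x) = Complex.exp (Real.pi * I * x) ^ 2 := by
      rw [← Complex.exp_nat_mul]; congr 1; push_cast; ring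
    have h2 : Complex.exp (-(Real.pi * x) * I) = (Complex.exp (Real.pi * I * x))⁻¹ := by
      rw [← Complex.exp_neg]; congr 1; ring
    have h3 : Complex.exp (Real.pi * x * I) = Complex.exp (Real.pi * I * x) := by congr 1; ring
    rw [h1, Complex.sin, h2, h3]
    have := Complex.exp_ne_zero (Real.pi * I * x)
    field_simp
    simp only [I_sq]
    ring
  have h4 : (-(2 * I))⁻¹ = I / 2 := by
    rw [← one_div, div_eq_iff (by simp)]
    linear_combination I_sq
  rw [h, mul_comm (-(2 * I)), mul_assoc (Complex.exp _), div_mul_cancel_left₀ (Complex.exp_ne_zero _), mul_inv, h4, ← div_eq_mul_inv]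

/-- `ζ_{2c}^a e^{πiw} = e^{πi(w + a/c)}`. -/
lemma zeta_pow_mul_exp (a c : ℕ) (w : ℂ) :
    zeta (2 * c) ^ a * Complex.exp (Real.pi * I * w) = Complex.exp (Real.pi * I * (w + (a : ℂ) / c)) := by
  rw [zeta, ← Complex.exp_nat_mul, ← Complex.exp_add]
  congr 1
  by_cases hc : (c : ℂ) = 0
  · simp [hc]
  · push_cast; field_simp; ring

lemma R2Den_eq (a c : ℕ) (τ w : ℂ) (n : ℤ) :
    R2Den a c (Complex.exp (2 * Real.pi * I * τ)) w n =
      1 - Complex.exp (2 * Real.pi * I * (w + (a : ℂ) / c + n * τ)) := by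
  rw [R2Den, zeta, ← Complex.exp_nat_mul, ← Complex.exp_int_mul, ← Complex.exp_add, ← Complex.exp_add]
  congr 2
  ring

lemma two_mul_int_pentagonal (n : ℤ) : 2 * (n * (3 * n + 1) / 2) = n * (3 * n + 1) := by
  apply Int.mul_ediv_cancel'
  rcases Int.even_or_odd n with ⟨i, rfl⟩ | ⟨i, rfl⟩
  · exact ⟨i * (3 * (i + i) + 1), by ring⟩
  · exact ⟨(2 * i + 1) * (3 * i + 2), by ring⟩

lemma exp_mul_R2Term (a c : ℕ) (τ w : ℂ) (n : ℤ) :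
    zeta (2 * c) ^ a * Complex.exp (Real.pi * I * w) *
        R2Term a c (Complex.exp (2 * Real.pi * I * τ)) w n =
      -(I / 2) * (gaussCoeff 0 τ n / Complex.sin (Real.pi * (w + (a : ℂ) / c + n * τ))) := by
  have e : Complex.exp (Real.pi * I * (w + (a : ℂ) / c)) *
      Complex.exp (2 * Real.pi * I * τ) ^ (n * (3 * n + 1) / 2) =
      Complex.exp (Real.pi * I * τ * (3 * n ^ 2 + 2 * (0 : ℤ) * n)) *
        Complex.exp (Real.pi * I * (w + (a : ℂ) / c + n * τ)) := by
    rw [← Complex.exp_int_mul, ← Complex.exp_add, ← Complex.exp_add]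
    congr 1
    have h := congrArg (fun n : ℤ => (n : ℂ)) (two_mul_int_pentagonal n)
    push_cast at h ⊢
    linear_combination (Real.pi * I * τ) * h
  have h := exp_div_one_sub_exp (w + (a : ℂ) / c + n * τ)
  rw [zeta_pow_mul_exp, R2Term, R2Den_eq, gaussCoeff, zpow_add₀ (by norm_num : (-1 : ℂ) ≠ 0), zpow_one]
  calc _ = -(-1) ^ n * ((Complex.exp (Real.pi * I * (w + (a : ℂ) / c)) *
        Complex.exp (2 * Real.pi * I * τ) ^ (n * (3 * n + 1) / 2)) /
        (1 - Complex.exp (2 * Real.pi * I * (w + (a : ℂ) / c + n * τ)))) := by ring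
    _ = -(-1) ^ n * (Complex.exp (Real.pi * I * τ * (3 * n ^ 2 + 2 * (0 : ℤ) * n)) *
        (Complex.exp (Real.pi * I * (w + (a : ℂ) / c + n * τ)) /
        (1 - Complex.exp (2 * Real.pi * I * (w + (a : ℂ) / c + n * τ))))) := by rw [e]; ring
    _ = _ := by rw [h]; ring

lemma summable_R2Term (a c : ℕ) {τ : ℂ} (hτ : 0 < τ.im) (w : ℂ) :
    Summable (R2Term a c (Complex.exp (2 * Real.pi * I * τ)) w) := by
  have h0 : zeta (2 * c) ^ a * Complex.exp (Real.pi * I * w) ≠ 0 := by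
    rw [zeta_pow_mul_exp]; exact Complex.exp_ne_zero _
  rw [← summable_mul_left_iff h0]
  simp only [exp_mul_R2Term]
  exact (summable_appell (summable_norm_gaussCoeff hτ 0) hτ _).mul_left _

lemma R2_eq_appell (a c : ℕ) (τ w : ℂ) :
    R2 a c (Complex.exp (2 * Real.pi * I * τ)) w =
      -(I / 2) * appell (gaussCoeff 0 τ) τ (w + (a : ℂ) / c) /
        qProd (Complex.exp (2 * Real.pi * I * τ)) := by
  have key : -(I / 2) * appell (gaussCoeff 0 τ) τ (w + (a : ℂ) / c) =
      zeta (2 * c) ^ a * Complex.exp (Real.pi * I * w) *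
        ∑' n, R2Term a c (Complex.exp (2 * Real.pi * I * τ)) w n := by
    rw [appell, ← tsum_mul_left, ← tsum_mul_left]
    exact tsum_congr fun n => (exp_mul_R2Term a c τ w n).symm
  rw [key, R2]
  ring

/-- The terms of both series in `T_2` in terms of those of the Appell function. -/
lemma exp_mul_T2Term (a c : ℕ) (τ w : ℂ) {ε : ℤ} (hε : ε ^ 2 = 1) (m : ℕ) :
    Complex.exp (ε * (Real.pi * I * w)) * qPow τ (ε * ((a : ℂ) / (2 * c))) * T2Term a c τ w ε m =
      ε * (I / 2 * (gaussCoeff (sIndex a c) τ (ε * m) /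
        Complex.sin (Real.pi * (w + (a : ℂ) / c * τ + (ε * m : ℤ) * τ)))) := by
  have hε' : (ε : ℂ) ^ 2 = 1 := by exact_mod_cast hε
  have hor : ε = 1 ∨ ε = -1 := by simpa using hε
  set x : ℂ := ε * (w + (a : ℂ) / c * τ + (ε * m : ℤ) * τ) with hx
  have hden : Complex.exp (ε * (2 * Real.pi * I * w)) * qPow τ (ε * ((a : ℂ) / c) + m) =
      Complex.exp (2 * Real.pi * I * x) := by
    rw [qPow, ← Complex.exp_add, hx]
    congr 1
    push_cast
    linear_combination (-2 * Real.pi * I * m * τ) * hε'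
  have hnum : Complex.exp (ε * (Real.pi * I * w)) * qPow τ (ε * ((a : ℂ) / (2 * c))) *
      qPow τ ((m : ℂ) / 2 * (3 * m + 1) + ε * m * sIndex a c) =
      Complex.exp (Real.pi * I * τ * (3 * (ε * m : ℤ) ^ 2 + 2 * sIndex a c * (ε * m : ℤ))) *
        Complex.exp (Real.pi * I * x) := by
    rw [qPow, qPow, ← Complex.exp_add, ← Complex.exp_add, ← Complex.exp_add, hx]
    congr 1
    push_cast
    linear_combination (-3 * Real.pi * I * m ^ 2 * τ - Real.pi * I * m * τ) * hε'
  have hsin : (Complex.sin (Real.pi * x))⁻¹ =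
      ε * (Complex.sin (Real.pi * (w + (a : ℂ) / c * τ + (ε * m : ℤ) * τ)))⁻¹ := by
    rcases hor with rfl | rfl
    · simp [hx]
    · rw [hx, show Real.pi * (((-1 : ℤ) : ℂ) * (w + (a : ℂ) / c * τ + ((-1 * m : ℤ) : ℂ) * τ)) =
        -(Real.pi * (w + (a : ℂ) / c * τ + ((-1 * m : ℤ) : ℂ) * τ)) by push_cast; ring, Complex.sin_neg,
        inv_neg]
      simp
  have hsign : (-1 : ℂ) ^ (ε * (m : ℤ)) = (-1) ^ m := by
    rcases hor with rfl | rfl <;> simp [← inv_pow]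
  have h := exp_div_one_sub_exp x
  rw [T2Term, hden, gaussCoeff, hsign]
  calc _ = (-1) ^ m * (Complex.exp (ε * (Real.pi * I * w)) * qPow τ (ε * ((a : ℂ) / (2 * c))) *
      qPow τ ((m : ℂ) / 2 * (3 * m + 1) + ε * m * sIndex a c)) /
        (1 - Complex.exp (2 * Real.pi * I * x)) := by ring
    _ = (-1) ^ m *
        Complex.exp (Real.pi * I * τ * (3 * (ε * m : ℤ) ^ 2 + 2 * sIndex a c * (ε * m : ℤ))) *
        (Complex.exp (Real.pi * I * x) / (1 - Complex.exp (2 * Real.pi * I * x))) := by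
      rw [hnum]; ring
    _ = _ := by rw [h, div_eq_mul_inv (I / 2), hsin]; ring

lemma summable_T2Term (a c : ℕ) {τ : ℂ} (hτ : 0 < τ.im) (w : ℂ) {ε : ℤ} (hε : ε ^ 2 = 1) :
    Summable (T2Term a c τ w ε) := by
  have h0 : Complex.exp (ε * (Real.pi * I * w)) * qPow τ (ε * ((a : ℂ) / (2 * c))) ≠ 0 :=
    mul_ne_zero (Complex.exp_ne_zero _) (Complex.exp_ne_zero _)
  rw [← summable_mul_left_iff h0]
  simp only [exp_mul_T2Term a c τ w hε]
  have hinj : Function.Injective fun m : ℕ => ε * (m : ℤ) := by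
    have : ε ≠ 0 := by rintro rfl; simp at hε
    exact fun x y h => by simpa [this] using h
  exact (((summable_appell (summable_norm_gaussCoeff hτ (sIndex a c)) hτ
    (w + (a : ℂ) / c * τ)).comp_injective hinj).mul_left _).mul_left _

lemma T2_eq_appell (a c : ℕ) {τ : ℂ} (hτ : 0 < τ.im) (w : ℂ) :
    T2 a c τ w = I / 2 * appell (gaussCoeff (sIndex a c) τ) τ (w + (a : ℂ) / c * τ) /
      qProd (Complex.exp (2 * Real.pi * I * τ)) := by
  have hs := summable_appell (summable_norm_gaussCoeff hτ (sIndex a c)) hτ (w + (a : ℂ) / c * τ)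
  have hpos : ∑' m : ℕ, gaussCoeff (sIndex a c) τ m /
      Complex.sin (Real.pi * (w + (a : ℂ) / c * τ + (m : ℤ) * τ)) =
      2 / I * (Complex.exp (Real.pi * I * w) * qPow τ ((a : ℂ) / (2 * c)) *
        ∑' m : ℕ, T2Term a c τ w 1 m) := by
    rw [← tsum_mul_left, ← tsum_mul_left]
    congr 1 with m
    have := exp_mul_T2Term a c τ w (ε := 1) (by norm_num) m
    simp only [Int.cast_one, one_mul] at this
    rw [this]
    field_simp
  have hneg : ∑' m : ℕ, gaussCoeff (sIndex a c) τ (-(m + 1)) /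
      Complex.sin (Real.pi * (w + (a : ℂ) / c * τ + (-((m : ℤ) + 1) : ℤ) * τ)) =
      -(2 / I) * (Complex.exp (-(Real.pi * I * w)) * qPow τ (-((a : ℂ) / (2 * c))) *
        ∑' m : ℕ, T2Term a c τ w (-1) (m + 1)) := by
    rw [← tsum_mul_left, ← tsum_mul_left]
    congr 1 with m
    have := exp_mul_T2Term a c τ w (ε := -1) (by norm_num) (m + 1)
    simp only [Int.cast_one, Int.cast_neg, neg_one_mul, Nat.cast_add, Nat.cast_one] at this
    rw [this]
    push_cast
    field_simp
  have hsplit := tsum_of_nat_of_neg_add_one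
    (f := fun m : ℤ => gaussCoeff (sIndex a c) τ m /
      Complex.sin (Real.pi * (w + (a : ℂ) / c * τ + m * τ)))
    (hs.comp_injective (i := fun n : ℕ => (n : ℤ)) Nat.cast_injective)
    (hs.comp_injective (i := fun n : ℕ => -((n : ℤ) + 1)) fun x y hxy => by simpa using hxy)
  rw [appell, hsplit, hpos, hneg, T2, show qPow τ 1 = Complex.exp (2 * Real.pi * I * τ) by rw [qPow, mul_one]]
  field_simp
  ring

lemma appell_gaussCoeff_zero_neg (τ v : ℂ) :
    appell (gaussCoeff 0 τ) τ (-v) = -appell (gaussCoeff 0 τ) τ v := by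
  rw [appell, appell, ← tsum_neg, ← (Equiv.neg ℤ).tsum_eq]
  congr 1 with m
  have : Real.pi * (-v + ((Equiv.neg ℤ m : ℤ) : ℂ) * τ) = -(Real.pi * (v + m * τ)) := by
    simp; ring
  rw [this, Complex.sin_neg, gaussCoeff, gaussCoeff]
  simp only [Equiv.neg_apply, neg_one_zpow_neg, div_neg]
  simp

/-- With x = a/c in mind: up to the even integer M, the point i(w + x)/z is Aτ₁ - (w/(iz) + x).
Re-indexing m by A absorbs Aτ₁ and turns s = 3A into s = 0, and oddness of the resulting series
produces the minus sign. -/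
lemma appellDual_three_mul {k : ℕ} (hk : 0 < k) {h' : ℤ} {z : ℂ} (hz : 0 < z.re) (w : ℂ) {x : ℂ}
    {A M : ℤ} (hA : (A : ℂ) = k * x) (hAe : Even A) (hM : (M : ℂ) = h' * x - x) (hMe : Even M)
    (hN : ∃ N : ℤ, (A : ℂ) * x = 2 * N) :
    appellDual k (3 * A) z (modPt k h' z⁻¹) (w + x) =
      -Complex.exp (3 * Real.pi * k * w ^ 2 / z) *
        appell (gaussCoeff 0 (modPt k h' z⁻¹)) (modPt k h' z⁻¹) (w / (I * z) + x) := by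
  have hz0 : z ≠ 0 := fun h0 => by simp [h0] at hz
  obtain ⟨N, hN⟩ := hN
  set τ := modPt k h' z⁻¹ with hτ
  have hkτ : (k : ℂ) * τ = h' + I * z⁻¹ := natCast_mul_modPt hk h' z⁻¹
  have hv : I * (w + x) / z = A * τ + (-(w / (I * z) + x) + (-M : ℤ)) := by
    have : (A : ℂ) * τ = x * (h' + I * z⁻¹) := by rw [hA, ← hkτ]; ring
    rw [this]
    push_cast
    rw [hM]
    field_simp
    ring_nf
    simp only [I_sq]
    ring
  have hshift : appell (gaussCoeff (3 * A) τ) τ (I * (w + x) / z) =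
      Complex.exp (-(3 * Real.pi * I * τ * A ^ 2)) *
        appell (gaussCoeff 0 τ) τ (I * (w + x) / z - A * τ) := by
    rw [appell, appell, ← tsum_mul_left, ← (Equiv.subRight A).tsum_eq]
    congr 1 with m
    have e : gaussCoeff (3 * A) τ (m - A) =
        Complex.exp (-(3 * Real.pi * I * τ * A ^ 2)) * gaussCoeff 0 τ m := by
      rw [gaussCoeff, gaussCoeff, zpow_sub₀ (by norm_num : (-1 : ℂ) ≠ 0), hAe.neg_one_zpow, div_one,
        mul_left_comm, ← Complex.exp_add]
      congr 2
      push_cast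
      ring
    rw [Equiv.subRight_apply, e, mul_div_assoc]
    congr 4
    push_cast
    ring
  have hexp : Complex.exp (3 * Real.pi * k * (w + x) ^ 2 / z - 2 * Real.pi * (3 * A : ℤ) * (w + x) / z) *
      Complex.exp (-(3 * Real.pi * I * τ * A ^ 2)) = Complex.exp (3 * Real.pi * k * w ^ 2 / z) := by
    -- The i/z part cancels against the Gaussian in x; the part with h' contributes an integral
    -- multiple of 2πi because Ax is an even integer.
    have h1 : τ * A ^ 2 = k * x ^ 2 * I / z + 2 * N * h' := by
      have : τ * A ^ 2 = A * x * (k * τ) := by rw [hA]; ring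
      rw [this, hkτ, ← hN, hA]
      ring
    rw [← Complex.exp_add, ← mul_one (Complex.exp (3 * Real.pi * k * w ^ 2 / z)),
      ← Complex.exp_int_mul_two_pi_mul_I (-(3 * N * h')), ← Complex.exp_add]
    congr 1
    push_cast
    rw [hA]
    rw [hA] at h1
    linear_combination (-(3 * Real.pi * I)) * h1 - 3 * Real.pi * k * x ^ 2 / z * I_sq
  rw [appellDual, hshift, ← mul_assoc, hexp, hv, add_sub_cancel_left, appell_add_int,
    hMe.neg.neg_one_zpow, one_mul, appell_gaussCoeff_zero_neg]
  ring


/-! ### Regrouping the Mordell integrals by residue class. -/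

lemma sum_range_add_of_periodic {f : ℤ → ℂ} {N : ℕ} (hf : ∀ n, f (n + N) = f n) (t : ℤ) :
    ∑ l ∈ Finset.range N, f (t + l) = ∑ l ∈ Finset.range N, f l := by
  have step : ∀ t : ℤ, ∑ l ∈ Finset.range N, f (t + 1 + l) = ∑ l ∈ Finset.range N, f (t + l) := by
    intro t
    have h1 := Finset.sum_range_succ (fun l : ℕ => f (t + l)) N
    have h2 := Finset.sum_range_succ' (fun l : ℕ => f (t + l)) N
    rw [h1, hf] at h2
    simp only [Nat.cast_zero, add_zero] at h2
    rw [add_right_cancel h2]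
    refine Finset.sum_congr rfl fun l _ => ?_
    congr 1
    push_cast
    ring
  induction t using Int.induction_on with
  | zero => simp
  | succ i ih => rw [step, ih]
  | pred i ih => rw [← ih, ← step (-i - 1), sub_add_cancel]

lemma sum_range_sub_of_periodic {f : ℤ → ℂ} {N : ℕ} (hf : ∀ n, f (n + N) = f n) (t : ℤ) :
    ∑ l ∈ Finset.range N, f (t - l) = ∑ l ∈ Finset.range N, f l := by
  rw [← Finset.sum_range_reflect, ← sum_range_add_of_periodic hf (t - (N - 1))]
  refine Finset.sum_congr rfl fun l hl => ?_
  rw [Finset.mem_range] at hl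
  congr 1
  omega

lemma sum_range_three_mul (f : ℕ → ℂ) (k : ℕ) :
    ∑ n ∈ Finset.range (3 * k), f n =
      ∑ ν ∈ Finset.range k, (f (3 * ν) + f (3 * ν + 1) + f (3 * ν + 2)) := by
  induction k with
  | zero => simp
  | succ k ih =>
    rw [show 3 * (k + 1) = 3 * k + 1 + 1 + 1 by ring, Finset.sum_range_succ, Finset.sum_range_succ,
      Finset.sum_range_succ, ih, Finset.sum_range_succ]
    ring

/-- The Mordell integral as a function of the position of its poles. -/
def mordellAt (lam v : ℂ) : ℂ :=
  ∫ x : ℝ, Complex.exp (-(3 * Real.pi * lam * (x : ℂ) ^ 2)) / Complex.sinh (Real.pi * (lam * x - I * v))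

lemma mordellAt_neg (lam v : ℂ) : mordellAt lam (-v) = -mordellAt lam v := by
  rw [mordellAt, mordellAt, ← integral_neg, ← integral_neg_eq_self]
  congr 1 with x
  rw [show Real.pi * (lam * ((-x : ℝ) : ℂ) - I * -v) = -(Real.pi * (lam * x - I * v)) by
    push_cast; ring, Complex.sinh_neg, div_neg]
  push_cast
  rw [neg_sq]

lemma mordellAt_sub_one (lam v : ℂ) : mordellAt lam (v - 1) = -mordellAt lam v := by
  rw [mordellAt, mordellAt, ← integral_neg]
  congr 1 with x
  rw [show Real.pi * (lam * (x : ℂ) - I * (v - 1)) = Real.pi * (lam * x - I * v) + Real.pi * I by ring,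
    Complex.sinh_add, Complex.cosh_mul_I, Complex.sinh_mul_I, Complex.cos_pi, Complex.sin_pi]
  simp [div_neg]

lemma mordellDen_eq {k : ℕ} (hk : 0 < k) (ν : ℤ) (a c : ℕ) {ε : ℤ} (hε : ε ^ 2 = 1) (z w : ℂ) (x : ℝ) :
    mordellDen k ν a c ε z w x = Complex.sinh (Real.pi *
      (z / k * x - I * (ε * (w + (a : ℂ) / c + ε * (6 * ν - 1) / (6 * k))))) := by
  have hk0 : (k : ℂ) ≠ 0 := by exact_mod_cast hk.ne'
  have hε' : (ε : ℂ) ^ 2 = 1 := by exact_mod_cast hε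
  rw [mordellDen]
  congr 1
  have : (ε : ℂ) * (w + (a : ℂ) / c + ε * (6 * ν - 1) / (6 * k)) =
      ε * (w + (a : ℂ) / c) + (6 * ν - 1) / (6 * k) := by
    linear_combination ((6 * ν - 1) / (6 * k) : ℂ) * hε'
  rw [this]
  field_simp
  ring

/-- Oddness in the pole position absorbs the sign in front of the integral, so both signs become
values of one function. -/
lemma mordellI_eq_mordellAt {k : ℕ} (hk : 0 < k) (ν : ℤ) (a c : ℕ) {ε : ℤ} (hε : ε ^ 2 = 1) (z w : ℂ) :
    mordellI k ν a c ε z w =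
      mordellAt (z / k) (w + (a : ℂ) / c + ε * (6 * ν - 1) / (6 * k)) := by
  have hor : ε = 1 ∨ ε = -1 := by simpa using hε
  have h : mordellI k ν a c ε z w =
      ε * mordellAt (z / k) (ε * (w + (a : ℂ) / c + ε * (6 * ν - 1) / (6 * k))) := by
    rw [mordellI, mordellAt]
    congr 2 with x
    rw [mordellIntegrand, mordellDen_eq hk ν a c hε]
    congr 2
    ring
  rw [h]
  rcases hor with rfl | rfl
  · simp
  · simp only [Int.cast_neg, Int.cast_one, neg_one_mul, mordellAt_neg, neg_neg]

/-- Every odd integer prime to `3` is `±(6ν - 1)` modulo `6k` for some `0 ≤ ν < k`. -/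
lemma exists_six_mul_sub_one {k : ℕ} (hk : 0 < k) {j : ℤ} (hj : Odd j) (h3 : ¬ (3 : ℤ) ∣ j) :
    ∃ ε ∈ ({1, -1} : Finset ℤ), ∃ ν ∈ Finset.range k, ∃ m : ℤ, j = -(ε * (6 * ν - 1)) + 6 * k * m := by
  have hk0 : (k : ℤ) ≠ 0 := by exact_mod_cast hk.ne'
  have main : ∀ i : ℤ, ∃ ν ∈ Finset.range k, ∃ m : ℤ, i = ν + k * m := by
    intro i
    have h0 := Int.emod_nonneg i hk0
    have h1 := Int.emod_lt_of_pos i (by exact_mod_cast hk : (0 : ℤ) < k)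
    refine ⟨(i % k).toNat, Finset.mem_range.2 (by omega), i / k, ?_⟩
    rw [Int.toNat_of_nonneg h0]
    exact (Int.emod_add_mul_ediv i k).symm
  have : (∃ i : ℤ, j = 6 * i - 1) ∨ ∃ i : ℤ, j = 6 * i + 1 := by
    obtain ⟨r, rfl⟩ := hj
    have : r % 3 = 0 ∨ r % 3 = 2 := by omega
    rcases this with h | h
    · exact Or.inr ⟨r / 3, by omega⟩
    · exact Or.inl ⟨r / 3 + 1, by omega⟩
  rcases this with ⟨i, rfl⟩ | ⟨i, rfl⟩
  · obtain ⟨ν, hν, m, rfl⟩ := main i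
    exact ⟨-1, by simp, ν, hν, m, by ring⟩
  · obtain ⟨ν, hν, m, hm⟩ := main (-i)
    refine ⟨1, by simp, ν, hν, -m, ?_⟩
    linear_combination -6 * hm

section
variable {k : ℕ} (hk : 0 < k) {a c : ℕ} {z : ℂ} (hz : 0 < z.re) {w : ℂ}
  (hw : ∀ t ∈ Set.Icc (0 : ℝ) 1, ∀ ν ∈ Finset.range k, ∀ ε ∈ ({1, -1} : Finset ℤ), ∀ x : ℝ,
      mordellDen k ν a c ε z (t * w) x ≠ 0)

include hk hz hw

/-- A pole at height 0 would be a real zero of some `mordellDen` on the segment: j is congruent to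
∓(6ν - 1) modulo 6k, and integer shifts do not affect the zeros of sinh. -/
lemma re_ne_zero_of_mordellDen_ne_zero {j : ℤ} (hj : Odd j) (h3 : ¬ (3 : ℤ) ∣ j) {t : ℝ}
    (ht : t ∈ Set.Icc (0 : ℝ) 1) (n : ℤ) :
    t * (w / (z / k)).re + ((a : ℝ) / c - j / (6 * k) + n) * ((z / k)⁻¹).re ≠ 0 := by
  intro h0
  have hk0 : (k : ℂ) ≠ 0 := by exact_mod_cast hk.ne'
  have hz0 : z ≠ 0 := fun h0 => by simp [h0] at hz
  obtain ⟨ε, hε, ν, hν, m, rfl⟩ := exists_six_mul_sub_one hk hj h3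
  have hε2 : ε ^ 2 = 1 := by
    simp only [Finset.mem_insert, Finset.mem_singleton] at hε
    rcases hε with rfl | rfl <;> norm_num
  set y : ℂ := (t * w + ((a : ℂ) / c - ((-(ε * (6 * ν - 1)) + 6 * k * m : ℤ) : ℂ) / (6 * k) + n)) / (z / k)
    with hy
  have hre : y.re = 0 := by
    rw [← h0, hy, add_div, add_re, mul_div_assoc, re_ofReal_mul, div_eq_mul_inv (_ + _) (z / (k : ℂ))]
    congr 1
    rw [← re_ofReal_mul]
    push_cast
    rfl
  have hyI : y = y.im * I := by
    apply Complex.ext <;> simp [hre]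
  refine hw t ht ν hν ε hε (-(ε * y.im)) ?_
  rw [mordellDen_eq hk ν a c hε2, sinh_pi_mul_eq_zero_iff]
  refine ⟨ε * (n - m), ?_⟩
  have h1 : (t * w + ((a : ℂ) / c - ((-(ε * (6 * ν - 1)) + 6 * k * m : ℤ) : ℂ) / (6 * k) + n)) =
      z / k * (y.im * I) := by
    rw [← hyI, hy]; field_simp
  have h2 : ((-(ε * (6 * ν - 1)) + 6 * k * m : ℤ) : ℂ) / (6 * k) =
      -(ε * (6 * ν - 1) / (6 * k)) + m := by
    push_cast; field_simp
  rw [h2] at h1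
  push_cast
  linear_combination (-(I * ε)) * h1 - (z / k * y.im * ε) * I_sq

lemma integral_eq_mordellExt_of_odd {j : ℤ} (hj : Odd j) (h3 : ¬ (3 : ℤ) ∣ j) :
    Integrable (fun x : ℝ => Complex.exp (-(3 * Real.pi * (z / k) * (x : ℂ) ^ 2)) /
      Complex.sinh (Real.pi * (z / k * x - I * (w + (a : ℂ) / c - j / (6 * k))))) ∧
    mordellAt (z / k) (w + (a : ℂ) / c - j / (6 * k)) =
      mordellExt (z / k) ((a : ℝ) / c - j / (6 * k)) w := by
  have h := integral_eq_mordellExt (div_natCast_re_pos hk hz) (b := (a : ℝ) / c - j / (6 * k)) (w := w)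
    fun t ht n => re_ne_zero_of_mordellDen_ne_zero hk hz hw hj h3 ht n
  have e : w + (((a : ℝ) / c - j / (6 * k) : ℝ) : ℂ) = w + (a : ℂ) / c - j / (6 * k) := by
    push_cast; ring
  rw [e] at h
  exact h

lemma integrable_mordellIntegrand (ν : ℤ) {ε : ℤ} (hε : ε ^ 2 = 1) :
    Integrable (mordellIntegrand k ν a c ε z w) := by
  have hor : ε = 1 ∨ ε = -1 := by simpa using hε
  have hj : Odd (-(ε * (6 * ν - 1))) := by
    rcases hor with rfl | rfl
    · exact ⟨-3 * ν, by ring⟩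
    · exact ⟨3 * ν - 1, by ring⟩
  have h3 : ¬ (3 : ℤ) ∣ -(ε * (6 * ν - 1)) := by
    rcases hor with rfl | rfl <;> omega
  have h := (integral_eq_mordellExt_of_odd hk hz hw hj h3).1
  have e : w + (a : ℂ) / c - ((-(ε * (6 * ν - 1)) : ℤ) : ℂ) / (6 * k) =
      w + (a : ℂ) / c + ε * (6 * ν - 1) / (6 * k) := by push_cast; ring
  rw [e] at h
  rcases hor with rfl | rfl
  · refine h.congr (Eventually.of_forall fun x => ?_)
    simp only [mordellIntegrand, mordellDen_eq hk ν a c hε, Int.cast_one, one_mul]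
    congr 2
    ring
  · refine h.comp_neg.neg.congr (Eventually.of_forall fun x => ?_)
    simp only [mordellIntegrand, mordellDen_eq hk ν a c hε, Pi.neg_apply]
    rw [← div_neg, ← Complex.sinh_neg]
    congr 2
    · push_cast; ring
    · push_cast; ring

/-- The sum of Mordell integrals over the window `2s - 1 - 2l`, `0 ≤ l < 3k`, rearranged as the sum
over `ν` modulo `k` and the two signs. -/
lemma sum_mordellTerm {h' : ℤ} (hpar : Even ((1 + (k : ℤ)) * (1 + h'))) (s : ℤ) :
    ∑ l ∈ Finset.range (3 * k),
        mordellTerm k z (modPt k h' z⁻¹) ((a : ℝ) / c) (2 * s - 1 - 2 * l) w =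
      Complex.exp (-(Real.pi / (12 * k * z))) * qProd (Complex.exp (2 * Real.pi * I * modPt k h' z⁻¹)) *
        ∑ ν ∈ Finset.range k, ∑ ε ∈ ({1, -1} : Finset ℤ), (-1) ^ ν *
          Complex.exp (Real.pi * I * h' / k * (-3 * (ν : ℂ) ^ 2 + ν)) * mordellI k ν a c ε z w := by
  have hk0 : (k : ℂ) ≠ 0 := by exact_mod_cast hk.ne'
  set T := modPt k h' z⁻¹ with hT
  -- Unlike `mordellTerm`, this is periodic on odd j: the sign changes of coefficient and integral
  -- over a period 6k cancel, so the window can be moved.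
  let φ : ℤ → ℂ := fun j => if (3 : ℤ) ∣ j then 0 else
    oddThetaHat k z T j * mordellAt (z / k) (w + (a : ℂ) / c - j / (6 * k))
  have hφ : ∀ n : ℤ, φ (2 * n - 1 + 6 * k) = φ (2 * n - 1) := by
    intro n
    have h1 := oddThetaHat_add_period hk hz hpar (j := 2 * n - 1) ⟨n - 1, by ring⟩
    have h2 : w + (a : ℂ) / c - ((2 * n - 1 + 6 * k : ℤ) : ℂ) / (6 * k) =
        w + (a : ℂ) / c - ((2 * n - 1 : ℤ) : ℂ) / (6 * k) - 1 := by
      push_cast; field_simp; ring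
    have h3 : (3 : ℤ) ∣ 2 * n - 1 + 6 * k ↔ (3 : ℤ) ∣ 2 * n - 1 := by omega
    simp only [φ, h1, h2, h3, mordellAt_sub_one, hT, neg_mul_neg]
  have h1 : ∑ l ∈ Finset.range (3 * k), mordellTerm k z T ((a : ℝ) / c) (2 * s - 1 - 2 * l) w =
      ∑ l ∈ Finset.range (3 * k), φ (2 * (s - l) - 1) := by
    refine Finset.sum_congr rfl fun l _ => ?_
    rw [show (2 * s - 1 - 2 * l : ℤ) = 2 * (s - l) - 1 by ring]
    simp only [mordellTerm, φ]
    split_ifs with h3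
    · rfl
    · rw [(integral_eq_mordellExt_of_odd hk hz hw ⟨s - l - 1, by ring⟩ h3).2]
  have h2 := sum_range_sub_of_periodic (f := fun n => φ (2 * n - 1)) (N := 3 * k) (fun n => by
    rw [← hφ n]; congr 1; push_cast; ring) s
  have h3 := sum_range_three_mul (fun n => φ (2 * (n : ℤ) - 1)) k
  -- Reflecting ν turns 6ν + 1 into -(6ν - 1); evenness of the theta coefficient then gives both
  -- signs the same weight.
  have h4 := sum_range_sub_of_periodic (f := fun n => φ (6 * n + 1)) (N := k) (fun n => by
    have := hφ (3 * n + 1)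
    rw [show (6 * (n + k) + 1 : ℤ) = 2 * (3 * n + 1) - 1 + 6 * k by ring, this]; congr 1; ring) 0
  rw [h1, h2, h3, Finset.mul_sum]
  -- The third member of each triple is 6ν + 3, whose coefficient is zero.
  have h5 : ∀ ν : ℕ, φ (2 * ((3 * ν : ℕ) : ℤ) - 1) + φ (2 * ((3 * ν + 1 : ℕ) : ℤ) - 1) +
      φ (2 * ((3 * ν + 2 : ℕ) : ℤ) - 1) = φ (6 * ν - 1) + φ (6 * ν + 1) := by
    intro ν
    have : φ (2 * ((3 * ν + 2 : ℕ) : ℤ) - 1) = 0 := if_pos (by push_cast; omega)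
    rw [this, add_zero]
    congr 2 <;> push_cast <;> ring
  simp only [h5]
  rw [Finset.sum_add_distrib, ← h4, ← Finset.sum_add_distrib]
  refine Finset.sum_congr rfl fun ν _ => ?_
  have h6 : φ (6 * ν - 1) = oddThetaHat k z T (6 * ν - 1) * mordellI k ν a c (-1) z w := by
    rw [mordellI_eq_mordellAt hk _ a c (by norm_num)]
    simp only [φ]
    rw [if_neg (by omega)]
    congr 2
    push_cast
    ring
  have h7 : φ (6 * (0 - ν) + 1) = oddThetaHat k z T (6 * ν - 1) * mordellI k ν a c 1 z w := by
    rw [mordellI_eq_mordellAt hk _ a c (by norm_num), ← oddThetaHat_neg]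
    simp only [φ]
    rw [if_neg (by omega), show (6 * (0 - ν) + 1 : ℤ) = -(6 * ν - 1) by ring]
    congr 2
    push_cast
    ring
  rw [h6, h7, Finset.sum_pair (by norm_num), hT, oddThetaHat_six_mul_sub_one hk h' hz, zpow_natCast,
    Int.cast_natCast]
  ring

end


/-! ### Division by the Euler products and the two cases of the theorem. -/

/-- The transformation law in terms of the dual Appell function. -/
lemma R2_transform {k : ℕ} (hk : 0 < k) {h h' B s : ℤ} {z : ℂ} (hz : 0 < z.re)
    (hB : h * h' + 1 = k * B) (hpar : Even ((1 + (k : ℤ)) * (1 + h')))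
    (hpar' : Even ((1 + h) * (1 + B))) {a c : ℕ} (hac : a ≤ c)
    (hb : ∀ l ∈ Finset.range (3 * k), ¬ (3 : ℤ) ∣ 2 * s - 1 - 2 * l →
      (a : ℝ) / c - (2 * s - 1 - 2 * l : ℤ) / (6 * k) ∈ Set.Ioo (0 : ℝ) 1) {w : ℂ}
    (hw : ∀ t ∈ Set.Icc (0 : ℝ) 1, ∀ ν ∈ Finset.range k, ∀ ε ∈ ({1, -1} : Finset ℤ), ∀ x : ℝ,
      mordellDen k ν a c ε z (t * w) x ≠ 0)
    (hpole : ∀ n : ℤ, R2Den a c (Complex.exp (2 * Real.pi * I * modPt k h z)) w n ≠ 0) :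
    R2 a c (Complex.exp (2 * Real.pi * I * modPt k h z)) w =
      omega h k * z ^ (1 / 2 : ℂ) * Complex.exp (Real.pi / (12 * k) * (z⁻¹ - z)) *
          (appellDual k s z (modPt k h' z⁻¹) (w + (a : ℂ) / c) / (2 * z) /
            qProd (Complex.exp (2 * Real.pi * I * modPt k h' z⁻¹))) -
        z ^ (1 / 2 : ℂ) / (2 * k) * omega h k * Complex.exp (-(Real.pi * z / (12 * k))) *
          ∑ ν ∈ Finset.range k, ∑ ε ∈ ({1, -1} : Finset ℤ), (-1) ^ ν *
            Complex.exp (Real.pi * I * h' / k * (-3 * (ν : ℂ) ^ 2 + ν)) * mordellI k ν a c ε z w := by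
  have hz0 : z ≠ 0 := fun h0 => by simp [h0] at hz
  have hk0 : (k : ℂ) ≠ 0 := by exact_mod_cast hk.ne'
  have hb₀ : (a : ℝ) / c ∈ Set.Icc (0 : ℝ) 1 :=
    ⟨by positivity, div_le_one_of_le₀ (by exact_mod_cast hac) (by positivity)⟩
  have hp : ∀ n j : ℤ, (w + ((a : ℝ) / c : ℝ)) + n * modPt k h z ≠ j := by
    intro n j hnj
    push_cast at hnj
    apply hpole n
    rw [R2Den_eq, hnj, sub_eq_zero, ← Complex.exp_int_mul_two_pi_mul_I j]
    congr 1
    ring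
  have hdef := transformDefect_eq_zero hk hz hB hpar hpar' hb hb₀ hp
  rw [transformDefect, sum_mordellTerm hk hz hw hpar s] at hdef
  have hP := qProd_modPt hk hB hz
  have hP0 := qProd_ne_zero (modPt_im_pos hk h hz)
  have hP₁ := qProd_ne_zero (modPt_im_pos hk h' (inv_re_pos hz))
  have hE : Complex.exp (Real.pi / (12 * k) * (z⁻¹ - z)) * Complex.exp (-(Real.pi / (12 * k * z))) =
      Complex.exp (-(Real.pi * z / (12 * k))) := by
    rw [← Complex.exp_add]
    congr 1
    field_simp
    ring
  push_cast at hdef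
  rw [R2_eq_appell, ← hE]
  set P := qProd (Complex.exp (2 * Real.pi * I * modPt k h z))
  set P₁ := qProd (Complex.exp (2 * Real.pi * I * modPt k h' z⁻¹))
  set D := appellDual k s z (modPt k h' z⁻¹) (w + (a : ℂ) / c)
  set E := Complex.exp (Real.pi / (12 * k) * (z⁻¹ - z))
  set E' := Complex.exp (-(Real.pi / (12 * k * z)))
  set S := ∑ ν ∈ Finset.range k, ∑ ε ∈ ({1, -1} : Finset ℤ), (-1) ^ ν *
    Complex.exp (Real.pi * I * h' / k * (-3 * (ν : ℂ) ^ 2 + ν)) * mordellI k ν a c ε z w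
  have hA : appell (gaussCoeff 0 (modPt k h z)) (modPt k h z) (w + (a : ℂ) / c) =
      I / z * D - I / k * (E' * P₁ * S) := by linear_combination hdef
  rw [hA]
  calc _ = (D / (2 * z) - E' * P₁ * S / (2 * k)) / P := by
        congr 1
        linear_combination (-(D / (2 * z) - E' * P₁ * S / (2 * k))) * I_sq
    _ = (D / (2 * z) - E' * P₁ * S / (2 * k)) * (omega h k * z ^ (1 / 2 : ℂ) * E) / P₁ := by
        rw [hP]
        have : omega h k * z ^ (1 / 2 : ℂ) * E * P ≠ 0 := by rw [← hP]; exact hP₁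
        have h1 := left_ne_zero_of_mul this
        rw [mul_comm _ P, mul_div_mul_right _ _ h1]
    _ = _ := by field_simp

/-- The numbers j = 2s - 1, 2s - 3, 2s - 5 all put a/c - j/6 in (0,1) exactly when (2s - 1)/6 < a/c
< (2s + 1)/6. This explains the four intervals, and the excluded values are their common endpoints.
-/
lemma sIndex_window {a c : ℕ} (ha : 0 < a) (hac : a < c) (h1 : (a : ℝ) / c ≠ 1 / 6)
    (h2 : (a : ℝ) / c ≠ 1 / 2) (h3 : (a : ℝ) / c ≠ 5 / 6) {l : ℕ} (hl : l < 3) :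
    (a : ℝ) / c - (2 * sIndex a c - 1 - 2 * l : ℤ) / 6 ∈ Set.Ioo (0 : ℝ) 1 := by
  have hc : (0 : ℝ) < c := by exact_mod_cast ha.trans hac
  have x0 : 0 < (a : ℝ) / c := div_pos (by exact_mod_cast ha) hc
  have x1 : (a : ℝ) / c < 1 := (div_lt_one hc).2 (by exact_mod_cast hac)
  unfold sIndex
  generalize (a : ℝ) / c = x at *
  split_ifs with i1 i2 i3
  all_goals
    try replace i1 := lt_of_le_of_ne (not_lt.1 i1) h1.symm
    try replace i2 := lt_of_le_of_ne (not_lt.1 i2) h2.symm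
    try replace i3 := lt_of_le_of_ne (not_lt.1 i3) h3.symm
    interval_cases l
    all_goals constructor <;> push_cast <;> linarith

end TwistedRank

end

open TwistedRank

theorem theorem4p2 (a c : ℕ) (ha : 0 < a) (hac : a < c) (hcop : Nat.Coprime a c)
    (k : ℕ) (hk : 0 < k) (h h' : ℤ) (hhk : IsCoprime h (k : ℤ))
    (hcase :
      (k = 1 ∧ h' = 0 ∧
        (a : ℝ) / c ≠ 1 / 6 ∧ (a : ℝ) / c ≠ 1 / 2 ∧ (a : ℝ) / c ≠ 5 / 6) ∨
      (2 * c ^ 2 ∣ k ∧ h * h' ≡ -1 [ZMOD 2 * (k : ℤ)] ∧ h' ≡ 1 [ZMOD 2 * (c : ℤ) ^ 2]))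
    (z : ℂ) (hz : 0 < z.re) (q q₁ : ℂ)
    (hq : q = Complex.exp (2 * Real.pi * Complex.I / k * (h + Complex.I * z)))
    (hq₁ : q₁ = Complex.exp (2 * Real.pi * Complex.I / k * (h' + Complex.I / z)))
    (w : ℂ)
    -- the integrals are defined at every point of the segment from `0` to `w`
    (hw : ∀ t ∈ Set.Icc (0 : ℝ) 1, ∀ ν ∈ Finset.range k, ∀ ε ∈ ({1, -1} : Finset ℤ), ∀ x : ℝ,
      TwistedRank.mordellDen k ν a c ε z (t * w) x ≠ 0)
    -- `w` is not a pole of the left-hand side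
    (hpole : ∀ n : ℤ, TwistedRank.R2Den a c q w n ≠ 0) :
    -- all the series and integrals converge absolutely
    Summable (TwistedRank.R2Term a c q w) ∧
    (k = 1 → ∀ ε ∈ ({1, -1} : Finset ℤ),
      Summable (TwistedRank.T2Term a c ((h' + Complex.I / z) / k) (Complex.I * w / z) ε)) ∧
    (2 * c ^ 2 ∣ k → Summable (TwistedRank.R2Term a c q₁ (w / (Complex.I * z)))) ∧
    (∀ ν ∈ Finset.range k, ∀ ε ∈ ({1, -1} : Finset ℤ),
      MeasureTheory.Integrable (TwistedRank.mordellIntegrand k ν a c ε z w)) ∧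
    -- the transformation law
    TwistedRank.R2 a c q w =
      TwistedRank.S1 a c k h h' z w -
        z ^ (1 / 2 : ℂ) / (2 * k) * TwistedRank.omega h k *
          Complex.exp (-(Real.pi * z / (12 * k))) *
          ∑ ν ∈ Finset.range k, ∑ ε ∈ ({1, -1} : Finset ℤ),
            (-1) ^ ν *
              Complex.exp (Real.pi * Complex.I * h' / k * (-3 * (ν : ℂ) ^ 2 + ν)) *
              TwistedRank.mordellI k ν a c ε z w := by
  have hz0 : z ≠ 0 := fun h0 => by simp [h0] at hz
  have hk0 : (k : ℂ) ≠ 0 := by exact_mod_cast hk.ne'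
  have hqm : q = Complex.exp (2 * Real.pi * Complex.I * modPt k h z) := by
    rw [hq, modPt]; congr 1; ring
  have hpt : (h' + Complex.I / z) / k = modPt k h' z⁻¹ := by rw [modPt, ← div_eq_mul_inv]
  have hq₁m : q₁ = Complex.exp (2 * Real.pi * Complex.I * modPt k h' z⁻¹) := by
    rw [hq₁, ← hpt]; congr 1; ring
  have hτ := modPt_im_pos hk h hz
  have hτ₁ := modPt_im_pos hk h' (inv_re_pos hz)
  have hε : ∀ ε ∈ ({1, -1} : Finset ℤ), ε ^ 2 = 1 := by
    intro ε hε
    simp only [Finset.mem_insert, Finset.mem_singleton] at hε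
    rcases hε with rfl | rfl <;> norm_num
  have hroot : z ^ (1 / 2 : ℂ) * z ^ (1 / 2 : ℂ) = z := by
    rw [← Complex.cpow_add _ _ hz0]; norm_num
  have hroot0 : z ^ (1 / 2 : ℂ) ≠ 0 := fun h0 => hz0 (by rw [← hroot, h0, mul_zero])
  have hrdiv : z ^ (1 / 2 : ℂ) * z⁻¹ = (z ^ (1 / 2 : ℂ))⁻¹ := by
    rw [← div_eq_mul_inv, div_eq_iff hz0, eq_inv_mul_iff_mul_eq₀ hroot0, hroot]
  refine ⟨hqm ▸ summable_R2Term a c hτ w, fun _ ε hmem => ?_, fun _ => hq₁m ▸ summable_R2Term a c hτ₁ _,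
    fun ν _ ε hmem => integrable_mordellIntegrand hk hz hw ν (hε ε hmem), ?_⟩
  · rw [hpt]
    exact summable_T2Term a c hτ₁ _ (hε ε hmem)
  rw [hqm] at hpole ⊢
  rw [S1, ← hq₁, hq₁m, hpt]
  rcases hcase with ⟨rfl, rfl, n1, n2, n3⟩ | ⟨⟨K, hK⟩, hh, h1⟩
  · rw [R2_transform hk hz (B := 1) (s := sIndex a c) (h' := 0) (by simp) (by decide)
      (by rw [← two_mul] at *; exact ⟨1 + h, by ring⟩) hac.le ?_ hw hpole, if_pos rfl,
      T2_eq_appell a c hτ₁, omega_one, appellDual, Complex.cpow_neg]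
    · have e : Complex.I * w / z + (a : ℂ) / c * modPt 1 0 z⁻¹ =
          Complex.I * (w + (a : ℂ) / c) / z := by
        rw [modPt]; push_cast; field_simp; ring
      simp only [e]
      congr 1
      have e2 : Complex.exp (Real.pi / 12 * (z⁻¹ - z) -
          2 * Real.pi * sIndex a c / z * (w + (a : ℂ) / c) +
          3 * Real.pi / z * (w + (a : ℂ) / c) ^ 2) =
          Complex.exp (Real.pi / (12 * (1 : ℕ)) * (z⁻¹ - z)) *
            Complex.exp (3 * Real.pi * (1 : ℕ) * (w + (a : ℂ) / c) ^ 2 / z -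
              2 * Real.pi * sIndex a c * (w + (a : ℂ) / c) / z) := by
        rw [← Complex.exp_add]
        congr 1
        push_cast
        ring
      rw [e2]
      generalize appell _ _ _ = Y
      set E := Complex.exp (Real.pi / (12 * (1 : ℕ)) * (z⁻¹ - z))
      set P := qProd _
      generalize Complex.exp (3 * Real.pi * (1 : ℕ) * (w + (a : ℂ) / c) ^ 2 / z -
              2 * Real.pi * sIndex a c * (w + (a : ℂ) / c) / z) = W
      linear_combination (E * W * Y / P / 2) * hrdiv +
        (E * W * Y / P / 2 * (z ^ (1 / 2 : ℂ))⁻¹) * Complex.I_sq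
    · intro l hl _
      have := sIndex_window ha hac n1 n2 n3 (by simpa using hl)
      simpa using this
  · have hk1 : k ≠ 1 := by
      rintro rfl
      have : 1 < c := by omega
      have := Nat.le_of_dvd one_pos ⟨K, hK⟩
      nlinarith
    have hc0 : (c : ℂ) ≠ 0 := by exact_mod_cast (ha.trans hac).ne'
    have hc0' : (c : ℝ) ≠ 0 := by exact_mod_cast (ha.trans hac).ne'
    obtain ⟨N, hN⟩ := h1.symm.dvd
    obtain ⟨B, hB⟩ := hh.symm.dvd
    have hke : Even (k : ℤ) := ⟨(c : ℤ) ^ 2 * K, by rw [hK]; push_cast; ring⟩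
    -- The congruence modulo 2k makes hh' odd, so h and h' are both odd and the two parity
    -- conditions hold.
    have hB' : h * h' + 1 = k * (2 * B) := by linear_combination hB
    have ho : Odd (h * h') := ⟨k * B - 1, by linear_combination hB⟩
    obtain ⟨hho, hho'⟩ := Int.odd_mul.1 ho
    have hkC : (k : ℂ) = 2 * c ^ 2 * K := by rw [hK]; push_cast; ring
    have hh'C : (h' : ℂ) - 1 = 2 * c ^ 2 * N := by exact_mod_cast hN
    have hK0 : (K : ℝ) ≠ 0 := by
      rintro h0
      rw [Nat.cast_eq_zero] at h0
      simp [h0] at hK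
      omega
    -- With k = 2c²K and h' - 1 = 2c²N, the even integers A = 2cKa and M = 2cNa are ka/c and (h' -
    -- 1)a/c, and s = 3A. The window then becomes the numbers (1 + 2l)/(6k) with 0 ≤ l < 3k, all of
    -- them in (0,1).
    rw [R2_transform hk hz hB' (s := 3 * (2 * c * K * a)) ((odd_one.add_odd hho').mul_left _)
      ((odd_one.add_odd hho).mul_right _) hac.le ?_ hw hpole, if_neg hk1,
      appellDual_three_mul hk hz w (A := 2 * c * K * a) (M := 2 * c * N * a) (x := (a : ℂ) / c)
        (by rw [hkC]; push_cast; field_simp) ⟨c * K * a, by ring⟩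
        (by
          have : (h' : ℂ) = 1 + 2 * c ^ 2 * N := by linear_combination hh'C
          rw [this]; push_cast; field_simp; ring) ⟨c * N * a, by ring⟩
        ⟨K * a ^ 2, by push_cast; field_simp⟩, R2_eq_appell, Complex.exp_add]
    · congr 1
      generalize appell _ _ _ = Y
      set E := Complex.exp (Real.pi / (12 * k) * (z⁻¹ - z))
      set W := Complex.exp (3 * Real.pi * k * w ^ 2 / z)
      set P := qProd _
      linear_combination (-(omega h k * E * W * Y / P / 2)) * hrdiv -
        (omega h k * E * W * Y / P / 2 * (z ^ (1 / 2 : ℂ))⁻¹) * Complex.I_sq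
    · intro l hl _
      have hl' : (l : ℝ) + 1 ≤ 3 * k := by exact_mod_cast Finset.mem_range.1 hl
      have hkR : (k : ℝ) = 2 * c ^ 2 * K := by rw [hK]; push_cast; ring
      have hk0' : (0 : ℝ) < k := by exact_mod_cast hk
      have e : (a : ℝ) / c - ((2 * (3 * (2 * c * K * a)) - 1 - 2 * l : ℤ) : ℝ) / (6 * k) =
          (1 + 2 * l) / (6 * k) := by
        rw [hkR]; push_cast; field_simp; ring
      rw [e]
      exact ⟨by positivity, by rw [div_lt_one (by positivity)]; linarith⟩
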